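/- For $\alpha \in (0,1)$ let $T_\alpha \colon [0,1] \to [0,1]$ be the map \[ T_\alpha(x) = \begin{cases} x(1 + 2^\alpha x^\alpha), & x \in [0,1/2], \\ 2x - 1, & x \in (1/2, 1]. \end{cases} \] For every $\alpha \in (0,1)$ there is exactly one probability measure $\nu_\alpha$ on $[0,1]$ that is $T_\alpha$-invariant and absolutely continuous with respect to Lebesgue measure. Moreover, for every real-valued $\varphi \in C^1[0,1]$ the map \[ \alpha \longmapsto \int_0^1 \varphi \, d\nu_\alpha \] is continuously differentiable on the whole interval $(0,1)$ (in particular also for $\alpha \ge 1/2$). -/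

import Mathlib

open MeasureTheory Set

/-- The Pomeau-Manneville (Liverani-Saussol-Vaienti) map with parameter `α`, to be used on the
interval `[0,1]`, which it maps to itself; its values outside `[0,1]` play no role. -/
noncomputable def lsvMap (α : ℝ) (x : ℝ) : ℝ :=
  if x ≤ 1 / 2 then x * (1 + (2 : ℝ) ^ α * x ^ α) else 2 * x - 1

/-- `ν` is an absolutely continuous invariant probability measure of `lsvMap α` on `[0,1]`.
Measures on `[0,1]` are taken as measures on `ℝ`; absolute continuity with respect to Lebesgue
measure on `[0,1]` forces `ν` to be concentrated on `[0,1]`. -/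
structure IsLSVMeasure (α : ℝ) (ν : Measure ℝ) : Prop where
  isProbabilityMeasure : IsProbabilityMeasure ν
  absolutelyContinuous : ν ≪ volume.restrict (Icc 0 1)
  invariant : MeasurePreserving (lsvMap α) ν ν

open Classical in
/-- The absolutely continuous invariant probability measure `ν_α` of `lsvMap α`
(the zero measure if there is none). -/
noncomputable def lsvMeasure (α : ℝ) : Measure ℝ :=
  if h : ∃ ν : Measure ℝ, IsLSVMeasure α ν then h.choose else 0

/-! ### The left inverse branch in the right half-plane -/

/-! The fixed point 0 is neutral, so the plan is to induce. Follow an orbit until it lies in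
(1/2,1], then apply the right branch once. The resulting map of (0,1] has full increasing branches
with inverses f_n(z) = g^n((1+z)/2), where g inverts the left branch.

Everything extends holomorphically. In the coordinate s = 1/(2x) the disc |x-1|<1 is the half-plane
Re s > 1/4, and the left branch lowers Re s. Hence g preserves this disc, and every f_n maps |z-1|<2
into |z-1|<1. The same drift makes (Re s)^α grow at least linearly along the iterates of g, so g^n =
O(n^(-1/α)). This is summable precisely because α < 1; the parameter derivative of g^n loses only an
arbitrarily small power and stays summable (`exists_summable_bound_leftInvIter`).

The transfer operator acts on distribution functions, U ↦ ∑ (U∘f_n - U(f_n 0)), for continuous U on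
the circle |ζ-1| = 3/2 extended inwards by Cauchy's integral. In this form only f_n itself has to be
summable, not its derivative. The branches stay well inside the circle, so the operator is an
absolutely convergent sum of rank one operators, hence compact, and it is C¹ in α in operator norm.

A rank one correction removes the eigenvalue 1 and gives `resolvOp`. It is injective by positivity:
a real analytic fixed density either vanishes or has a strict sign, by the equality case of the
triangle inequality. The Fredholm alternative then makes it invertible, and smoothness of inversion
makes the induced distribution function D = `distFun α` a C¹ function of α.

Going back, H(t) = ∑ D(g^k t) is the distribution function of a `lsvMap α`-invariant measure,
unnormalized. Ergodicity follows from the same invertibility: every exponential minus its mean is of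
the form u - Pu, where P is the induced transfer operator on densities, so its integral over any
invariant set is 0, and Lebesgue measure on such a set is a multiple of Lebesgue measure on (0,1].
Ergodicity and positivity of the density give uniqueness. Finally ∫ φ dν = φ(1) - ∫ φ'(t) H(t)/H(1)
dt, which is differentiated under the integral sign. -/

theorem re_exp_neg_mul_pos {α : ℝ} (hα : α ∈ Ioo (0 : ℝ) 1) {l : ℂ} (hl : |l.im| < Real.pi / 2) :
    0 < (Complex.exp (-α * l)).re := by
  rw [Complex.exp_re]
  refine mul_pos (Real.exp_pos _) (Real.cos_pos_of_mem_Ioo ?_)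
  have h1 : (-(α : ℂ) * l).im = -(α * l.im) := by simp
  rw [h1]
  have h2 : |α * l.im| < Real.pi / 2 := by
    rw [abs_mul, abs_of_pos hα.1]
    nlinarith [hα.1, hα.2, abs_nonneg l.im, Real.pi_pos]
  have := abs_lt.1 h2
  constructor <;> linarith

theorem norm_div_one_add_le {p : ℂ} (hp : 0 < p.re) : ‖p / (1 + p)‖ ≤ 1 := by
  rw [norm_div]
  refine div_le_one_of_le₀ ?_ (norm_nonneg _)
  rw [← sq_le_sq₀ (norm_nonneg _) (norm_nonneg _), Complex.sq_norm, Complex.sq_norm,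
    Complex.normSq_apply, Complex.normSq_apply]
  simp
  nlinarith

/-- `log (1 + exp (-α l))`, the displacement of the left branch in the coordinate `-log (2 x)`. -/
noncomputable def logShift (α : ℝ) (l : ℂ) : ℂ := Complex.log (1 + Complex.exp (-α * l))

theorem exp_logShift {α : ℝ} (hα : α ∈ Ioo (0 : ℝ) 1) {l : ℂ} (hl : |l.im| < Real.pi / 2) :
    Complex.exp (logShift α l) = 1 + Complex.exp (-α * l) := by
  refine Complex.exp_log fun h => ?_
  have := congrArg Complex.re h
  have h2 := re_exp_neg_mul_pos hα hl
  rw [Complex.add_re] at this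
  simp only [Complex.one_re, Complex.zero_re] at this
  linarith

theorem hasDerivAt_logShift {α : ℝ} (hα : α ∈ Ioo (0 : ℝ) 1) {l : ℂ} (hl : |l.im| < Real.pi / 2) :
    HasDerivAt (logShift α)
      (-α * (Complex.exp (-α * l) / (1 + Complex.exp (-α * l)))) l := by
  have hp := re_exp_neg_mul_pos hα hl
  have h1 : HasDerivAt (fun l : ℂ => 1 + Complex.exp (-α * l)) (Complex.exp (-α * l) * (-α * 1)) l :=
    (((hasDerivAt_id l).const_mul (-(α : ℂ))).cexp).const_add 1
  have h2 := h1.clog (Or.inl (by rw [Complex.add_re, Complex.one_re]; linarith))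
  refine h2.congr_deriv ?_
  ring

/-- With p = exp(-αl) in the right half-plane, |p/(1+p)| ≤ 1 bounds the derivative by α on the
convex strip. In the coordinate l = -log(2x) the left branch is l - `logShift α l`, so it is the
identity minus a contraction. -/
theorem norm_logShift_sub_le {α : ℝ} (hα : α ∈ Ioo (0 : ℝ) 1) {l₁ l₂ : ℂ}
    (h₁ : |l₁.im| < Real.pi / 2) (h₂ : |l₂.im| < Real.pi / 2) :
    ‖logShift α l₁ - logShift α l₂‖ ≤ α * ‖l₁ - l₂‖ := by
  have hconv : Convex ℝ {l : ℂ | |l.im| < Real.pi / 2} := by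
    have : {l : ℂ | |l.im| < Real.pi / 2} = Complex.imLm ⁻¹' (Ioo (-(Real.pi / 2)) (Real.pi / 2)) := by
      ext l; simp [abs_lt]
    rw [this]
    exact (convex_Ioo _ _).linear_preimage _
  refine hconv.norm_image_sub_le_of_norm_hasDerivWithin_le
    (fun l hl => (hasDerivAt_logShift hα hl).hasDerivWithinAt) (fun l hl => ?_) h₂ h₁
  rw [norm_mul]
  have := norm_div_one_add_le (re_exp_neg_mul_pos hα hl)
  have h3 : ‖(-α : ℂ)‖ = α := by simp [abs_of_pos hα.1]
  rw [h3]
  nlinarith [hα.1]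

theorem abs_im_logShift_le {α : ℝ} (hα : α ∈ Ioo (0 : ℝ) 1) {l : ℂ} (hl : |l.im| < Real.pi / 2) :
    |(logShift α l).im| ≤ α * |l.im| := by
  have h0 : (logShift α (l.re : ℂ)).im = 0 := by
    have : logShift α (l.re : ℂ) = ((Real.log (1 + Real.exp (-α * l.re)) : ℝ) : ℂ) := by
      rw [logShift, Complex.ofReal_log (by positivity)]
      push_cast; rfl
    rw [this, Complex.ofReal_im]
  have h1 := norm_logShift_sub_le hα hl (l₂ := (l.re : ℂ)) (by simp [Real.pi_pos])
  have h2 := (Complex.abs_im_le_norm _).trans h1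
  rw [Complex.sub_im, h0, sub_zero] at h2
  refine h2.trans_eq ?_
  congr 1
  have : l - (l.re : ℂ) = (l.im : ℂ) * Complex.I := by
    apply Complex.ext <;> simp
  rw [this, norm_mul]; simp

/-- The shift moves imaginary parts towards 0. This keeps the iteration of `exists_sub_logShift_eq`
in a closed horizontal strip. -/
theorem im_logShift_nonpos {α : ℝ} (hα : α ∈ Ioo (0 : ℝ) 1) {l : ℂ} (hl : |l.im| < Real.pi / 2)
    (h : 0 ≤ l.im) : (logShift α l).im ≤ 0 := by
  rw [logShift, Complex.log_im]
  rcases h.eq_or_lt with h0 | h0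
  · have := abs_im_logShift_le hα hl
    rw [← h0, logShift, Complex.log_im] at this
    exact (le_abs_self _).trans (by simpa using this)
  · refine (Complex.arg_neg_iff.2 ?_).le
    rw [Complex.add_im, Complex.one_im, zero_add, Complex.exp_im]
    refine mul_neg_of_pos_of_neg (Real.exp_pos _) ?_
    have h1 : (-(α : ℂ) * l).im = -(α * l.im) := by simp
    rw [h1, Real.sin_neg, neg_lt_zero]
    refine Real.sin_pos_of_pos_of_lt_pi (mul_pos hα.1 h0) ?_
    have := (abs_lt.1 hl).2
    nlinarith [hα.1, hα.2, Real.pi_pos]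

theorem im_logShift_nonneg {α : ℝ} (hα : α ∈ Ioo (0 : ℝ) 1) {l : ℂ} (hl : |l.im| < Real.pi / 2)
    (h : l.im ≤ 0) : 0 ≤ (logShift α l).im := by
  rcases h.eq_or_lt with h0 | h0
  · have := abs_im_logShift_le hα hl
    rw [h0] at this
    simp only [abs_zero, mul_zero] at this
    exact (abs_nonpos_iff.1 this).ge
  rw [logShift, Complex.log_im]
  refine Complex.arg_nonneg_iff.2 ?_
  rw [Complex.add_im, Complex.one_im, zero_add, Complex.exp_im]
  refine mul_nonneg (Real.exp_pos _).le ?_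
  have h1 : (-(α : ℂ) * l).im = α * (-l.im) := by simp
  rw [h1]
  refine (Real.sin_pos_of_pos_of_lt_pi (mul_pos hα.1 (by linarith)) ?_).le
  have := (abs_lt.1 hl).1
  nlinarith [hα.1, hα.2, Real.pi_pos]

/-- Banach's fixed point theorem for l ↦ w + `logShift α l` on the strip between the heights 0 and
Im w. The strip is preserved because the imaginary part of the shift has sign opposite to Im l and
modulus at most α|Im l|. -/
theorem exists_sub_logShift_eq {α : ℝ} (hα : α ∈ Ioo (0 : ℝ) 1) {w : ℂ} (hw : |w.im| < Real.pi / 2) :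
    ∃ l : ℂ, |l.im| < Real.pi / 2 ∧ l - logShift α l = w := by
  set R : Set ℂ := Complex.im ⁻¹' (uIcc 0 w.im) with hR
  have hRs : ∀ l ∈ R, |l.im| < Real.pi / 2 := by
    intro l hl
    refine lt_of_le_of_lt ?_ hw
    have := abs_sub_left_of_mem_uIcc hl
    simpa using this
  have hcl : IsComplete R := ((isClosed_Icc (a := 0 ⊓ w.im)).preimage Complex.continuous_im).isComplete
  have hmaps : MapsTo (fun l => w + logShift α l) R R := by
    intro l hl
    have hl' := hRs l hl
    have h1 := abs_im_logShift_le hα hl'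
    change l.im ∈ uIcc 0 w.im at hl
    change (w + logShift α l).im ∈ uIcc 0 w.im
    rw [Complex.add_im]
    rcases le_total 0 w.im with h | h
    · rw [uIcc_of_le h] at hl ⊢
      have h2 := im_logShift_nonpos hα hl' hl.1
      have h3 := hl.2
      rw [abs_of_nonneg hl.1, abs_of_nonpos h2] at h1
      constructor <;> nlinarith [hα.1, hα.2, hl.1]
    · rw [uIcc_of_ge h] at hl ⊢
      have h2 := im_logShift_nonneg hα hl' hl.2
      have h3 := hl.1
      rw [abs_of_nonpos hl.2, abs_of_nonneg h2] at h1
      constructor <;> nlinarith [hα.1, hα.2, hl.2]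
  have hc : ContractingWith ⟨α, hα.1.le⟩ (hmaps.restrict _ R R) := by
    refine ⟨by exact_mod_cast hα.2, LipschitzWith.of_dist_le_mul fun x y => ?_⟩
    change dist (w + logShift α x) (w + logShift α y) ≤ α * dist (x : ℂ) y
    rw [dist_add_left, dist_eq_norm, dist_eq_norm]
    exact norm_logShift_sub_le hα (hRs _ x.2) (hRs _ y.2)
  obtain ⟨l, hl, hfix, -⟩ := hc.exists_fixedPoint' hcl hmaps (x := w) (by simp [hR])
    (edist_ne_top _ _)
  refine ⟨l, hRs l hl, ?_⟩
  have : w + logShift α l = l := hfix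
  rw [sub_eq_iff_eq_add, this]

theorem eq_of_sub_logShift_eq {α : ℝ} (hα : α ∈ Ioo (0 : ℝ) 1) {l₁ l₂ : ℂ}
    (h₁ : |l₁.im| < Real.pi / 2) (h₂ : |l₂.im| < Real.pi / 2)
    (h : l₁ - logShift α l₁ = l₂ - logShift α l₂) : l₁ = l₂ := by
  have h3 := norm_logShift_sub_le hα h₁ h₂
  have h4 : logShift α l₁ - logShift α l₂ = l₁ - l₂ := by linear_combination -h
  rw [h4] at h3
  have : ‖l₁ - l₂‖ = 0 := by nlinarith [norm_nonneg (l₁ - l₂), hα.2]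
  exact sub_eq_zero.1 (norm_eq_zero.1 this)

/-! ### The left branch and its holomorphic inverse -/

/-- The left branch of `lsvMap α` as a function on the right half-plane. -/
noncomputable def leftBranch (α : ℝ) (x : ℂ) : ℂ := x * (1 + (2 * x) ^ (α : ℂ))

theorem abs_im_log_lt {x : ℂ} (hx : 0 < x.re) : |(Complex.log x).im| < Real.pi / 2 := by
  rw [Complex.log_im, Complex.abs_arg_lt_pi_div_two_iff]
  exact Or.inl hx

theorem two_mul_re_pos {x : ℂ} (hx : 0 < x.re) : 0 < (2 * x).re := by simpa using hx

theorem ne_zero_of_re_pos' {x : ℂ} (hx : 0 < x.re) : x ≠ 0 := by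
  rintro rfl; simp at hx

theorem cpow_two_mul_eq {α : ℝ} {x : ℂ} (hx : 0 < x.re) :
    (2 * x) ^ (α : ℂ) = Complex.exp (-α * (-Complex.log (2 * x))) := by
  rw [Complex.cpow_def_of_ne_zero (ne_zero_of_re_pos' (two_mul_re_pos hx))]
  congr 1; ring

theorem re_cpow_two_mul_pos {α : ℝ} (hα : α ∈ Ioo (0 : ℝ) 1) {x : ℂ} (hx : 0 < x.re) :
    0 < ((2 * x) ^ (α : ℂ)).re := by
  rw [cpow_two_mul_eq hx]
  exact re_exp_neg_mul_pos hα (by simpa using abs_im_log_lt (two_mul_re_pos hx))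

/-- Exponentiated, this is the definition of `leftBranch`. The principal logarithm undoes the
exponential because the new imaginary part is below (1+α)π/2 < π, although the image may leave the
right half-plane. -/
theorem neg_log_leftBranch {α : ℝ} (hα : α ∈ Ioo (0 : ℝ) 1) {x : ℂ} (hx : 0 < x.re) :
    -Complex.log (2 * leftBranch α x) =
      -Complex.log (2 * x) - logShift α (-Complex.log (2 * x)) := by
  have h2 := two_mul_re_pos hx
  have him : |(-Complex.log (2 * x)).im| < Real.pi / 2 := by simpa using abs_im_log_lt h2
  set l := -Complex.log (2 * x) with hl
  have hexp : 2 * leftBranch α x = Complex.exp (-(l - logShift α l)) := by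
    rw [neg_sub, Complex.exp_sub, exp_logShift hα him, leftBranch, cpow_two_mul_eq hx, ← hl]
    have : Complex.exp l = (2 * x)⁻¹ := by
      rw [hl, Complex.exp_neg, Complex.exp_log (ne_zero_of_re_pos' h2)]
    rw [this, div_inv_eq_mul]; ring
  have h3 := abs_im_logShift_le hα him
  have h4 : |(-(l - logShift α l)).im| < Real.pi := by
    rw [Complex.neg_im, abs_neg, Complex.sub_im]
    refine (abs_sub _ _).trans_lt ?_
    nlinarith [hα.1, hα.2, abs_nonneg l.im]
  rw [hexp, Complex.log_exp (abs_lt.1 h4).1 (abs_lt.1 h4).2.le, neg_neg]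

theorem exists_leftBranch_eq {α : ℝ} (hα : α ∈ Ioo (0 : ℝ) 1) {y : ℂ} (hy : 0 < y.re) :
    ∃ x : ℂ, 0 < x.re ∧ leftBranch α x = y := by
  have h2 := two_mul_re_pos hy
  obtain ⟨l, hl, hlw⟩ := exists_sub_logShift_eq hα (w := -Complex.log (2 * y))
    (by simpa using abs_im_log_lt h2)
  have hx : 0 < (Complex.exp (-l) / 2).re := by
    rw [show Complex.exp (-l) / 2 = ((1 / 2 : ℝ) : ℂ) * Complex.exp (-l) by push_cast; ring,
      Complex.re_ofReal_mul, Complex.exp_re]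
    refine mul_pos (by norm_num) (mul_pos (Real.exp_pos _) (Real.cos_pos_of_mem_Ioo ?_))
    have := abs_lt.1 hl
    rw [Complex.neg_im]
    constructor <;> linarith
  refine ⟨Complex.exp (-l) / 2, hx, ?_⟩
  have hlog : -Complex.log (2 * (Complex.exp (-l) / 2)) = l := by
    rw [mul_div_cancel₀ _ two_ne_zero, Complex.log_exp, neg_neg]
    · have := abs_lt.1 hl; rw [Complex.neg_im]; linarith [Real.pi_pos]
    · have := abs_lt.1 hl; rw [Complex.neg_im]; linarith [Real.pi_pos]
  have h3 := neg_log_leftBranch hα hx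
  rw [hlog, hlw, neg_inj] at h3
  have hne : leftBranch α (Complex.exp (-l) / 2) ≠ 0 := by
    refine mul_ne_zero (ne_zero_of_re_pos' hx) (ne_zero_of_re_pos' ?_)
    rw [Complex.add_re, Complex.one_re]
    linarith [re_cpow_two_mul_pos hα hx]
  have h4 := congrArg Complex.exp h3
  rw [Complex.exp_log (mul_ne_zero two_ne_zero hne), Complex.exp_log (ne_zero_of_re_pos' h2)] at h4
  exact mul_left_cancel₀ two_ne_zero h4

theorem leftBranch_injOn {α : ℝ} (hα : α ∈ Ioo (0 : ℝ) 1) : InjOn (leftBranch α) {x | 0 < x.re} := by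
  intro x hx y hy h
  have h1 := neg_log_leftBranch hα hx
  rw [h, neg_log_leftBranch hα hy] at h1
  have h2 := eq_of_sub_logShift_eq hα (by simpa using abs_im_log_lt (two_mul_re_pos hy))
    (by simpa using abs_im_log_lt (two_mul_re_pos hx)) h1
  have h3 := congrArg Complex.exp (neg_inj.1 h2)
  rw [Complex.exp_log (ne_zero_of_re_pos' (two_mul_re_pos hx)),
    Complex.exp_log (ne_zero_of_re_pos' (two_mul_re_pos hy))] at h3
  exact (mul_left_cancel₀ two_ne_zero h3).symm

open Classical in
/-- The inverse of `leftBranch α` on the right half-plane. -/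
noncomputable def leftInv (α : ℝ) (y : ℂ) : ℂ :=
  if h : ∃ x : ℂ, 0 < x.re ∧ leftBranch α x = y then h.choose else 0

theorem leftInv_re_pos {α : ℝ} (hα : α ∈ Ioo (0 : ℝ) 1) {y : ℂ} (hy : 0 < y.re) :
    0 < (leftInv α y).re := by
  have h := exists_leftBranch_eq hα hy
  rw [leftInv, dif_pos h]; exact h.choose_spec.1

theorem leftBranch_leftInv {α : ℝ} (hα : α ∈ Ioo (0 : ℝ) 1) {y : ℂ} (hy : 0 < y.re) :
    leftBranch α (leftInv α y) = y := by
  have h := exists_leftBranch_eq hα hy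
  rw [leftInv, dif_pos h]; exact h.choose_spec.2

theorem leftInv_eq {α : ℝ} (hα : α ∈ Ioo (0 : ℝ) 1) {x y : ℂ} (hx : 0 < x.re) (hy : 0 < y.re)
    (h : leftBranch α x = y) : leftInv α y = x :=
  leftBranch_injOn hα (leftInv_re_pos hα hy) hx ((leftBranch_leftInv hα hy).trans h.symm)

theorem leftBranch_eventuallyEq {q : ℝ × ℂ} (hq : 0 < q.2.re) :
    (fun p : ℝ × ℂ => leftBranch p.1 p.2) =ᶠ[nhds q]
      fun p => p.2 * (1 + Complex.exp (Complex.log (2 * p.2) * p.1)) := by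
  have : ∀ᶠ p : ℝ × ℂ in nhds q, 0 < p.2.re :=
    (Complex.continuous_re.comp continuous_snd).continuousAt.eventually_const_lt hq
  filter_upwards [this] with p hp
  rw [leftBranch, Complex.cpow_def_of_ne_zero (ne_zero_of_re_pos' (two_mul_re_pos hp))]

theorem contDiffAt_leftBranch {q : ℝ × ℂ} (hq : 0 < q.2.re) :
    ContDiffAt ℝ 1 (fun p : ℝ × ℂ => leftBranch p.1 p.2) q := by
  refine ContDiffAt.congr_of_eventuallyEq ?_ (leftBranch_eventuallyEq hq)
  have h1 : ContDiffAt ℝ 1 (fun p : ℝ × ℂ => Complex.log (2 * p.2)) q := by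
    refine ContDiffAt.comp q (g := Complex.log) (f := fun p : ℝ × ℂ => 2 * p.2) ?_ (by fun_prop)
    exact (Complex.contDiffAt_log (Or.inl (two_mul_re_pos hq))).restrict_scalars ℝ
  have h2 : ContDiffAt ℝ 1 (fun p : ℝ × ℂ => (p.1 : ℂ)) q :=
    (Complex.ofRealCLM.contDiff.comp contDiff_fst).contDiffAt
  exact contDiffAt_snd.mul (contDiffAt_const.add (h1.mul h2).cexp)

theorem hasDerivAt_leftBranch (α : ℝ) {x : ℂ} (hx : 0 < x.re) :
    HasDerivAt (leftBranch α) (1 + (1 + α) * (2 * x) ^ (α : ℂ)) x := by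
  have h2 := two_mul_re_pos hx
  have h1 : HasDerivAt (fun x : ℂ => 2 * x) 2 x := by simpa using (hasDerivAt_id x).const_mul 2
  have h3 := (hasDerivAt_id x).mul ((h1.cpow_const (c := (α : ℂ)) (Or.inl h2)).const_add 1)
  refine h3.congr_deriv ?_
  have hne : 2 * x ≠ 0 := ne_zero_of_re_pos' h2
  have hx0 : x ≠ 0 := ne_zero_of_re_pos' hx
  simp only [id]
  rw [Complex.cpow_sub _ _ hne, Complex.cpow_one]
  field_simp
  ring

theorem deriv_leftBranch_re_pos {α : ℝ} (hα : α ∈ Ioo (0 : ℝ) 1) {x : ℂ} (hx : 0 < x.re) :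
    0 < (1 + (1 + α) * (2 * x) ^ (α : ℂ)).re := by
  have := re_cpow_two_mul_pos hα hx
  rw [show (1 + (1 + α) * (2 * x) ^ (α : ℂ)) =
    ((1 : ℝ) : ℂ) + ((1 + α : ℝ) : ℂ) * (2 * x) ^ (α : ℂ) by push_cast; rfl, Complex.add_re,
    Complex.re_ofReal_mul, Complex.ofReal_re]
  have := hα.1
  positivity

/-- Implicit function theorem for `leftBranch a x - y = 0` with (a, y) as parameter. The derivative
in x is multiplication by a number of positive real part, hence invertible over ℝ; injectivity on
the half-plane identifies the implicit function with `leftInv`. -/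
theorem contDiffAt_leftInv {q : ℝ × ℂ} (hα : q.1 ∈ Ioo (0 : ℝ) 1) (hq : 0 < q.2.re) :
    ContDiffAt ℝ 1 (fun p : ℝ × ℂ => leftInv p.1 p.2) q := by
  obtain ⟨α, y⟩ := q
  set x := leftInv α y with hx
  have hxre : 0 < x.re := leftInv_re_pos hα hq
  set f : (ℝ × ℂ) × ℂ → ℂ := fun v => leftBranch v.1.1 v.2 - v.1.2 with hf
  set u : (ℝ × ℂ) × ℂ := ((α, y), x) with hu
  have hcd : ContDiffAt ℝ 1 f u := by
    refine ContDiffAt.sub ?_ (by fun_prop)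
    exact ContDiffAt.comp u (g := fun p : ℝ × ℂ => leftBranch p.1 p.2)
      (f := fun v : (ℝ × ℂ) × ℂ => (v.1.1, v.2)) (contDiffAt_leftBranch (q := (α, x)) hxre)
      (by fun_prop)
  set D : ℂ := 1 + (1 + α) * (2 * x) ^ (α : ℂ) with hD
  have hD0 : D ≠ 0 := ne_zero_of_re_pos' (deriv_leftBranch_re_pos hα hxre)
  have hinr : ∀ z : ℂ, (fderiv ℝ f u ∘L .inr ℝ (ℝ × ℂ) ℂ) z = D * z := by
    have h1 : HasFDerivAt (fun z : ℂ => f ((α, y), z)) (fderiv ℝ f u ∘L .inr ℝ (ℝ × ℂ) ℂ) x :=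
      HasFDerivAt.comp x (f := fun z : ℂ => (((α, y), z) : (ℝ × ℂ) × ℂ))
        (hcd.differentiableAt one_ne_zero).hasFDerivAt (hasFDerivAt_prodMk_right (α, y) x)
    have h2 : HasFDerivAt (fun z : ℂ => f ((α, y), z))
        ((ContinuousLinearMap.toSpanSingleton ℂ D).restrictScalars ℝ) x :=
      ((hasDerivAt_leftBranch α hxre).sub_const y).hasFDerivAt.restrictScalars ℝ
    intro z
    rw [h1.unique h2]
    simp [mul_comm]
  have hinv : (fderiv ℝ f u ∘L .inr ℝ (ℝ × ℂ) ℂ).IsInvertible := by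
    refine ContinuousLinearMap.IsInvertible.of_inverse (g := ContinuousLinearMap.mul ℝ ℂ D⁻¹) ?_ ?_
    · ext z
      simp only [ContinuousLinearMap.comp_apply (fderiv ℝ f u ∘L .inr ℝ (ℝ × ℂ) ℂ), hinr]
      simp [hD0]
    · ext z
      rw [ContinuousLinearMap.comp_apply, hinr]
      simp [hD0]
  have hf0 : f u = 0 := sub_eq_zero.2 (leftBranch_leftInv hα hq)
  have h3 := hcd.eventually_apply_implicitFunction one_ne_zero hinv
  have h4 := hcd.contDiffAt_implicitFunction one_ne_zero hinv
  have h5 := hcd.implicitFunction_apply_self one_ne_zero hinv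
  rw [hf0] at h3
  refine h4.congr_of_eventuallyEq ?_
  have h6 : ∀ᶠ p : ℝ × ℂ in nhds (α, y), 0 < (hcd.implicitFunction one_ne_zero hinv p).re := by
    refine (Complex.continuous_re.continuousAt.comp h4.continuousAt).eventually_const_lt ?_
    change 0 < (hcd.implicitFunction one_ne_zero hinv u.1).re
    rw [h5]; exact hxre
  have h7 : ∀ᶠ p : ℝ × ℂ in nhds (α, y), 0 < p.2.re :=
    (Complex.continuous_re.comp continuous_snd).continuousAt.eventually_const_lt hq
  have h8 : ∀ᶠ p : ℝ × ℂ in nhds (α, y), p.1 ∈ Ioo (0 : ℝ) 1 :=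
    continuous_fst.continuousAt.eventually_mem (isOpen_Ioo.mem_nhds hα)
  filter_upwards [h3, h6, h7, h8] with p hp3 hp6 hp7 hp8
  exact leftInv_eq hp8 hp6 hp7 (sub_eq_zero.1 hp3)

theorem hasDerivAt_leftInv {α : ℝ} (hα : α ∈ Ioo (0 : ℝ) 1) {y : ℂ} (hy : 0 < y.re) :
    HasDerivAt (leftInv α) (1 + (1 + α) * (2 * leftInv α y) ^ (α : ℂ))⁻¹ y := by
  have hx := leftInv_re_pos hα hy
  refine HasDerivAt.of_local_left_inverse ?_ (hasDerivAt_leftBranch α hx)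
    (ne_zero_of_re_pos' (deriv_leftBranch_re_pos hα hx)) ?_
  · exact ContinuousAt.comp (f := fun y : ℂ => (α, y)) (g := fun p : ℝ × ℂ => leftInv p.1 p.2)
      (contDiffAt_leftInv (q := (α, y)) hα hy).continuousAt (by fun_prop)
  · filter_upwards [Complex.continuous_re.continuousAt.eventually_const_lt hy] with z hz
    exact leftBranch_leftInv hα hz

/-! ### Drift of the left branch in the coordinate 1/(2x) -/

/-- The real part of `1 / (2 x)`. -/
noncomputable def invRe (x : ℂ) : ℝ := ((2 * x)⁻¹).re

theorem invRe_eq (x : ℂ) : invRe x = x.re / (2 * Complex.normSq x) := by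
  rw [invRe, Complex.inv_re, Complex.normSq_mul]
  norm_num
  rw [mul_div_mul_comm]
  rcases eq_or_ne (Complex.normSq x) 0 with h | h
  · simp [h]
  · field_simp; norm_num

/-- Inversion turns the circle |x-1| = 1, which passes through 0, into the line Re 1/(2x) = 1/4 and
sends the neutral fixed point to infinity. -/
theorem mem_ball_iff_invRe {x : ℂ} : x ∈ Metric.ball (1 : ℂ) 1 ↔ 1 / 4 < invRe x := by
  rw [mem_ball_iff_norm, ← sq_lt_sq₀ (norm_nonneg _) zero_le_one, Complex.sq_norm,
    Complex.normSq_apply, invRe_eq, Complex.normSq_apply]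
  rcases eq_or_ne x 0 with rfl | hx
  · simp
  have hpos : 0 < x.re * x.re + x.im * x.im := by
    rw [← Complex.normSq_apply]; exact Complex.normSq_pos.2 hx
  rw [lt_div_iff₀ (by positivity)]
  simp
  constructor <;> intro h <;> nlinarith

theorem re_pos_of_mem_ball {x : ℂ} (hx : x ∈ Metric.ball (1 : ℂ) 1) : 0 < x.re := by
  have h := (Complex.abs_re_le_norm (x - 1)).trans_lt (mem_ball_iff_norm.1 hx)
  have := (abs_lt.1 h).1
  simp at this; linarith

theorem invRe_le_norm (x : ℂ) : invRe x ≤ ‖(2 * x)⁻¹‖ := (le_abs_self _).trans (Complex.abs_re_le_norm _)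

/-- The number (2x)^(α-1) has argument at most (1-α)π/2 in modulus, and the cosine of that angle is
at least 1-(1-α) = α, by the chord bound for the cosine on [0, π/2]. -/
theorem rpow_mul_le_re {α : ℝ} (hα : α ∈ Ioo (0 : ℝ) 1) {x : ℂ} (hx : 0 < x.re) :
    α * ‖(2 * x)⁻¹‖ ^ (1 - α) ≤ ((2 * x)⁻¹ * (2 * x) ^ (α : ℂ)).re := by
  have h2 := two_mul_re_pos hx
  have hne := ne_zero_of_re_pos' h2
  set l := Complex.log (2 * x) with hl
  have h3 : (2 * x)⁻¹ * (2 * x) ^ (α : ℂ) = Complex.exp (((-(1 - α) : ℝ) : ℂ) * l) := by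
    rw [Complex.cpow_def_of_ne_zero hne]
    nth_rewrite 1 [← Complex.exp_log hne]
    rw [← Complex.exp_neg, ← Complex.exp_add]
    congr 1
    push_cast; ring
  have h4 : ‖(2 * x)⁻¹‖ ^ (1 - α) = Real.exp (-(1 - α) * l.re) := by
    rw [hl, Complex.log_re, norm_inv, Real.inv_rpow (norm_nonneg _),
      ← Real.rpow_neg (norm_nonneg _), Real.rpow_def_of_pos (norm_pos_iff.2 hne)]
    congr 1; ring
  rw [h3, h4, Complex.exp_re, Complex.re_ofReal_mul, Complex.im_ofReal_mul, mul_comm α]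
  refine mul_le_mul_of_nonneg_left ?_ (Real.exp_pos _).le
  have him := (abs_im_log_lt h2).le
  rw [neg_mul, Real.cos_neg, ← Real.cos_abs, abs_mul, abs_of_pos (by linarith [hα.2] : 0 < 1 - α)]
  have h5 : (1 - α) * |l.im| ≤ (1 - α) * (Real.pi / 2) :=
    mul_le_mul_of_nonneg_left him (by linarith [hα.2])
  have h6 := Real.one_sub_mul_le_cos (x := (1 - α) * |l.im|)
    (mul_nonneg (by linarith [hα.2]) (abs_nonneg _)) (by nlinarith [hα.1, Real.pi_pos])
  refine le_trans ?_ h6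
  have h7 : 2 / Real.pi * ((1 - α) * |l.im|) ≤ 2 / Real.pi * ((1 - α) * (Real.pi / 2)) :=
    mul_le_mul_of_nonneg_left h5 (by positivity)
  have h8 : 2 / Real.pi * ((1 - α) * (Real.pi / 2)) = 1 - α := by field_simp
  linarith

/-- With s = 1/(2x) and p = (2x)^α the branch reads s ↦ s/(1+p), and s - s/(1+p) = sp/(1+p) = (sp +
s|p|²)/|1+p|². Both terms of the numerator have positive real part. -/
theorem inv_leftBranch_sub {α : ℝ} (hα : α ∈ Ioo (0 : ℝ) 1) {x : ℂ} (hx : 0 < x.re) :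
    invRe x - invRe (leftBranch α x) =
      (((2 * x)⁻¹ * (2 * x) ^ (α : ℂ)).re + Complex.normSq ((2 * x) ^ (α : ℂ)) * invRe x) /
        Complex.normSq (1 + (2 * x) ^ (α : ℂ)) := by
  set p := (2 * x) ^ (α : ℂ) with hp
  set s := (2 * x)⁻¹ with hs
  have h1 : (2 * leftBranch α x)⁻¹ = s / (1 + p) := by
    rw [leftBranch, ← mul_assoc, mul_inv, ← hs, ← hp, div_eq_mul_inv]
  have hne : 1 + p ≠ 0 := by
    refine ne_zero_of_re_pos' ?_
    rw [Complex.add_re, Complex.one_re]; linarith [re_cpow_two_mul_pos hα hx]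
  have hpos := Complex.normSq_pos.2 hne
  rw [eq_div_iff hpos.ne']
  have h2 : invRe x = s.re := rfl
  have h3 : invRe (leftBranch α x) = (s / (1 + p)).re := by rw [invRe, h1]
  rw [h2, h3, Complex.div_re, sub_mul, add_mul, div_mul_cancel₀ _ hpos.ne',
    div_mul_cancel₀ _ hpos.ne']
  simp [Complex.normSq_apply]
  ring

theorem invRe_pos {x : ℂ} (hx : 0 < x.re) : 0 < invRe x := by
  rw [invRe_eq]
  exact div_pos hx (mul_pos two_pos (Complex.normSq_pos.2 (ne_zero_of_re_pos' hx)))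

theorem norm_cpow_two_mul (α : ℝ) {x : ℂ} (hx : 0 < x.re) :
    ‖(2 * x) ^ (α : ℂ)‖ = ‖(2 * x)⁻¹‖ ^ (-α) := by
  rw [Complex.norm_cpow_of_ne_zero (ne_zero_of_re_pos' (two_mul_re_pos hx)), norm_inv,
    Real.inv_rpow (norm_nonneg _), Real.rpow_neg (norm_nonneg _), inv_inv]
  simp

theorem invRe_leftBranch_lt {α : ℝ} (hα : α ∈ Ioo (0 : ℝ) 1) {x : ℂ} (hx : 0 < x.re) :
    invRe (leftBranch α x) < invRe x := by
  have h := inv_leftBranch_sub hα hx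
  have h1 := rpow_mul_le_re hα hx
  have h2 : 0 < ‖(2 * x)⁻¹‖ :=
    norm_pos_iff.2 (inv_ne_zero (ne_zero_of_re_pos' (two_mul_re_pos hx)))
  have h3 : 0 < α * ‖(2 * x)⁻¹‖ ^ (1 - α) := mul_pos hα.1 (Real.rpow_pos_of_pos h2 _)
  rw [← sub_pos, h]
  refine div_pos ?_ (Complex.normSq_pos.2 (ne_zero_of_re_pos' ?_))
  · have := mul_nonneg (Complex.normSq_nonneg ((2 * x) ^ (α : ℂ))) (invRe_pos hx).le
    linarith
  · rw [Complex.add_re, Complex.one_re]; linarith [re_cpow_two_mul_pos hα hx]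

/-- When Re s ≥ 1/4, |p| = |s|^(-α) ≤ 4, so the denominator |1+p|² is at most 25. -/
theorem invRe_leftBranch_add_le {α : ℝ} (hα : α ∈ Ioo (0 : ℝ) 1) {x : ℂ} (hx : 0 < x.re)
    (h4 : 1 / 4 ≤ invRe x) :
    invRe (leftBranch α x) + α / 25 * ‖(2 * x)⁻¹‖ ^ (1 - α) ≤ invRe x := by
  have h := inv_leftBranch_sub hα hx
  have h1 := rpow_mul_le_re hα hx
  set r := ‖(2 * x)⁻¹‖ with hr
  have hr4 : 1 / 4 ≤ r := h4.trans (invRe_le_norm x)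
  have hp : ‖(2 * x) ^ (α : ℂ)‖ ≤ 4 := by
    rw [norm_cpow_two_mul α hx, ← hr, Real.rpow_neg (by linarith), ← Real.inv_rpow (by linarith)]
    have h5 : r⁻¹ ≤ 4 := by rw [inv_le_comm₀ (by linarith) (by norm_num)]; linarith
    calc r⁻¹ ^ α ≤ 4 ^ α := Real.rpow_le_rpow (by positivity) h5 hα.1.le
      _ ≤ 4 ^ (1 : ℝ) := Real.rpow_le_rpow_of_exponent_le (by norm_num) hα.2.le
      _ = 4 := Real.rpow_one _
  have hn : Complex.normSq (1 + (2 * x) ^ (α : ℂ)) ≤ 25 := by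
    rw [← Complex.sq_norm]
    have := (norm_add_le (1 : ℂ) ((2 * x) ^ (α : ℂ)))
    rw [norm_one] at this
    nlinarith [norm_nonneg (1 + (2 * x) ^ (α : ℂ))]
  have hn0 : 0 < Complex.normSq (1 + (2 * x) ^ (α : ℂ)) := by
    refine Complex.normSq_pos.2 (ne_zero_of_re_pos' ?_)
    rw [Complex.add_re, Complex.one_re]; linarith [re_cpow_two_mul_pos hα hx]
  have hq : 0 ≤ α * r ^ (1 - α) := mul_nonneg hα.1.le (Real.rpow_nonneg (norm_nonneg _) _)
  have h6 : α * r ^ (1 - α) / 25 ≤ invRe x - invRe (leftBranch α x) := by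
    rw [h]
    refine div_le_div₀ ?_ ?_ hn0 hn
    · have := mul_nonneg (Complex.normSq_nonneg ((2 * x) ^ (α : ℂ))) (invRe_pos hx).le
      linarith
    · have := mul_nonneg (Complex.normSq_nonneg ((2 * x) ^ (α : ℂ))) (invRe_pos hx).le
      linarith
  linarith

theorem leftInv_mem_ball {α : ℝ} (hα : α ∈ Ioo (0 : ℝ) 1) {y : ℂ} (hy : y ∈ Metric.ball (1 : ℂ) 1) :
    leftInv α y ∈ Metric.ball (1 : ℂ) 1 := by
  have hy0 := re_pos_of_mem_ball hy
  have h := invRe_leftBranch_lt hα (leftInv_re_pos hα hy0)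
  rw [leftBranch_leftInv hα hy0] at h
  rw [mem_ball_iff_invRe] at hy ⊢
  exact hy.trans h

/-- Concavity of the power, via Bernoulli's inequality at y/x. It converts drift estimates into
telescoping ones. -/
theorem mul_rpow_sub_le {e x y : ℝ} (he : 0 ≤ e) (he1 : e ≤ 1) (hy : 0 < y) (hx : y ≤ x) :
    e * (x - y) * x ^ (e - 1) ≤ x ^ e - y ^ e := by
  have hx0 : 0 < x := hy.trans_le hx
  have h1 := rpow_one_add_le_one_add_mul_self (s := y / x - 1) (by have := div_pos hy hx0; linarith)
    he he1
  rw [add_sub_cancel, Real.div_rpow hy.le hx0.le, div_le_iff₀ (Real.rpow_pos_of_pos hx0 e)] at h1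
  have h2 : x ^ e = x ^ (e - 1) * x := by
    rw [← Real.rpow_add_one hx0.ne', sub_add_cancel]
  have h3 : (1 + e * (y / x - 1)) * x ^ e = x ^ e + e * (y - x) * x ^ (e - 1) := by
    rw [h2]; field_simp
  rw [h3] at h1
  linarith

/-! ### Iterates of the inverse branch: decay and parameter derivative -/

/-- The inverse branches of the iterates of the left branch of `lsvMap α`. -/
noncomputable def leftInvIter (α : ℝ) (n : ℕ) : ℂ → ℂ := (leftInv α)^[n]

theorem leftInvIter_zero (α : ℝ) (y : ℂ) : leftInvIter α 0 y = y := rfl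

theorem leftInvIter_succ (α : ℝ) (n : ℕ) (y : ℂ) :
    leftInvIter α (n + 1) y = leftInv α (leftInvIter α n y) := Function.iterate_succ_apply' ..

theorem leftInvIter_succ' (α : ℝ) (n : ℕ) (y : ℂ) :
    leftInvIter α (n + 1) y = leftInvIter α n (leftInv α y) := Function.iterate_succ_apply ..

section
variable {α : ℝ} (hα : α ∈ Ioo (0 : ℝ) 1) {y : ℂ} (hy : y ∈ Metric.ball (1 : ℂ) 1) (n : ℕ)
include hα hy

theorem leftInvIter_mem_ball : leftInvIter α n y ∈ Metric.ball (1 : ℂ) 1 := by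
  induction n with
  | zero => exact hy
  | succ n ih => rw [leftInvIter_succ]; exact leftInv_mem_ball hα ih

theorem leftInvIter_re_pos : 0 < (leftInvIter α n y).re :=
  re_pos_of_mem_ball (leftInvIter_mem_ball hα hy n)

theorem leftBranch_leftInvIter_succ :
    leftBranch α (leftInvIter α (n + 1) y) = leftInvIter α n y := by
  rw [leftInvIter_succ, leftBranch_leftInv hα (leftInvIter_re_pos hα hy n)]

theorem quarter_lt_invRe_leftInvIter : 1 / 4 < invRe (leftInvIter α n y) :=
  mem_ball_iff_invRe.1 (leftInvIter_mem_ball hα hy n)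

theorem invRe_leftInvIter_add_le :
    invRe (leftInvIter α n y) + α / 25 * ‖(2 * leftInvIter α (n + 1) y)⁻¹‖ ^ (1 - α) ≤
      invRe (leftInvIter α (n + 1) y) := by
  have h := invRe_leftBranch_add_le hα (leftInvIter_re_pos hα hy (n + 1))
    (quarter_lt_invRe_leftInvIter hα hy (n + 1)).le
  rwa [leftBranch_leftInvIter_succ hα hy] at h

theorem invRe_leftInvIter_le_succ :
    invRe (leftInvIter α n y) ≤ invRe (leftInvIter α (n + 1) y) := by
  have := invRe_leftInvIter_add_le hα hy n
  have h2 : 0 ≤ α / 25 * ‖(2 * leftInvIter α (n + 1) y)⁻¹‖ ^ (1 - α) := by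
    have := hα.1; positivity
  linarith

/-- A discrete form of s' = s^(1-α). If a ≤ b are consecutive values of Re s, then b - a ≥ (α/25)
b^(1-α), and concavity gives b^α - a^α ≥ α(b-a)b^(α-1) ≥ α²/25. -/
theorem le_rpow_invRe_leftInvIter : α ^ 2 / 25 * (n + 1) ≤ invRe (leftInvIter α n y) ^ α := by
  have hα0 := hα.1
  have hα1 := hα.2
  induction n with
  | zero =>
    have h1 := (quarter_lt_invRe_leftInvIter hα hy 0).le
    have h2 := Real.rpow_le_rpow (by norm_num) h1 hα0.le
    have h3 := Real.rpow_le_rpow_of_exponent_ge (x := 1 / 4) (by norm_num) (by norm_num) hα1.le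
    rw [Real.rpow_one] at h3
    refine le_trans ?_ (h3.trans h2)
    simp only [Nat.cast_zero]
    nlinarith
  | succ n ih =>
    have h1 := invRe_leftInvIter_add_le hα hy n
    have h2 := invRe_leftInvIter_le_succ hα hy n
    have h3 := quarter_lt_invRe_leftInvIter hα hy n
    have h6 := invRe_le_norm (leftInvIter α (n + 1) y)
    set a := invRe (leftInvIter α n y)
    set b := invRe (leftInvIter α (n + 1) y)
    have ha : 0 < a := by linarith
    have hb : 0 < b := by linarith
    have h4 := mul_rpow_sub_le hα0.le hα1.le ha h2
    have h5 : b ^ (1 - α) ≤ ‖(2 * leftInvIter α (n + 1) y)⁻¹‖ ^ (1 - α) :=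
      Real.rpow_le_rpow hb.le h6 (by linarith)
    have h7 : α / 25 * b ^ (1 - α) ≤ b - a := by
      have := mul_le_mul_of_nonneg_left h5 (by positivity : 0 ≤ α / 25)
      linarith
    have h8 : b ^ (1 - α) * b ^ (α - 1) = 1 := by
      rw [← Real.rpow_add hb]; simp
    have h9 : α * (α / 25 * b ^ (1 - α)) * b ^ (α - 1) ≤ α * (b - a) * b ^ (α - 1) := by
      gcongr
    have h10 : α * (α / 25 * b ^ (1 - α)) * b ^ (α - 1) = α ^ 2 / 25 := by
      linear_combination (α ^ 2 / 25) * h8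
    push_cast
    linarith

theorem invRe_leftInvIter_rpow_le {e : ℝ} (he : e ≤ 1) :
    invRe (leftInvIter α n y) ^ (e - 1) ≤ (α ^ 2 / 25 * (n + 1)) ^ (-((1 - e) / α)) := by
  have hα0 := hα.1
  have h1 := le_rpow_invRe_leftInvIter hα hy n
  have h2 := quarter_lt_invRe_leftInvIter hα hy n
  have h3 : invRe (leftInvIter α n y) ^ (e - 1) =
      (invRe (leftInvIter α n y) ^ α) ^ (-((1 - e) / α)) := by
    rw [← Real.rpow_mul (by linarith)]
    congr 1; field_simp; ring
  rw [h3]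
  refine Real.rpow_le_rpow_of_nonpos (by positivity) h1 ?_
  rw [neg_nonpos]
  exact div_nonneg (by linarith) hα0.le

theorem norm_leftInvIter_le_inv : ‖leftInvIter α n y‖ ≤ (invRe (leftInvIter α n y))⁻¹ := by
  have h1 := invRe_le_norm (leftInvIter α n y)
  have h2 := quarter_lt_invRe_leftInvIter hα hy n
  rw [norm_inv, norm_mul] at h1
  have h0 : 0 < ‖leftInvIter α n y‖ :=
    norm_pos_iff.2 (ne_zero_of_re_pos' (leftInvIter_re_pos hα hy n))
  rw [le_inv_comm₀ h0 (by linarith)]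
  refine h1.trans ?_
  gcongr
  simp
  linarith

end

theorem contDiffOn_leftInvIter (n : ℕ) :
    ContDiffOn ℝ 1 (fun p : ℝ × ℂ => leftInvIter p.1 n p.2)
      (Ioo (0 : ℝ) 1 ×ˢ Metric.ball (1 : ℂ) 1) := by
  induction n with
  | zero => exact contDiff_snd.contDiffOn
  | succ n ih =>
    simp only [leftInvIter_succ]
    refine ContDiffOn.comp (t := Ioo (0 : ℝ) 1 ×ˢ Metric.ball (1 : ℂ) 1)
      (g := fun p : ℝ × ℂ => leftInv p.1 p.2) (f := fun p : ℝ × ℂ => (p.1, leftInvIter p.1 n p.2))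
      ?_ (contDiff_fst.contDiffOn.prodMk ih) fun p hp => ⟨hp.1, leftInvIter_mem_ball hp.1 hp.2 n⟩
    exact fun p hp => (contDiffAt_leftInv hp.1 (re_pos_of_mem_ball hp.2)).contDiffWithinAt

theorem differentiableOn_leftInvIter {α : ℝ} (hα : α ∈ Ioo (0 : ℝ) 1) (n : ℕ) :
    DifferentiableOn ℂ (leftInvIter α n) (Metric.ball (1 : ℂ) 1) := by
  induction n with
  | zero => exact differentiableOn_id
  | succ n ih =>
    have : leftInvIter α (n + 1) = leftInv α ∘ leftInvIter α n := by
      ext y; exact leftInvIter_succ ..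
    rw [this]
    refine DifferentiableOn.comp (t := Metric.ball (1 : ℂ) 1) ?_ ih
      fun y hy => leftInvIter_mem_ball hα hy n
    exact fun y hy =>
      (hasDerivAt_leftInv hα (re_pos_of_mem_ball hy)).differentiableAt.differentiableWithinAt

/-- The derivative of `leftInvIter α n y` with respect to the parameter `α`. -/
noncomputable def leftInvIterDot (α : ℝ) (n : ℕ) (y : ℂ) : ℂ :=
  fderiv ℝ (fun p : ℝ × ℂ => leftInvIter p.1 n p.2) (α, y) (1, 0)

theorem hasDerivAt_leftInvIter_param {α : ℝ} (hα : α ∈ Ioo (0 : ℝ) 1) {y : ℂ}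
    (hy : y ∈ Metric.ball (1 : ℂ) 1) (n : ℕ) :
    HasDerivAt (fun a => leftInvIter a n y) (leftInvIterDot α n y) α := by
  have h1 := ((contDiffOn_leftInvIter n).contDiffAt
    ((isOpen_Ioo.prod Metric.isOpen_ball).mem_nhds (show (α, y) ∈ _ from ⟨hα, hy⟩))).differentiableAt
    one_ne_zero
  have h2 : HasFDerivAt (fun a : ℝ => (a, y)) (ContinuousLinearMap.inl ℝ ℝ ℂ) α :=
    hasFDerivAt_prodMk_left α y
  have := (HasFDerivAt.comp α (f := fun a : ℝ => (a, y)) h1.hasFDerivAt h2).hasDerivAt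
  exact this.congr_deriv (by simp [leftInvIterDot])

theorem continuousOn_leftInvIterDot (n : ℕ) :
    ContinuousOn (fun p : ℝ × ℂ => leftInvIterDot p.1 n p.2)
      (Ioo (0 : ℝ) 1 ×ˢ Metric.ball (1 : ℂ) 1) := by
  have h := (contDiffOn_leftInvIter n).continuousOn_fderiv_of_isOpen
    (isOpen_Ioo.prod Metric.isOpen_ball) le_rfl
  exact h.clm_apply continuousOn_const

theorem leftInvIterDot_zero (α : ℝ) {y : ℂ} (hα : α ∈ Ioo (0 : ℝ) 1)
    (hy : y ∈ Metric.ball (1 : ℂ) 1) : leftInvIterDot α 0 y = 0 := by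
  have := hasDerivAt_leftInvIter_param hα hy 0
  simp only [leftInvIter_zero] at this
  exact this.unique (hasDerivAt_const α y)

/-- Differentiation in a of `leftBranch a` at the (n+1)-st iterate, which equals the n-th iterate.
The first summand comes from the moving point, the second from the exponent. -/
theorem leftInvIterDot_succ {α : ℝ} (hα : α ∈ Ioo (0 : ℝ) 1) {y : ℂ}
    (hy : y ∈ Metric.ball (1 : ℂ) 1) (n : ℕ) :
    leftInvIterDot α (n + 1) y * (1 + (1 + α) * (2 * leftInvIter α (n + 1) y) ^ (α : ℂ)) +
      leftInvIter α (n + 1) y * ((2 * leftInvIter α (n + 1) y) ^ (α : ℂ) *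
        Complex.log (2 * leftInvIter α (n + 1) y)) = leftInvIterDot α n y := by
  have hx := leftInvIter_re_pos hα hy (n + 1)
  have h2 := two_mul_re_pos hx
  have hne : 2 * leftInvIter α (n + 1) y ≠ 0 := ne_zero_of_re_pos' h2
  have hd := hasDerivAt_leftInvIter_param hα hy (n + 1)
  have h3 : HasDerivAt (fun a : ℝ => (a : ℂ)) 1 α := Complex.ofRealCLM.hasDerivAt
  have h4 := hd.mul ((((hd.const_mul 2).clog_real (Or.inl h2)).mul h3).cexp.const_add 1)
  have h5 : HasDerivAt (fun a => leftInvIter a n y) (leftInvIterDot α n y) α :=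
    hasDerivAt_leftInvIter_param hα hy n
  have h6 : (fun a => leftInvIter a n y) =ᶠ[nhds α]
      ((fun a => leftInvIter a (n + 1) y) * fun a =>
        1 + Complex.exp (((fun a => Complex.log (2 * leftInvIter a (n + 1) y)) *
          fun a : ℝ => (a : ℂ)) a)) := by
    filter_upwards [isOpen_Ioo.mem_nhds hα] with a ha
    rw [← leftBranch_leftInvIter_succ ha hy, leftBranch, Complex.cpow_def_of_ne_zero
      (ne_zero_of_re_pos' (two_mul_re_pos (leftInvIter_re_pos ha hy (n + 1))))]
    rfl
  have h7 := (h4.congr_of_eventuallyEq h6).unique h5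
  rw [← h7, Complex.cpow_def_of_ne_zero hne]
  simp only [Pi.mul_apply]
  have hx0 := ne_zero_of_re_pos' hx
  field_simp
  ring

/-- Stretching p in the right half-plane moves 1+p away from 0. Consequently the logarithmic
parameter derivative is not amplified from one iterate to the next. -/
theorem one_le_norm_div {α : ℝ} (hα : α ∈ Ioo (0 : ℝ) 1) {p : ℂ} (hp : 0 < p.re) :
    ‖1 + p‖ ≤ ‖1 + (1 + α) * p‖ := by
  have hα0 := hα.1
  rw [← sq_le_sq₀ (norm_nonneg _) (norm_nonneg _), Complex.sq_norm, Complex.sq_norm,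
    Complex.normSq_apply, Complex.normSq_apply]
  have h1 : (1 + (1 + α) * p).re = 1 + (1 + α) * p.re := by simp
  have h2 : (1 + (1 + α) * p).im = (1 + α) * p.im := by simp
  rw [h1, h2]
  simp only [Complex.add_re, Complex.one_re, Complex.add_im, Complex.one_im, zero_add]
  have h3 : 0 ≤ α * p.re := by positivity
  have h4 : p.im * p.im ≤ (1 + α) * p.im * ((1 + α) * p.im) := by
    have h5 := mul_nonneg (mul_self_nonneg p.im) (by nlinarith : 0 ≤ (1 + α) * (1 + α) - 1)
    linarith
  nlinarith

/-- For r ≥ 1, log r ≤ r^e/e. For 1/4 ≤ r ≤ 1 the real part is at most 3 in modulus and the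
imaginary part at most 2, while r^e ≥ 1/4, whence the constant 20. -/
theorem norm_log_le_rpow {e : ℝ} (he : 0 < e) (he1 : e ≤ 1) {x : ℂ} (hx : 0 < x.re)
    (h4 : 1 / 4 ≤ ‖(2 * x)⁻¹‖) :
    ‖Complex.log (2 * x)‖ ≤ (1 / e + 20) * ‖(2 * x)⁻¹‖ ^ e := by
  set r := ‖(2 * x)⁻¹‖ with hr
  have h2 := two_mul_re_pos hx
  have hre : (Complex.log (2 * x)).re = -Real.log r := by
    rw [Complex.log_re, hr, norm_inv, Real.log_inv, neg_neg]
  have him := abs_im_log_lt h2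
  have h1 := Complex.norm_le_abs_re_add_abs_im (Complex.log (2 * x))
  rw [hre, abs_neg] at h1
  have hpi := Real.pi_lt_four
  have he0 : 0 < 1 / e := by positivity
  rcases le_total 1 r with h | h
  · have h5 := Real.log_le_rpow_div (x := r) (by linarith) he
    rw [abs_of_nonneg (Real.log_nonneg h)] at h1
    have h6 : 1 ≤ r ^ e := Real.one_le_rpow h he.le
    rw [div_eq_mul_one_div] at h5
    nlinarith
  · have h7 : 1 / 4 ≤ r ^ e := by
      have := Real.rpow_le_rpow_of_exponent_ge (by linarith) h he1
      rw [Real.rpow_one] at this; linarith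
    rw [abs_of_nonpos (Real.log_nonpos (by linarith) h)] at h1
    have h8 := Real.log_le_sub_one_of_pos (x := r⁻¹) (by positivity)
    rw [Real.log_inv] at h8
    have h9 : r⁻¹ ≤ 4 := by rw [inv_le_comm₀ (by linarith) (by norm_num)]; linarith
    nlinarith

/-- Divided by the iterate, the recursion of `leftInvIterDot_succ` adds at most |p||log(2x)| ≤ C
r^(e-α) per step, where r = |1/(2x)|. Since r^(1-α) is controlled by the drift b - a, this increment
is at most a constant times b^e - a^e, and the sum telescopes. -/
theorem norm_leftInvIterDot_div_le {α : ℝ} (hα : α ∈ Ioo (0 : ℝ) 1) {y : ℂ}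
    (hy : y ∈ Metric.ball (1 : ℂ) 1) {e : ℝ} (he : 0 < e) (he1 : e ≤ 1) (n : ℕ) :
    ‖leftInvIterDot α n y / leftInvIter α n y‖ ≤
      (1 / e + 20) * (25 / (α * e)) * invRe (leftInvIter α n y) ^ e := by
  have hα0 := hα.1
  have hα1 := hα.2
  induction n with
  | zero =>
    rw [leftInvIterDot_zero α hα hy, zero_div, norm_zero]
    have := quarter_lt_invRe_leftInvIter hα hy 0
    have : 0 < invRe (leftInvIter α 0 y) := by linarith
    positivity
  | succ n ih =>
    have h1 := invRe_leftInvIter_add_le hα hy n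
    have h2 := invRe_leftInvIter_le_succ hα hy n
    have h3 := quarter_lt_invRe_leftInvIter hα hy n
    have h3' := quarter_lt_invRe_leftInvIter hα hy (n + 1)
    have h6 := invRe_le_norm (leftInvIter α (n + 1) y)
    have hx := leftInvIter_re_pos hα hy (n + 1)
    have hd := leftInvIterDot_succ hα hy n
    have hb := leftBranch_leftInvIter_succ hα hy n
    have hpn := norm_cpow_two_mul α hx
    have hp := re_cpow_two_mul_pos hα hx
    have hlog := norm_log_le_rpow he he1 hx (by linarith)
    rw [leftBranch] at hb
    set a := invRe (leftInvIter α n y)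
    set b := invRe (leftInvIter α (n + 1) y)
    set x := leftInvIter α (n + 1) y
    set p := (2 * x) ^ (α : ℂ)
    set r := ‖(2 * x)⁻¹‖
    have hr : 0 < r := by linarith
    have hb0 : 0 < b := by linarith
    have hx0 : x ≠ 0 := ne_zero_of_re_pos' hx
    have hp1 : 1 + p ≠ 0 := ne_zero_of_re_pos' (by rw [Complex.add_re, Complex.one_re]; linarith)
    have hkey : leftInvIterDot α (n + 1) y / x * ((1 + (1 + α) * p) / (1 + p)) =
        leftInvIterDot α n y / leftInvIter α n y - p / (1 + p) * Complex.log (2 * x) := by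
      rw [← hb, ← hd]; field_simp; ring
    have h7 : 1 ≤ ‖(1 + (1 + α) * p) / (1 + p)‖ := by
      rw [norm_div, one_le_div (norm_pos_iff.2 hp1)]
      exact one_le_norm_div hα hp
    have h8 : ‖p / (1 + p)‖ ≤ ‖p‖ := by
      rw [norm_div]
      refine div_le_self (norm_nonneg _) ?_
      refine le_trans ?_ (Complex.re_le_norm _)
      rw [Complex.add_re, Complex.one_re]; linarith
    have h9 : ‖leftInvIterDot α (n + 1) y / x‖ ≤
        ‖leftInvIterDot α n y / leftInvIter α n y‖ + r ^ (-α) * ((1 / e + 20) * r ^ e) := by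
      calc ‖leftInvIterDot α (n + 1) y / x‖
          ≤ ‖leftInvIterDot α (n + 1) y / x * ((1 + (1 + α) * p) / (1 + p))‖ := by
            rw [norm_mul]; exact le_mul_of_one_le_right (norm_nonneg _) h7
        _ ≤ ‖leftInvIterDot α n y / leftInvIter α n y‖ + ‖p / (1 + p) * Complex.log (2 * x)‖ := by
            rw [hkey]; exact norm_sub_le _ _
        _ ≤ _ := by
            rw [norm_mul, ← hpn]
            gcongr
    have h10 : r ^ (-α) * r ^ e = r ^ (1 - α) * r ^ (e - 1) := by
      rw [← Real.rpow_add hr, ← Real.rpow_add hr]; congr 1; ring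
    have h11 : r ^ (e - 1) ≤ b ^ (e - 1) := Real.rpow_le_rpow_of_nonpos hb0 h6 (by linarith)
    have h12 : r ^ (1 - α) ≤ 25 / α * (b - a) := by
      rw [div_mul_eq_mul_div, le_div_iff₀ hα0]; linarith
    have h13 := mul_rpow_sub_le he.le he1 (by linarith : 0 < a) h2
    have h14 : r ^ (1 - α) * r ^ (e - 1) ≤ 25 / (α * e) * (b ^ e - a ^ e) := by
      calc r ^ (1 - α) * r ^ (e - 1) ≤ (25 / α * (b - a)) * b ^ (e - 1) :=
            mul_le_mul h12 h11 (Real.rpow_nonneg hr.le _) (by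
              have := sub_nonneg.2 h2; positivity)
        _ = 25 / (α * e) * (e * (b - a) * b ^ (e - 1)) := by field_simp
        _ ≤ _ := by gcongr
    have h15 : r ^ (-α) * ((1 / e + 20) * r ^ e) ≤
        (1 / e + 20) * (25 / (α * e) * (b ^ e - a ^ e)) := by
      rw [← h10] at h14
      calc r ^ (-α) * ((1 / e + 20) * r ^ e) = (1 / e + 20) * (r ^ (-α) * r ^ e) := by ring
        _ ≤ _ := by gcongr
    calc _ ≤ _ := h9
      _ ≤ (1 / e + 20) * (25 / (α * e)) * a ^ e +
          (1 / e + 20) * (25 / (α * e) * (b ^ e - a ^ e)) := add_le_add ih h15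
      _ = _ := by ring

/-- Summable bounds for the inverse branches and their parameter derivatives, locally uniform in
the parameter. -/
theorem exists_summable_bound_leftInvIter {a b : ℝ} (ha : 0 < a) (hab : a ≤ b) (hb : b < 1) :
    ∃ u : ℕ → ℝ, Summable u ∧ ∀ α ∈ Icc a b, ∀ y ∈ Metric.ball (1 : ℂ) 1, ∀ n,
      ‖leftInvIter α n y‖ ≤ u n ∧ ‖leftInvIterDot α n y‖ ≤ u n := by
  -- Then 1 - e = (1+b)/2 > b, so the exponent (1-e)/b of the majorant exceeds 1.
  set e := (1 - b) / 2 with he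
  have he0 : 0 < e := by rw [he]; linarith
  have he1 : e ≤ 1 := by rw [he]; linarith
  -- The first summand serves the parameter derivatives; the 4 serves the iterates themselves,
  -- through c^(-e) ≤ 4.
  set K := (1 / e + 20) * (25 / (a * e)) + 4 with hK
  have hK0 : 0 < K := by positivity
  set M := (a ^ 2 / 25) ^ (-(1 / a)) with hM
  refine ⟨fun n => K * (M * ((n : ℝ) + 1) ^ (-((1 - e) / b))), ?_, ?_⟩
  · refine (Summable.mul_left _ ?_).mul_left _
    have h1 : Summable fun n : ℕ => (n : ℝ) ^ (-((1 - e) / b)) := by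
      rw [Real.summable_nat_rpow, neg_lt_neg_iff, lt_div_iff₀ (by linarith)]
      rw [he]; linarith
    have h2 := (summable_nat_add_iff 1).2 h1
    simpa using h2
  intro α hαab y hy n
  have hα : α ∈ Ioo (0 : ℝ) 1 := ⟨ha.trans_le hαab.1, hαab.2.trans_lt hb⟩
  have hα0 := hα.1
  set c := invRe (leftInvIter α n y) with hc
  have hc4 : 1 / 4 < c := quarter_lt_invRe_leftInvIter hα hy n
  have hc0 : 0 < c := by linarith
  have hce : c ^ (e - 1) ≤ M * ((n : ℝ) + 1) ^ (-((1 - e) / b)) := by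
    refine (invRe_leftInvIter_rpow_le hα hy n he1).trans ?_
    rw [Real.mul_rpow (by positivity) (by positivity)]
    refine mul_le_mul ?_ ?_ (by positivity) (by positivity)
    · have h1 : a ^ 2 / 25 ≤ α ^ 2 / 25 := by
        have := hαab.1
        gcongr
      refine (Real.rpow_le_rpow_of_nonpos (by positivity) h1 ?_).trans ?_
      · rw [neg_nonpos]; exact div_nonneg (by linarith) hα0.le
      · refine Real.rpow_le_rpow_of_exponent_ge (by positivity) ?_ ?_
        · nlinarith
        · rw [neg_le_neg_iff]
          exact div_le_div₀ zero_le_one (by linarith) ha hαab.1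
    · refine Real.rpow_le_rpow_of_exponent_le (by simp) ?_
      rw [neg_le_neg_iff]
      exact div_le_div_of_nonneg_left (by linarith) hα0 hαab.2
  have hx1 : ‖leftInvIter α n y‖ ≤ c⁻¹ := norm_leftInvIter_le_inv hα hy n
  have hcc : c⁻¹ = c ^ (-e) * c ^ (e - 1) := by
    rw [← Real.rpow_add hc0, ← Real.rpow_neg_one]; congr 1; ring
  have hcc' : c ^ e * c⁻¹ = c ^ (e - 1) := by
    rw [Real.rpow_sub_one hc0.ne', div_eq_mul_inv]
  have hce4 : c ^ (-e) ≤ 4 := by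
    rw [Real.rpow_neg hc0.le, inv_le_comm₀ (by positivity) (by norm_num)]
    have h1 := Real.rpow_le_rpow (by norm_num) hc4.le he0.le
    have h2 := Real.rpow_le_rpow_of_exponent_ge (x := 1 / 4) (by norm_num) (by norm_num) he1
    rw [Real.rpow_one] at h2
    linarith
  have hK4 : 4 ≤ K := by
    rw [hK]
    have : 0 < (1 / e + 20) * (25 / (a * e)) := by positivity
    linarith
  constructor
  · calc _ ≤ _ := hx1
      _ = c ^ (-e) * c ^ (e - 1) := hcc
      _ ≤ K * c ^ (e - 1) := by gcongr; linarith
      _ ≤ _ := mul_le_mul_of_nonneg_left hce hK0.le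
  · have hx0 : leftInvIter α n y ≠ 0 := ne_zero_of_re_pos' (leftInvIter_re_pos hα hy n)
    have h1 := norm_leftInvIterDot_div_le hα hy he0 he1 n
    rw [norm_div, div_le_iff₀ (norm_pos_iff.2 hx0)] at h1
    have h2 : (1 / e + 20) * (25 / (α * e)) ≤ K := by
      have : 25 / (α * e) ≤ 25 / (a * e) := by
        have := hαab.1
        gcongr
      have : (1 / e + 20) * (25 / (α * e)) ≤ (1 / e + 20) * (25 / (a * e)) := by gcongr
      linarith
    calc _ ≤ _ := h1
      _ ≤ K * c ^ e * c⁻¹ := by gcongr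
      _ = K * c ^ (e - 1) := by rw [mul_assoc, hcc']
      _ ≤ _ := mul_le_mul_of_nonneg_left hce hK0.le

/-! ### Curves in Banach spaces -/

section Curves
variable {E : Type*} [NormedAddCommGroup E] [NormedSpace ℝ E]

theorem contDiffOn_one_of_hasDerivAt {f f' : ℝ → E} {s : Set ℝ} (hs : IsOpen s)
    (h : ∀ x ∈ s, HasDerivAt f (f' x) x) (hc : ContinuousOn f' s) : ContDiffOn ℝ 1 f s := by
  have h1 : ContDiffOn ℝ (0 + 1) f s := by
    rw [contDiffOn_succ_iff_deriv_of_isOpen hs]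
    refine ⟨fun x hx => (h x hx).differentiableAt.differentiableWithinAt, by simp, ?_⟩
    rw [contDiffOn_zero]
    exact hc.congr fun x hx => (h x hx).deriv
  simpa using h1

theorem contDiffOn_one_hasDerivAt {f : ℝ → E} {s : Set ℝ} (hs : IsOpen s)
    (h : ContDiffOn ℝ 1 f s) {x : ℝ} (hx : x ∈ s) : HasDerivAt f (deriv f x) x :=
  ((h.contDiffAt (hs.mem_nhds hx)).differentiableAt one_ne_zero).hasDerivAt

theorem hasDerivAt_tsum_Ioo [CompleteSpace E] {ι : Type*} {f f' : ι → ℝ → E} {u : ι → ℝ}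
    (hu : Summable u) {a b : ℝ} (hf : ∀ i, ∀ x ∈ Ioo a b, HasDerivAt (f i) (f' i x) x)
    (h0 : ∀ i, ∀ x ∈ Ioo a b, ‖f i x‖ ≤ u i) (h1 : ∀ i, ∀ x ∈ Ioo a b, ‖f' i x‖ ≤ u i)
    {x : ℝ} (hx : x ∈ Ioo a b) :
    HasDerivAt (fun x => ∑' i, f i x) (∑' i, f' i x) x :=
  hasDerivAt_tsum_of_isPreconnected hu isOpen_Ioo isPreconnected_Ioo hf h1 hx
    (hu.of_norm_bounded fun i => h0 i x hx) hx

theorem contDiffOn_tsum_Ioo [CompleteSpace E] {ι : Type*} {f f' : ι → ℝ → E} {u : ι → ℝ}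
    (hu : Summable u) {a b : ℝ} (hf : ∀ i, ∀ x ∈ Ioo a b, HasDerivAt (f i) (f' i x) x)
    (hc : ∀ i, ContinuousOn (f' i) (Ioo a b))
    (h0 : ∀ i, ∀ x ∈ Ioo a b, ‖f i x‖ ≤ u i) (h1 : ∀ i, ∀ x ∈ Ioo a b, ‖f' i x‖ ≤ u i) :
    ContDiffOn ℝ 1 (fun x => ∑' i, f i x) (Ioo a b) :=
  contDiffOn_one_of_hasDerivAt isOpen_Ioo (fun _ hx => hasDerivAt_tsum_Ioo hu hf h0 h1 hx)
    (continuousOn_tsum hc hu h1)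

/-- A curve of continuous functions on a compact space is differentiable in the sup norm if it is
pointwise differentiable and the derivatives form a continuous curve. -/
theorem hasDerivAt_continuousMap {Y : Type*} [TopologicalSpace Y] [CompactSpace Y]
    {F F' : ℝ → C(Y, E)} {s : Set ℝ} (hs : IsOpen s)
    (h : ∀ x ∈ s, ∀ y, HasDerivAt (fun x => F x y) (F' x y) x) (hc : ContinuousOn F' s)
    {x : ℝ} (hx : x ∈ s) : HasDerivAt F (F' x) x := by
  rw [hasDerivAt_iff_isLittleO, Asymptotics.isLittleO_iff]
  intro c hc0
  have h1 := (hc.continuousAt (hs.mem_nhds hx))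
  obtain ⟨δ, hδ, hball⟩ := Metric.mem_nhds_iff.1
    (Filter.inter_mem (hs.mem_nhds hx) (h1 (Metric.closedBall_mem_nhds _ hc0)))
  filter_upwards [Metric.ball_mem_nhds x hδ] with z hz
  rw [ContinuousMap.norm_le _ (by positivity)]
  intro y
  -- Mean value inequality for `F t y` minus its linear part at x: the derivative `F' t y - F' x y`
  -- is at most c uniformly in y.
  have h2 := (convex_ball x δ).norm_image_sub_le_of_norm_hasDerivWithin_le
    (f := fun t => F t y - (t - x) • F' x y) (f' := fun t => F' t y - F' x y) (C := c)
    (fun t ht => ?_) (fun t ht => ?_) (Metric.mem_ball_self hδ) hz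
  · simpa [sub_right_comm] using h2
  · have h3 := ((hasDerivAt_id t).sub_const x).smul_const (F' x y)
    rw [one_smul] at h3
    exact ((h t (hball ht).1 y).sub h3).hasDerivWithinAt
  · have h3 : F' t ∈ Metric.closedBall (F' x) c := (hball ht).2
    rw [mem_closedBall_iff_norm] at h3
    exact ((F' t - F' x).norm_coe_le_norm y).trans h3

end Curves

theorem norm_pow_sub_pow_le {R : Type*} [NormedCommRing R] [NormOneClass R] {x y : R}
    (hx : ‖x‖ ≤ 1) (hy : ‖y‖ ≤ 1) (j : ℕ) : ‖x ^ j - y ^ j‖ ≤ j * ‖x - y‖ := by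
  induction j with
  | zero => simp
  | succ j ih =>
    have h1 : x ^ (j + 1) - y ^ (j + 1) = x * (x ^ j - y ^ j) + (x - y) * y ^ j := by ring
    rw [h1]
    refine (norm_add_le _ _).trans ?_
    have h2 := (norm_mul_le x (x ^ j - y ^ j))
    have h3 := (norm_mul_le (x - y) (y ^ j))
    have h4 : ‖y ^ j‖ ≤ 1 := (norm_pow_le y j).trans (pow_le_one₀ (norm_nonneg _) hy)
    have h5 : ‖x‖ * ‖x ^ j - y ^ j‖ ≤ 1 * ‖x ^ j - y ^ j‖ := by gcongr
    have h6 : ‖x - y‖ * ‖y ^ j‖ ≤ ‖x - y‖ * 1 := by gcongr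
    push_cast
    linarith

/-! ### Continuous functions on a circle and their Cauchy extension -/

/-- The circle of center `1` and radius `3 / 2`. -/
abbrev Circ : Type := Metric.sphere (1 : ℂ) (3 / 2)

/-- The Banach algebra of continuous functions on the circle `Circ`. -/
abbrev CircFun : Type := C(Circ, ℂ)

/-- Angular parametrization of `Circ`. -/
noncomputable def circPt (θ : ℝ) : Circ :=
  ⟨circleMap 1 (3 / 2) θ, circleMap_mem_sphere _ (by norm_num) _⟩

instance : Nonempty Circ := ⟨circPt 0⟩

theorem continuous_circPt : Continuous circPt := (continuous_circleMap _ _).subtype_mk _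

theorem norm_circ_sub_one (z : Circ) : ‖(z : ℂ) - 1‖ = 3 / 2 := mem_sphere_iff_norm.1 z.2

theorem circ_sub_one_ne_zero (z : Circ) : (z : ℂ) - 1 ≠ 0 := by
  rw [← norm_pos_iff, norm_circ_sub_one]; norm_num

/-- The mean of a function on `Circ`. -/
noncomputable def circMean : CircFun →L[ℂ] ℂ :=
  LinearMap.mkContinuous
    { toFun := fun U => (2 * Real.pi : ℂ)⁻¹ * ∫ θ in (0 : ℝ)..2 * Real.pi, U (circPt θ)
      map_add' := fun U V => by
        simp only [ContinuousMap.add_apply]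
        rw [intervalIntegral.integral_add, mul_add]
        · exact (U.continuous.comp continuous_circPt).intervalIntegrable _ _
        · exact (V.continuous.comp continuous_circPt).intervalIntegrable _ _
      map_smul' := fun c U => by
        simp only [ContinuousMap.smul_apply, RingHom.id_apply, smul_eq_mul,
          intervalIntegral.integral_const_mul]
        ring } 1 (fun U => by
        have h := intervalIntegral.norm_integral_le_of_norm_le_const (a := 0) (b := 2 * Real.pi)
          (f := fun θ => U (circPt θ)) (C := ‖U‖) (fun θ _ => U.norm_coe_le_norm _)
        have hpi := Real.pi_pos
        simp only [LinearMap.coe_mk, AddHom.coe_mk, norm_mul, norm_inv, one_mul]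
        rw [sub_zero, abs_of_pos (by positivity)] at h
        have h2 : ‖(2 : ℂ)‖ * ‖(Real.pi : ℂ)‖ = 2 * Real.pi := by simp [hpi.le]
        rw [h2, inv_mul_le_iff₀ (by positivity)]
        linarith)

theorem circMean_apply (U : CircFun) :
    circMean U = (2 * Real.pi : ℂ)⁻¹ * ∫ θ in (0 : ℝ)..2 * Real.pi, U (circPt θ) := rfl

theorem norm_circMean_le (U : CircFun) : ‖circMean U‖ ≤ ‖U‖ := by
  have := circMean.le_of_opNorm_le (LinearMap.mkContinuous_norm_le _ zero_le_one _) U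
  simpa using this

/-- The function `(ζ - 1)⁻¹` on `Circ`. -/
noncomputable def circInv : CircFun :=
  ⟨fun z => ((z : ℂ) - 1)⁻¹, (continuous_subtype_val.sub continuous_const).inv₀ circ_sub_one_ne_zero⟩

theorem norm_circInv_le : ‖circInv‖ ≤ 2 / 3 := by
  rw [ContinuousMap.norm_le _ (by norm_num)]
  intro z
  simp only [circInv, ContinuousMap.coe_mk, norm_inv, norm_circ_sub_one]
  norm_num

theorem norm_smul_circInv_lt {y : ℂ} (hy : y ∈ Metric.ball (1 : ℂ) (3 / 2)) :
    ‖(y - 1) • circInv‖ < 1 := by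
  rw [norm_smul]
  have h1 := mem_ball_iff_norm.1 hy
  have h2 := norm_circInv_le
  nlinarith [norm_nonneg (y - 1), norm_nonneg circInv]

/-- The Cauchy kernel `(ζ - 1) / (ζ - y)`. -/
noncomputable def cauchyKer (y : ℂ) : CircFun := Ring.inverse (1 - (y - 1) • circInv)

theorem isUnit_one_sub_smul_circInv {y : ℂ} (hy : y ∈ Metric.ball (1 : ℂ) (3 / 2)) :
    IsUnit (1 - (y - 1) • circInv) := (Units.oneSub _ (norm_smul_circInv_lt hy)).isUnit

theorem cauchyKer_apply {y : ℂ} (hy : y ∈ Metric.ball (1 : ℂ) (3 / 2)) (z : Circ) :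
    cauchyKer y z = ((z : ℂ) - 1) * ((z : ℂ) - y)⁻¹ := by
  have h := Ring.inverse_mul_cancel _ (isUnit_one_sub_smul_circInv hy)
  have h1 := congrArg (fun f : CircFun => f z) h
  simp only [ContinuousMap.mul_apply, ContinuousMap.sub_apply, ContinuousMap.one_apply,
    ContinuousMap.smul_apply, smul_eq_mul, circInv, ContinuousMap.coe_mk] at h1
  have h0 := circ_sub_one_ne_zero z
  have h2 : (z : ℂ) - y ≠ 0 := by
    intro h3
    rw [mem_ball_iff_norm, ← sub_eq_zero.1 h3, norm_circ_sub_one] at hy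
    exact lt_irrefl _ hy
  have h4 : 1 - (y - 1) * ((z : ℂ) - 1)⁻¹ = ((z : ℂ) - y) / ((z : ℂ) - 1) := by
    field_simp; ring
  have h5 := eq_div_of_mul_eq (by rw [h4]; exact div_ne_zero h2 h0) h1
  change cauchyKer y z = _ at h5
  rw [h5, h4]
  field_simp

/-- Evaluation at `y` of the Cauchy extension of a function on `Circ`. -/
noncomputable def cauchyEv (y : ℂ) : CircFun →L[ℂ] ℂ :=
  circMean.comp (ContinuousLinearMap.mul ℂ CircFun (cauchyKer y))

theorem cauchyEv_apply (y : ℂ) (U : CircFun) : cauchyEv y U = circMean (cauchyKer y * U) := rfl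

/-- The Taylor coefficients at `1` of the Cauchy extension. -/
noncomputable def cauchyCoeff (j : ℕ) : CircFun →L[ℂ] ℂ :=
  circMean.comp (ContinuousLinearMap.mul ℂ CircFun (circInv ^ j))

theorem norm_cauchyCoeff_le (j : ℕ) : ‖cauchyCoeff j‖ ≤ (2 / 3) ^ j := by
  refine ContinuousLinearMap.opNorm_le_bound _ (by positivity) fun U => ?_
  refine (norm_circMean_le _).trans ((norm_mul_le _ _).trans ?_)
  gcongr
  exact (norm_pow_le _ _).trans (by gcongr; exact norm_circInv_le)

/-- Neumann series of the kernel, averaged term by term. It splits evaluation at f_n into the rank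
one pieces from which `transferOp` is assembled. -/
theorem hasSum_cauchyEv {y : ℂ} (hy : y ∈ Metric.ball (1 : ℂ) (3 / 2)) (U : CircFun) :
    HasSum (fun j => cauchyCoeff j U * (y - 1) ^ j) (cauchyEv y U) := by
  have h1 : HasSum (fun j => ((y - 1) • circInv) ^ j) (cauchyKer y) :=
    hasSum_geom_series_inverse _ (norm_smul_circInv_lt hy)
  have h2 := circMean.hasSum (h1.mul_right U)
  rw [cauchyEv_apply]
  convert! h2 using 2 with j
  rw [smul_pow, smul_mul_assoc, map_smul, smul_eq_mul, mul_comm]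
  rfl

/-- Cauchy's integral formula. For a general continuous U the extension need not have U as its
boundary values; it does when U comes from a holomorphic function. -/
theorem cauchyEv_eq {V : ℂ → ℂ} {U : CircFun} (hV : DiffContOnCl ℂ V (Metric.ball 1 (3 / 2)))
    (h : ∀ z : Circ, U z = V z) {y : ℂ} (hy : y ∈ Metric.ball (1 : ℂ) (3 / 2)) :
    cauchyEv y U = V y := by
  have h1 := hV.circleIntegral_sub_inv_smul hy
  rw [circleIntegral] at h1
  rw [cauchyEv_apply, circMean_apply]
  have h2 : ∀ θ : ℝ, deriv (circleMap 1 (3 / 2)) θ • (circleMap 1 (3 / 2) θ - y)⁻¹ •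
      V (circleMap 1 (3 / 2) θ) = Complex.I * (cauchyKer y * U) (circPt θ) := by
    intro θ
    rw [ContinuousMap.mul_apply, cauchyKer_apply hy, h, deriv_circleMap]
    simp only [circPt, smul_eq_mul, circleMap]
    ring
  simp_rw [h2] at h1
  rw [intervalIntegral.integral_const_mul, smul_eq_mul] at h1
  have h3 : ∫ θ in (0 : ℝ)..2 * Real.pi, (cauchyKer y * U) (circPt θ) = 2 * Real.pi * V y := by
    refine mul_left_cancel₀ Complex.I_ne_zero (h1.trans (by ring))
  rw [h3, inv_mul_cancel_left₀]
  exact mul_ne_zero two_ne_zero (by exact_mod_cast Real.pi_ne_zero)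

theorem norm_cauchyKer_le {y : ℂ} (hy : ‖y - 1‖ ≤ 1) : ‖cauchyKer y‖ ≤ 3 := by
  have hy' : y ∈ Metric.ball (1 : ℂ) (3 / 2) := by rw [mem_ball_iff_norm]; linarith
  rw [ContinuousMap.norm_le _ (by norm_num)]
  intro z
  rw [cauchyKer_apply hy', norm_mul, norm_inv, norm_circ_sub_one]
  have h1 : 1 / 2 ≤ ‖(z : ℂ) - y‖ := by
    have := norm_sub_norm_le ((z : ℂ) - 1) (y - 1)
    rw [norm_circ_sub_one, sub_sub_sub_cancel_right] at this
    linarith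
  rw [← div_eq_mul_inv, div_le_iff₀ (by linarith)]
  linarith

/-- Resolvent identity for the kernels at x and y. Both have norm at most (3/2)/(1/2) = 3 and
`circInv` has norm at most 2/3, so 3 · (2/3) · 3 = 6. The closed disc is allowed because 0, where
the branches accumulate, lies on its boundary. -/
theorem norm_cauchyEv_sub_le {y x : ℂ} (hy : ‖y - 1‖ ≤ 1) (hx : ‖x - 1‖ ≤ 1) (U : CircFun) :
    ‖cauchyEv y U - cauchyEv x U‖ ≤ 6 * ‖y - x‖ * ‖U‖ := by
  have hy' : y ∈ Metric.ball (1 : ℂ) (3 / 2) := by rw [mem_ball_iff_norm]; linarith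
  have hx' : x ∈ Metric.ball (1 : ℂ) (3 / 2) := by rw [mem_ball_iff_norm]; linarith
  rw [cauchyEv_apply, cauchyEv_apply, ← map_sub, ← sub_mul]
  refine (norm_circMean_le _).trans ((norm_mul_le _ _).trans ?_)
  gcongr
  have h1 : cauchyKer y - cauchyKer x = cauchyKer y * ((y - x) • circInv) * cauchyKer x := by
    have h2 : cauchyKer y * (1 - (y - 1) • circInv) = 1 :=
      Ring.inverse_mul_cancel _ (isUnit_one_sub_smul_circInv hy')
    have h3 : cauchyKer x * (1 - (x - 1) • circInv) = 1 :=
      Ring.inverse_mul_cancel _ (isUnit_one_sub_smul_circInv hx')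
    have h4 : (y - x) • circInv = (1 - (x - 1) • circInv) - (1 - (y - 1) • circInv) := by
      module
    rw [h4]
    linear_combination (-cauchyKer y) * h3 + cauchyKer x * h2
  rw [h1]
  refine (norm_mul_le _ _).trans ?_
  have h5 := norm_mul_le (cauchyKer y) ((y - x) • circInv)
  rw [norm_smul] at h5
  have h6 := norm_cauchyKer_le hy
  have h7 := norm_cauchyKer_le hx
  have h8 := norm_circInv_le
  calc _ ≤ (3 * (‖y - x‖ * (2 / 3))) * 3 := by
        refine mul_le_mul (h5.trans ?_) h7 (norm_nonneg _) (by positivity)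
        gcongr
    _ = _ := by ring

/-- Inversion is smooth at the units of a Banach algebra; defining the kernel by `Ring.inverse`
gives regularity in sup norm directly. -/
theorem contDiffAt_cauchyKer {y : ℂ} (hy : y ∈ Metric.ball (1 : ℂ) (3 / 2)) :
    ContDiffAt ℂ 1 cauchyKer y := by
  obtain ⟨u, hu⟩ := isUnit_one_sub_smul_circInv hy
  have h1 := contDiffAt_ringInverse ℂ (n := 1) u
  rw [hu] at h1
  refine ContDiffAt.comp y h1 ?_
  fun_prop

theorem differentiableOn_cauchyEv (U : CircFun) :
    DifferentiableOn ℂ (fun y => cauchyEv y U) (Metric.ball (1 : ℂ) (3 / 2)) := by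
  intro y hy
  have h1 := (contDiffAt_cauchyKer hy).differentiableAt one_ne_zero
  have h2 : DifferentiableAt ℂ (fun y => cauchyKer y * U) y := h1.mul_const U
  exact (circMean.differentiableAt.comp y h2).differentiableWithinAt

/-! ### The transfer operator of the induced map, acting on distribution functions -/

theorem half_mem_ball {z : ℂ} (hz : z ∈ Metric.ball (1 : ℂ) 2) :
    (1 + z) / 2 ∈ Metric.ball (1 : ℂ) 1 := by
  rw [mem_ball_iff_norm] at hz ⊢
  have : (1 + z) / 2 - 1 = (z - 1) / 2 := by ring
  rw [this, norm_div, Complex.norm_ofNat]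
  linarith

theorem circ_mem_ball (z : Circ) : (z : ℂ) ∈ Metric.ball (1 : ℂ) 2 := by
  rw [mem_ball_iff_norm, norm_circ_sub_one]; norm_num

/-- The inverse branches of the induced map. -/
noncomputable def branch (α : ℝ) (n : ℕ) (z : ℂ) : ℂ := leftInvIter α n ((1 + z) / 2)

theorem branch_mem_ball {α : ℝ} (hα : α ∈ Ioo (0 : ℝ) 1) (n : ℕ) {z : ℂ}
    (hz : z ∈ Metric.ball (1 : ℂ) 2) : branch α n z ∈ Metric.ball (1 : ℂ) 1 :=
  leftInvIter_mem_ball hα (half_mem_ball hz) n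

theorem differentiableOn_branch {α : ℝ} (hα : α ∈ Ioo (0 : ℝ) 1) (n : ℕ) :
    DifferentiableOn ℂ (branch α n) (Metric.ball (1 : ℂ) 2) :=
  (differentiableOn_leftInvIter hα n).comp (by fun_prop) fun _ hz => half_mem_ball hz

open Classical in
/-- The inverse branches of the induced map as elements of `CircFun`. -/
noncomputable def branchFun (n : ℕ) (α : ℝ) : CircFun :=
  if hα : α ∈ Ioo (0 : ℝ) 1 then
    ⟨fun z => branch α n z, ((differentiableOn_branch hα n).continuousOn.comp_continuous
      continuous_subtype_val circ_mem_ball)⟩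
  else 0

theorem branchFun_apply {α : ℝ} (hα : α ∈ Ioo (0 : ℝ) 1) (n : ℕ) (z : Circ) :
    branchFun n α z = branch α n z := by
  rw [branchFun, dif_pos hα]; rfl

theorem continuous_leftInvIterDot_half {α : ℝ} (hα : α ∈ Ioo (0 : ℝ) 1) (n : ℕ) :
    Continuous fun z : Circ => leftInvIterDot α n ((1 + z) / 2) := by
  refine (continuousOn_leftInvIterDot n).comp_continuous
    (f := fun z : Circ => (α, ((1 + z) / 2 : ℂ))) (by fun_prop)
    fun z => ⟨hα, half_mem_ball (circ_mem_ball z)⟩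

open Classical in
/-- The parameter derivatives of the inverse branches as elements of `CircFun`. -/
noncomputable def branchDot (n : ℕ) (α : ℝ) : CircFun :=
  if hα : α ∈ Ioo (0 : ℝ) 1 then
    ⟨fun z => leftInvIterDot α n ((1 + z) / 2), continuous_leftInvIterDot_half hα n⟩
  else 0

theorem branchDot_apply {α : ℝ} (hα : α ∈ Ioo (0 : ℝ) 1) (n : ℕ) (z : Circ) :
    branchDot n α z = leftInvIterDot α n ((1 + z) / 2) := by
  rw [branchDot, dif_pos hα]; rfl

theorem continuousOn_branchDot (n : ℕ) : ContinuousOn (branchDot n) (Ioo 0 1) := by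
  rw [continuousOn_iff_continuous_domRestrict]
  refine ContinuousMap.continuous_of_continuous_uncurry _ ?_
  have h1 : Continuous fun p : Ioo (0 : ℝ) 1 × Circ =>
      leftInvIterDot p.1 n ((1 + (p.2 : ℂ)) / 2) :=
    (continuousOn_leftInvIterDot n).comp_continuous
      (f := fun p : Ioo (0 : ℝ) 1 × Circ => ((p.1 : ℝ), ((1 + (p.2 : ℂ)) / 2))) (by fun_prop)
      fun p => ⟨p.1.2, half_mem_ball (circ_mem_ball p.2)⟩
  refine h1.congr fun p => ?_
  exact (branchDot_apply p.1.2 n p.2).symm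

theorem hasDerivAt_branchFun {α : ℝ} (hα : α ∈ Ioo (0 : ℝ) 1) (n : ℕ) :
    HasDerivAt (branchFun n) (branchDot n α) α := by
  refine hasDerivAt_continuousMap isOpen_Ioo (fun a ha z => ?_) (continuousOn_branchDot n) hα
  rw [branchDot_apply ha]
  refine (hasDerivAt_leftInvIter_param ha (half_mem_ball (circ_mem_ball z)) n).congr_of_eventuallyEq
    ?_
  filter_upwards [isOpen_Ioo.mem_nhds ha] with c hc
  exact branchFun_apply hc n z

theorem zero_mem_ball_two : (0 : ℂ) ∈ Metric.ball (1 : ℂ) 2 := by simp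

theorem one_mem_ball_two : (1 : ℂ) ∈ Metric.ball (1 : ℂ) 2 := by simp

theorem norm_branchFun_sub_one_le {α : ℝ} (hα : α ∈ Ioo (0 : ℝ) 1) (n : ℕ) :
    ‖branchFun n α - 1‖ ≤ 1 := by
  rw [ContinuousMap.norm_le _ zero_le_one]
  intro z
  rw [ContinuousMap.sub_apply, branchFun_apply hα, ContinuousMap.one_apply]
  exact (mem_ball_iff_norm.1 (branch_mem_ball hα n (circ_mem_ball z))).le

theorem algebraMap_circFun_apply (c : ℂ) (z : Circ) : algebraMap ℂ CircFun c z = c := rfl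

/-- The difference `(f_n - 1) ^ j - (f_n 0 - 1) ^ j` for the `n`-th inverse branch `f_n`. -/
noncomputable def branchPow (p : ℕ × ℕ) (α : ℝ) : CircFun :=
  (branchFun p.2 α - 1) ^ p.1 - (algebraMap ℂ CircFun (branch α p.2 0) - 1) ^ p.1

/-- The parameter derivative of `branchPow`. -/
noncomputable def branchPowDot (p : ℕ × ℕ) (α : ℝ) : CircFun :=
  p.1 * (branchFun p.2 α - 1) ^ (p.1 - 1) * branchDot p.2 α -
    p.1 * (algebraMap ℂ CircFun (branch α p.2 0) - 1) ^ (p.1 - 1) *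
      algebraMap ℂ CircFun (leftInvIterDot α p.2 ((1 + 0) / 2))

theorem hasDerivAt_algebraMap_branch {α : ℝ} (hα : α ∈ Ioo (0 : ℝ) 1) (n : ℕ) :
    HasDerivAt (fun a => algebraMap ℂ CircFun (branch a n 0))
      (algebraMap ℂ CircFun (leftInvIterDot α n ((1 + 0) / 2))) α := by
  have h1 := hasDerivAt_leftInvIter_param hα (half_mem_ball zero_mem_ball_two) n
  simp only [Algebra.algebraMap_eq_smul_one]
  exact h1.smul_const (1 : CircFun)

theorem hasDerivAt_branchPow {α : ℝ} (hα : α ∈ Ioo (0 : ℝ) 1) (p : ℕ × ℕ) :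
    HasDerivAt (branchPow p) (branchPowDot p α) α :=
  (((hasDerivAt_branchFun hα p.2).sub_const 1).pow p.1).sub
    (((hasDerivAt_algebraMap_branch hα p.2).sub_const 1).pow p.1)

theorem continuousOn_branchPowDot (p : ℕ × ℕ) : ContinuousOn (branchPowDot p) (Ioo 0 1) := by
  have h1 : ContinuousOn (branchFun p.2) (Ioo 0 1) :=
    fun a ha => (hasDerivAt_branchFun ha p.2).continuousAt.continuousWithinAt
  have h2 : ContinuousOn (fun a => algebraMap ℂ CircFun (branch a p.2 0)) (Ioo 0 1) :=
    fun a ha => (hasDerivAt_algebraMap_branch ha p.2).continuousAt.continuousWithinAt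
  have h3 : ContinuousOn (fun α => leftInvIterDot α p.2 ((1 + 0) / 2)) (Ioo 0 1) :=
    (continuousOn_leftInvIterDot p.2).comp (f := fun α : ℝ => (α, ((1 + 0) / 2 : ℂ)))
      (by fun_prop) fun a ha => ⟨ha, half_mem_ball zero_mem_ball_two⟩
  have h4 := (algebraMapCLM ℂ CircFun).continuous.comp_continuousOn h3
  have h5 := continuousOn_branchDot p.2
  exact ((continuousOn_const.mul ((h1.sub continuousOn_const).pow _)).mul h5).sub
    ((continuousOn_const.mul ((h2.sub continuousOn_const).pow _)).mul h4)

theorem norm_algebraMap_branch_sub_one_le {α : ℝ} (hα : α ∈ Ioo (0 : ℝ) 1) (n : ℕ) :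
    ‖algebraMap ℂ CircFun (branch α n 0) - 1‖ ≤ 1 := by
  rw [← map_one (algebraMap ℂ CircFun), ← map_sub, norm_algebraMap']
  exact (mem_ball_iff_norm.1 (branch_mem_ball hα n zero_mem_ball_two)).le

/-- Both bases have norm at most 1, so the j-th powers differ by at most j times the difference of
the bases. Subtracting the value at 0 is what makes the term small in n. -/
theorem norm_branchPow_le {α : ℝ} (hα : α ∈ Ioo (0 : ℝ) 1) {v : ℝ} {n : ℕ}
    (hv : ∀ y ∈ Metric.ball (1 : ℂ) 1, ‖leftInvIter α n y‖ ≤ v) (j : ℕ) :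
    ‖branchPow (j, n) α‖ ≤ j * (2 * v) := by
  refine (norm_pow_sub_pow_le (norm_branchFun_sub_one_le hα n)
    (norm_algebraMap_branch_sub_one_le hα n) j).trans ?_
  have hv0 : 0 ≤ v := (norm_nonneg _).trans (hv 1 (by simp))
  gcongr
  rw [sub_sub_sub_cancel_right, ContinuousMap.norm_le _ (by positivity)]
  intro z
  rw [ContinuousMap.sub_apply, branchFun_apply hα]
  refine (norm_sub_le _ _).trans ?_
  have h1 := hv _ (half_mem_ball (circ_mem_ball z))
  have h2 := hv _ (half_mem_ball zero_mem_ball_two)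
  change ‖branch α n z‖ ≤ v at h1
  change ‖branch α n 0‖ ≤ v at h2
  change ‖branch α n z‖ + ‖branch α n 0‖ ≤ 2 * v
  linarith

theorem norm_branchPowDot_le {α : ℝ} (hα : α ∈ Ioo (0 : ℝ) 1) {v : ℝ} {n : ℕ}
    (hv : ∀ y ∈ Metric.ball (1 : ℂ) 1, ‖leftInvIterDot α n y‖ ≤ v) (j : ℕ) :
    ‖branchPowDot (j, n) α‖ ≤ j * (2 * v) := by
  have hv0 : 0 ≤ v := (norm_nonneg _).trans (hv 1 (by simp))
  have key : ∀ x d : CircFun, ‖x‖ ≤ 1 → ‖d‖ ≤ v → ‖(j : CircFun) * x ^ (j - 1) * d‖ ≤ j * v := by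
    intro x d hx hd
    have h1 : ‖x ^ (j - 1)‖ ≤ 1 := (norm_pow_le _ _).trans (pow_le_one₀ (norm_nonneg _) hx)
    have h2 : ‖(j : CircFun)‖ = j := by
      rw [← map_natCast (algebraMap ℂ CircFun), norm_algebraMap']; simp
    refine (norm_mul_le _ _).trans ?_
    refine mul_le_mul ((norm_mul_le _ _).trans ?_) hd (norm_nonneg _) (Nat.cast_nonneg _)
    rw [h2]
    exact mul_le_of_le_one_right (Nat.cast_nonneg _) h1
  have h3 : ‖branchDot n α‖ ≤ v := by
    rw [ContinuousMap.norm_le _ hv0]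
    intro z
    rw [branchDot_apply hα]
    exact hv _ (half_mem_ball (circ_mem_ball z))
  have h4 : ‖algebraMap ℂ CircFun (leftInvIterDot α n ((1 + 0) / 2))‖ ≤ v := by
    rw [norm_algebraMap']
    exact hv _ (half_mem_ball zero_mem_ball_two)
  refine (norm_sub_le _ _).trans ?_
  have h5 := key _ _ (norm_branchFun_sub_one_le hα n) h3
  have h6 := key _ _ (norm_algebraMap_branch_sub_one_le hα n) h4
  calc _ ≤ (j * v + j * v : ℝ) := add_le_add h5 h6
    _ = _ := by ring

/-- The rank one summands of the transfer operator. -/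
noncomputable def transferTerm (p : ℕ × ℕ) (α : ℝ) : CircFun →L[ℂ] CircFun :=
  (cauchyCoeff p.1).smulRight (branchPow p α)

/-- The parameter derivatives of the rank one summands of the transfer operator. -/
noncomputable def transferTermDot (p : ℕ × ℕ) (α : ℝ) : CircFun →L[ℂ] CircFun :=
  (cauchyCoeff p.1).smulRight (branchPowDot p α)

/-- The transfer operator on distribution functions:
`U ↦ ∑ n, (U ∘ f_n - U (f_n 0))`, in terms of Taylor coefficients. -/
noncomputable def transferOp (α : ℝ) : CircFun →L[ℂ] CircFun :=
  ∑' p : ℕ × ℕ, transferTerm p α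

/-- The Taylor coefficients decay like (2/3)^j, the ratio of the radius 1 containing the branches to
the radius 3/2 of the circle. The powers cost only a factor j, and the index n is summed by the
decay of the iterates. -/
theorem exists_summable_bound_transferOp {a b : ℝ} (ha : 0 < a) (hab : a ≤ b) (hb : b < 1) :
    ∃ u : ℕ × ℕ → ℝ, Summable u ∧ ∀ α ∈ Icc a b, ∀ p : ℕ × ℕ,
      ‖transferTerm p α‖ ≤ u p ∧
      ‖transferTermDot p α‖ ≤ u p := by
  obtain ⟨u, hu, h⟩ := exists_summable_bound_leftInvIter ha hab hb
  have hs : Summable fun j : ℕ => (2 / 3 : ℝ) ^ j * j := by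
    have := summable_pow_mul_geometric_of_norm_lt_one (R := ℝ) 1 (r := 2 / 3)
      (by norm_num [abs_of_pos])
    simpa [mul_comm] using this
  refine ⟨fun p => (2 / 3 : ℝ) ^ p.1 * p.1 * (2 * u p.2), ?_, fun α hα p => ?_⟩
  · have hu0 : ∀ n, 0 ≤ u n := fun n =>
      (norm_nonneg _).trans (h a ⟨le_rfl, hab⟩ 1 (by simp) n).1
    exact hs.mul_of_nonneg (hu.mul_left 2) (fun j => by positivity)
      (fun n => mul_nonneg two_pos.le (hu0 n))
  have hα' : α ∈ Ioo (0 : ℝ) 1 := ⟨ha.trans_le hα.1, hα.2.trans_lt hb⟩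
  have h1 := norm_branchPow_le hα' (n := p.2) (fun y hy => (h α hα y hy p.2).1) p.1
  have h2 := norm_branchPowDot_le hα' (n := p.2) (fun y hy => (h α hα y hy p.2).2) p.1
  rw [transferTerm, transferTermDot, ContinuousLinearMap.norm_smulRight_apply,
    ContinuousLinearMap.norm_smulRight_apply]
  have h3 := norm_cauchyCoeff_le p.1
  constructor
  · calc _ ≤ (2 / 3 : ℝ) ^ p.1 * (p.1 * (2 * u p.2)) :=
          mul_le_mul h3 h1 (norm_nonneg _) (by positivity)
      _ = _ := by ring
  · calc _ ≤ (2 / 3 : ℝ) ^ p.1 * (p.1 * (2 * u p.2)) :=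
          mul_le_mul h3 h2 (norm_nonneg _) (by positivity)
      _ = _ := by ring

theorem summable_transferOp {α : ℝ} (hα : α ∈ Ioo (0 : ℝ) 1) :
    Summable fun p : ℕ × ℕ => transferTerm p α := by
  obtain ⟨u, hu, h⟩ := exists_summable_bound_transferOp hα.1 le_rfl hα.2
  exact hu.of_norm_bounded fun p => (h α ⟨le_rfl, le_rfl⟩ p).1

section SMulRight
variable {E F : Type*} [NormedAddCommGroup E] [NormedSpace ℂ E] [NormedAddCommGroup F]
  [NormedSpace ℂ F] [NormedSpace ℝ F] [SMulCommClass ℂ ℝ F]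

/-- The map `v ↦ c.smulRight v` as a real continuous linear map. -/
noncomputable def smulRightReal (c : E →L[ℂ] ℂ) : F →L[ℝ] (E →L[ℂ] F) :=
  LinearMap.mkContinuous
    { toFun := fun v => c.smulRight v
      map_add' := fun v w => by ext x; simp
      map_smul' := fun r v => by ext x; exact smul_comm (c x) r v } ‖c‖
    fun v => (ContinuousLinearMap.norm_smulRight_apply c v).le

theorem hasDerivAt_smulRight (c : E →L[ℂ] ℂ) {v : ℝ → F} {v' : F} {x : ℝ}
    (h : HasDerivAt v v' x) : HasDerivAt (fun a => c.smulRight (v a)) (c.smulRight v') x :=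
  ((smulRightReal (F := F) c).hasFDerivAt (x := v x)).comp_hasDerivAt x h

theorem continuousOn_smulRight (c : E →L[ℂ] ℂ) {v : ℝ → F} {s : Set ℝ}
    (h : ContinuousOn v s) : ContinuousOn (fun a => c.smulRight (v a)) s :=
  (smulRightReal c).continuous.comp_continuousOn h

end SMulRight

theorem isCompactOperator_smulRight {E F : Type*} [NormedAddCommGroup E] [NormedSpace ℂ E]
    [NormedAddCommGroup F] [NormedSpace ℂ F] (c : E →L[ℂ] ℂ) (v : F) :
    IsCompactOperator (c.smulRight v) :=
  (isCompactOperator_of_locallyCompactSpace_dom c).clm_comp (ContinuousLinearMap.toSpanSingleton ℂ v)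

theorem hasDerivAt_transferTerm {α : ℝ} (hα : α ∈ Ioo (0 : ℝ) 1) (p : ℕ × ℕ) :
    HasDerivAt (transferTerm p) (transferTermDot p α) α :=
  hasDerivAt_smulRight (cauchyCoeff p.1) (hasDerivAt_branchPow hα p)

theorem continuousOn_transferTermDot (p : ℕ × ℕ) : ContinuousOn (transferTermDot p) (Ioo 0 1) :=
  continuousOn_smulRight _ (continuousOn_branchPowDot p)

theorem contDiffOn_transferOp : ContDiffOn ℝ 1 transferOp (Ioo 0 1) := by
  intro α hα
  set a := α / 2
  set b := (1 + α) / 2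
  have ha : 0 < a := by have := hα.1; positivity
  have hb : b < 1 := by have := hα.2; simp only [b]; linarith
  have haα : a < α := by have := hα.1; simp only [a]; linarith
  have hαb : α < b := by have := hα.2; simp only [b]; linarith
  obtain ⟨u, hu, h⟩ := exists_summable_bound_transferOp ha (haα.trans hαb).le hb
  have hsub : Ioo a b ⊆ Ioo (0 : ℝ) 1 := Ioo_subset_Ioo ha.le hb.le
  have h1 : ContDiffOn ℝ 1 transferOp (Ioo a b) := by
    exact contDiffOn_tsum_Ioo hu
      (fun p x hx => hasDerivAt_transferTerm (hsub hx) p)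
      (fun p => (continuousOn_transferTermDot p).mono hsub)
      (fun p x hx => (h x (Ioo_subset_Icc_self hx) p).1)
      (fun p x hx => (h x (Ioo_subset_Icc_self hx) p).2)
  exact (h1.contDiffAt (Ioo_mem_nhds haα hαb)).contDiffWithinAt

/-- A norm limit of finite rank operators. -/
theorem isCompactOperator_transferOp {α : ℝ} (hα : α ∈ Ioo (0 : ℝ) 1) :
    IsCompactOperator (transferOp α) := by
  have h := (summable_transferOp hα).hasSum
  refine isClosed_setOfPred_isCompactOperator.mem_of_tendsto h (.of_forall fun s => ?_)
  induction s using Finset.cons_induction with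
  | empty => exact isCompactOperator_zero
  | cons p s hp ih =>
    rw [Finset.sum_cons]
    exact (isCompactOperator_smulRight _ _).add ih

/-- Summing over the Taylor index first reassembles the Cauchy extension at f_n(z) and at f_n(0). -/
theorem hasSum_transferOp_apply {α : ℝ} (hα : α ∈ Ioo (0 : ℝ) 1) (U : CircFun) (z : Circ) :
    HasSum (fun n => cauchyEv (branch α n z) U - cauchyEv (branch α n 0) U) (transferOp α U z) := by
  have h1 : HasSum (fun p : ℕ × ℕ => cauchyCoeff p.1 U * branchPow p α z) (transferOp α U z) := by
    have h2 := (summable_transferOp hα).hasSum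
    have h3 := (ContinuousLinearMap.apply ℂ CircFun U).hasSum h2
    exact (ContinuousMap.evalCLM ℂ z).hasSum h3
  have h4 := (Equiv.prodComm ℕ ℕ).hasSum_iff.2 h1
  refine h4.prod_fiberwise fun n => ?_
  have hball : Metric.ball (1 : ℂ) 1 ⊆ Metric.ball (1 : ℂ) (3 / 2) :=
    Metric.ball_subset_ball (by norm_num)
  have h5 := (hasSum_cauchyEv (hball (branch_mem_ball hα n (circ_mem_ball z))) U).sub
    (hasSum_cauchyEv (hball (branch_mem_ball hα n zero_mem_ball_two)) U)
  convert! h5 using 2 with j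
  simp only [Function.comp_apply, Equiv.prodComm_apply, Prod.swap_prod_mk, branchPow,
    ContinuousMap.sub_apply, ContinuousMap.pow_apply, branchFun_apply hα, ContinuousMap.one_apply,
    algebraMap_circFun_apply]
  ring

theorem ball_one_subset_ball : Metric.ball (1 : ℂ) 1 ⊆ Metric.ball (1 : ℂ) (3 / 2) :=
  Metric.ball_subset_ball (by norm_num)

theorem exists_summable_bound_leftInvIter_fixed {α : ℝ} (hα : α ∈ Ioo (0 : ℝ) 1) :
    ∃ u : ℕ → ℝ, Summable u ∧ ∀ y ∈ Metric.ball (1 : ℂ) 1, ∀ n, ‖leftInvIter α n y‖ ≤ u n := by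
  obtain ⟨u, hu, h⟩ := exists_summable_bound_leftInvIter hα.1 le_rfl hα.2
  exact ⟨u, hu, fun y hy n => (h α ⟨le_rfl, le_rfl⟩ y hy n).1⟩

theorem tendsto_leftInvIter {α : ℝ} (hα : α ∈ Ioo (0 : ℝ) 1) {y : ℂ}
    (hy : y ∈ Metric.ball (1 : ℂ) 1) :
    Filter.Tendsto (fun n => leftInvIter α n y) Filter.atTop (nhds 0) := by
  obtain ⟨u, hu, h⟩ := exists_summable_bound_leftInvIter_fixed hα
  exact squeeze_zero_norm (h y hy) hu.tendsto_atTop_zero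

theorem leftInv_one {α : ℝ} (hα : α ∈ Ioo (0 : ℝ) 1) : leftInv α 1 = 1 / 2 := by
  refine leftInv_eq hα (by norm_num) (by norm_num) ?_
  rw [leftBranch]
  norm_num

theorem branch_one (α : ℝ) (n : ℕ) : branch α n 1 = leftInvIter α n 1 := by
  rw [branch]; norm_num

theorem branch_zero {α : ℝ} (hα : α ∈ Ioo (0 : ℝ) 1) (n : ℕ) :
    branch α n 0 = leftInvIter α (n + 1) 1 := by
  rw [branch, leftInvIter_succ', leftInv_one hα, add_zero]

theorem one_mem_ball_one : (1 : ℂ) ∈ Metric.ball (1 : ℂ) 1 := by simp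

theorem exists_summable_bound_cauchyEv_branch {α : ℝ} (hα : α ∈ Ioo (0 : ℝ) 1) (U : CircFun) :
    ∃ v : ℕ → ℝ, Summable v ∧ ∀ n, ∀ z ∈ Metric.ball (1 : ℂ) 2,
      ‖cauchyEv (branch α n z) U - cauchyEv (branch α n 0) U‖ ≤ v n := by
  obtain ⟨u, hu, h⟩ := exists_summable_bound_leftInvIter_fixed hα
  refine ⟨fun n => 6 * (2 * u n) * ‖U‖, ((hu.mul_left 2).mul_left 6).mul_right _,
    fun n z hz => ?_⟩
  have h1 := branch_mem_ball hα n hz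
  have h2 := branch_mem_ball hα n zero_mem_ball_two
  refine (norm_cauchyEv_sub_le (mem_ball_iff_norm.1 h1).le (mem_ball_iff_norm.1 h2).le U).trans ?_
  refine mul_le_mul_of_nonneg_right (mul_le_mul_of_nonneg_left ?_ (by norm_num)) (norm_nonneg _)
  refine (norm_sub_le _ _).trans ?_
  have h3 : ‖branch α n z‖ ≤ u n := h _ (half_mem_ball hz) n
  have h4 : ‖branch α n 0‖ ≤ u n := h _ (half_mem_ball zero_mem_ball_two) n
  linarith

/-- Since f_n(1) = g^n(1) and f_n(0) = g^(n+1)(1), the sum telescopes, and g^n(1) → 0. This is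
conservation of mass by the induced transfer operator. -/
theorem hasSum_cauchyEv_branch_one {α : ℝ} (hα : α ∈ Ioo (0 : ℝ) 1) (U : CircFun) :
    HasSum (fun n => cauchyEv (branch α n 1) U - cauchyEv (branch α n 0) U)
      (cauchyEv 1 U - cauchyEv 0 U) := by
  obtain ⟨v, hv, h⟩ := exists_summable_bound_cauchyEv_branch hα U
  have hs : Summable fun n => cauchyEv (branch α n 1) U - cauchyEv (branch α n 0) U :=
    hv.of_norm_bounded fun n => h n 1 one_mem_ball_two
  have h1 := hs.hasSum.tendsto_sum_nat
  simp only [branch_one, branch_zero hα] at h1 hs ⊢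
  simp only [Finset.sum_range_sub'] at h1
  have h2 : Filter.Tendsto (fun n => cauchyEv (leftInvIter α n 1) U) Filter.atTop
      (nhds (cauchyEv 0 U)) := by
    have h3 := ((differentiableOn_cauchyEv U).differentiableAt
      (Metric.isOpen_ball.mem_nhds (by simp; norm_num : (0 : ℂ) ∈ Metric.ball 1 (3 / 2)))).continuousAt
    exact h3.tendsto.comp (tendsto_leftInvIter hα one_mem_ball_one)
  have h4 := tendsto_nhds_unique h1 (h2.const_sub (cauchyEv (leftInvIter α 0 1) U))
  rw [leftInvIter_zero] at h4
  exact h4 ▸ hs.hasSum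

/-- The identity function on `Circ`. -/
noncomputable def circId : CircFun := ⟨fun z => z, continuous_subtype_val⟩

/-- The rank one operator `U ↦ (U 1 - U 0) • id`, on Cauchy extensions. -/
noncomputable def massOp : CircFun →L[ℂ] CircFun := (cauchyEv 1 - cauchyEv 0).smulRight circId

/-- The operator whose inverse sends `circId` to the distribution function of the invariant
density of the induced map. -/
noncomputable def resolvOp (α : ℝ) : CircFun →L[ℂ] CircFun := 1 - (transferOp α - massOp)

theorem resolvOp_apply (α : ℝ) (U : CircFun) (z : Circ) :
    resolvOp α U z = U z - transferOp α U z + (cauchyEv 1 U - cauchyEv 0 U) * z := by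
  simp [resolvOp, massOp, circId]
  ring

section Equation
variable {α : ℝ} (hα : α ∈ Ioo (0 : ℝ) 1) {Y : ℂ → ℂ}
  (hY : DifferentiableOn ℂ Y (Metric.ball 1 2)) {U : CircFun}
  (hU : ∀ z : Circ, resolvOp α U z = Y z)
include hα hY hU

/-- The right side is holomorphic on the disc of radius 2, because the branches map it into the disc
of radius 1, and it equals U on the circle. So a solution U is automatically the boundary value of
its extension, and the equation holds inside. -/
theorem cauchyEv_eq_of_resolvOp {z : ℂ} (hz : z ∈ Metric.ball (1 : ℂ) (3 / 2)) :
    cauchyEv z U = Y z + (∑' n, (cauchyEv (branch α n z) U - cauchyEv (branch α n 0) U)) -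
      (cauchyEv 1 U - cauchyEv 0 U) * z := by
  obtain ⟨v, hv, h⟩ := exists_summable_bound_cauchyEv_branch hα U
  refine cauchyEv_eq (V := fun z => Y z +
    (∑' n, (cauchyEv (branch α n z) U - cauchyEv (branch α n 0) U)) -
      (cauchyEv 1 U - cauchyEv 0 U) * z) ?_ (fun w => ?_) hz
  · have h1 : DifferentiableOn ℂ
        (fun z => ∑' n, (cauchyEv (branch α n z) U - cauchyEv (branch α n 0) U))
        (Metric.ball 1 2) := by
      refine Complex.differentiableOn_tsum_of_summable_norm hv (fun n => ?_) Metric.isOpen_ball h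
      refine DifferentiableOn.sub_const ?_ _
      exact (differentiableOn_cauchyEv U).comp (differentiableOn_branch hα n)
        fun z hz => ball_one_subset_ball (branch_mem_ball hα n hz)
    have h2 : DifferentiableOn ℂ (fun z : ℂ => (cauchyEv 1 U - cauchyEv 0 U) * z)
        (Metric.ball 1 2) := by fun_prop
    have h3 := (hY.add h1).sub h2
    refine (h3.mono ?_).diffContOnCl
    rw [closure_ball _ (by norm_num)]
    exact Metric.closedBall_subset_ball (by norm_num)
  · have h1 := resolvOp_apply α U w
    rw [(hasSum_transferOp_apply hα U w).tsum_eq, ← hU w, h1]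
    ring

theorem cauchyEv_zero_of_resolvOp (hY0 : Y 0 = 0) : cauchyEv 0 U = 0 := by
  rw [cauchyEv_eq_of_resolvOp hα hY hU (by simp; norm_num)]
  simp [hY0]

/-- At z = 1 the telescoped series cancels the term from `massOp`. Thus the correction drops out of
the equation except that it prescribes the total mass Y(1). -/
theorem cauchyEv_one_of_resolvOp (hY0 : Y 0 = 0) : cauchyEv 1 U = Y 1 := by
  have h1 := cauchyEv_eq_of_resolvOp hα hY hU (z := 1) (by simp)
  rw [(hasSum_cauchyEv_branch_one hα U).tsum_eq, cauchyEv_zero_of_resolvOp hα hY hU hY0] at h1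
  linear_combination h1

theorem hasSum_branch_of_resolvOp (hY0 : Y 0 = 0) {z : ℂ}
    (hz : z ∈ Metric.ball (1 : ℂ) (3 / 2)) :
    HasSum (fun n => cauchyEv (branch α n z) U - cauchyEv (branch α n 0) U)
      (cauchyEv z U - (Y z - Y 1 * z)) := by
  have h1 := cauchyEv_eq_of_resolvOp hα hY hU hz
  rw [cauchyEv_one_of_resolvOp hα hY hU hY0, cauchyEv_zero_of_resolvOp hα hY hU hY0] at h1
  obtain ⟨v, hv, h⟩ := exists_summable_bound_cauchyEv_branch hα U
  have hs : Summable fun n => cauchyEv (branch α n z) U - cauchyEv (branch α n 0) U :=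
    hv.of_norm_bounded fun n => h n z (Metric.ball_subset_ball (by norm_num) hz)
  convert! hs.hasSum using 1
  rw [h1]; ring

/-- Termwise differentiation of a locally uniformly convergent series of holomorphic functions. It
returns from distribution functions to the usual transfer operator P on densities: for u = U', u -
Pu = Y' - Y(1). -/
theorem hasSum_deriv_branch_of_resolvOp (hY0 : Y 0 = 0) {z : ℂ}
    (hz : z ∈ Metric.ball (1 : ℂ) (3 / 2)) :
    HasSum (fun n => deriv (fun y => cauchyEv y U) (branch α n z) * deriv (branch α n) z)
      (deriv (fun y => cauchyEv y U) z - (deriv Y z - Y 1)) := by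
  obtain ⟨v, hv, h⟩ := exists_summable_bound_cauchyEv_branch hα U
  have hsub : Metric.ball (1 : ℂ) (3 / 2) ⊆ Metric.ball (1 : ℂ) 2 :=
    Metric.ball_subset_ball (by norm_num)
  have hdb : ∀ n, ∀ w ∈ Metric.ball (1 : ℂ) (3 / 2), HasDerivAt
      (fun z => cauchyEv (branch α n z) U - cauchyEv (branch α n 0) U)
      (deriv (fun y => cauchyEv y U) (branch α n w) * deriv (branch α n) w) w := by
    intro n w hw
    refine HasDerivAt.sub_const _ ?_
    have h1 := ((differentiableOn_cauchyEv U).differentiableAt (Metric.isOpen_ball.mem_nhds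
      (ball_one_subset_ball (branch_mem_ball hα n (hsub hw))))).hasDerivAt
    have h2 := ((differentiableOn_branch hα n).differentiableAt
      (Metric.isOpen_ball.mem_nhds (hsub hw))).hasDerivAt
    exact h1.comp w h2
  have h1 := Complex.hasSum_deriv_of_summable_norm hv
    (F := fun n z => cauchyEv (branch α n z) U - cauchyEv (branch α n 0) U)
    (fun n w hw => (hdb n w hw).differentiableAt.differentiableWithinAt)
    Metric.isOpen_ball (fun n w hw => h n w (hsub hw)) hz
  convert! h1 using 1
  · ext n; exact (hdb n z hz).deriv.symm
  · have h2 : (fun w => ∑' n, (cauchyEv (branch α n w) U - cauchyEv (branch α n 0) U)) =ᶠ[nhds z]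
        fun w => cauchyEv w U - (Y w - Y 1 * w) := by
      filter_upwards [Metric.isOpen_ball.mem_nhds hz] with w hw
      exact (hasSum_branch_of_resolvOp hα hY hU hY0 hw).tsum_eq
    rw [h2.deriv_eq]
    have h3 := ((differentiableOn_cauchyEv U).differentiableAt
      (Metric.isOpen_ball.mem_nhds hz)).hasDerivAt
    have h4 := (hY.differentiableAt (Metric.isOpen_ball.mem_nhds (hsub hz))).hasDerivAt
    have h5 := h3.sub (h4.sub ((hasDerivAt_id z).const_mul (Y 1)))
    rw [mul_one] at h5
    exact h5.deriv.symm

end Equation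

theorem isCompactOperator_sub_massOp {α : ℝ} (hα : α ∈ Ioo (0 : ℝ) 1) :
    IsCompactOperator (transferOp α - massOp) :=
  (isCompactOperator_transferOp hα).sub (isCompactOperator_smulRight _ _)

/-- Fredholm alternative. -/
theorem isUnit_resolvOp_of_injective {α : ℝ} (hα : α ∈ Ioo (0 : ℝ) 1)
    (h : ∀ U, resolvOp α U = 0 → U = 0) : IsUnit (resolvOp α) := by
  rcases (isCompactOperator_sub_massOp hα).hasEigenvalue_or_mem_resolventSet one_ne_zero with h1 | h1
  · obtain ⟨U, hU⟩ := h1.exists_hasEigenvector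
    refine absurd (h U ?_) hU.2
    have h2 : (transferOp α - massOp) U = (1 : ℂ) • U := hU.apply_eq_smul
    rw [one_smul] at h2
    simp only [resolvOp]
    rw [sub_apply, h2]
    simp
  · have h2 := spectrum.mem_resolventSet_iff.1 h1
    rwa [map_one] at h2

/-! ### Inverse branches on the real line -/

theorem conj_leftBranch (α : ℝ) {x : ℂ} (hx : 0 < x.re) :
    leftBranch α ((starRingEnd ℂ) x) = (starRingEnd ℂ) (leftBranch α x) := by
  have h1 : (2 * x).arg ≠ Real.pi := by
    have := Complex.abs_arg_lt_pi_div_two_iff.2 (Or.inl (two_mul_re_pos hx))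
    intro h
    rw [h, abs_of_pos Real.pi_pos] at this
    linarith [Real.pi_pos]
  have h2 := Complex.conj_cpow (2 * x) (α : ℂ) h1
  rw [Complex.conj_ofReal, map_mul, Complex.conj_ofNat] at h2
  rw [leftBranch, h2]
  simp [leftBranch]

theorem conj_leftInv {α : ℝ} (hα : α ∈ Ioo (0 : ℝ) 1) {y : ℂ} (hy : 0 < y.re) :
    leftInv α ((starRingEnd ℂ) y) = (starRingEnd ℂ) (leftInv α y) := by
  have hx := leftInv_re_pos hα hy
  refine leftInv_eq hα (by simpa using hx) (by simpa using hy) ?_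
  rw [conj_leftBranch α hx, leftBranch_leftInv hα hy]

theorem ofReal_mem_ball {t : ℝ} : (t : ℂ) ∈ Metric.ball (1 : ℂ) 1 ↔ t ∈ Ioo (0 : ℝ) 2 := by
  rw [mem_ball_iff_norm, ← Complex.ofReal_one, ← Complex.ofReal_sub, Complex.norm_real,
    Real.norm_eq_abs, abs_lt]
  constructor <;> rintro ⟨h1, h2⟩ <;> constructor <;> linarith

/-- The left branch commutes with conjugation, hence so does its unique inverse, and real points
stay real. -/
theorem conj_leftInvIter {α : ℝ} (hα : α ∈ Ioo (0 : ℝ) 1) {t : ℝ} (ht : t ∈ Ioo (0 : ℝ) 2)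
    (n : ℕ) : (starRingEnd ℂ) (leftInvIter α n t) = leftInvIter α n t := by
  induction n with
  | zero => simp [leftInvIter_zero]
  | succ n ih =>
    rw [leftInvIter_succ, ← conj_leftInv hα (leftInvIter_re_pos hα (ofReal_mem_ball.2 ht) n), ih]

/-- The real version of `leftInvIter`. -/
noncomputable def leftInvReal (α : ℝ) (n : ℕ) (t : ℝ) : ℝ := (leftInvIter α n t).re

theorem leftInvReal_zero (α t : ℝ) : leftInvReal α 0 t = t := by
  simp [leftInvReal, leftInvIter_zero]

/-- The derivative of `leftInvReal`. -/
noncomputable def leftInvDer (α : ℝ) (n : ℕ) (t : ℝ) : ℝ := (deriv (leftInvIter α n) t).re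

/-- The real inverse branches of the induced map. -/
noncomputable def branchReal (α : ℝ) (n : ℕ) (t : ℝ) : ℝ := leftInvReal α n ((1 + t) / 2)

/-- The derivatives of the real inverse branches of the induced map. -/
noncomputable def branchDer (α : ℝ) (n : ℕ) (t : ℝ) : ℝ := leftInvDer α n ((1 + t) / 2) / 2

section
variable {α : ℝ} (hα : α ∈ Ioo (0 : ℝ) 1)
include hα

theorem ofReal_leftInvReal {t : ℝ} (ht : t ∈ Ioo (0 : ℝ) 2) (n : ℕ) :
    (leftInvReal α n t : ℂ) = leftInvIter α n t :=
  Complex.conj_eq_iff_re.1 (conj_leftInvIter hα ht n)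

theorem leftInvReal_mem_Ioo {t : ℝ} (ht : t ∈ Ioo (0 : ℝ) 2) (n : ℕ) :
    leftInvReal α n t ∈ Ioo (0 : ℝ) 2 := by
  rw [← ofReal_mem_ball, ofReal_leftInvReal hα ht]
  exact leftInvIter_mem_ball hα (ofReal_mem_ball.2 ht) n

theorem leftInvReal_succ {t : ℝ} (ht : t ∈ Ioo (0 : ℝ) 2) (n : ℕ) :
    leftInvReal α (n + 1) t = leftInvReal α 1 (leftInvReal α n t) := by
  rw [leftInvReal, leftInvIter_succ, leftInvReal, ofReal_leftInvReal hα ht]; rfl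

theorem leftInvReal_mul {t : ℝ} (ht : t ∈ Ioo (0 : ℝ) 2) :
    leftInvReal α 1 t * (1 + (2 * leftInvReal α 1 t) ^ α) = t := by
  have h1 := leftBranch_leftInvIter_succ hα (ofReal_mem_ball.2 ht) 0
  rw [leftInvIter_zero, zero_add, ← ofReal_leftInvReal hα ht, leftBranch] at h1
  have h2 := (leftInvReal_mem_Ioo hα ht 1).1
  have h3 : ((leftInvReal α 1 t * (1 + (2 * leftInvReal α 1 t) ^ α) : ℝ) : ℂ) = t := by
    rw [← h1]
    push_cast
    rw [Complex.ofReal_cpow (by linarith)]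
    push_cast; rfl
  exact_mod_cast h3

omit hα in
theorem strictMonoOn_mul_one_add_rpow (hα : 0 < α) :
    StrictMonoOn (fun x : ℝ => x * (1 + (2 * x) ^ α)) (Ici 0) := by
  intro x hx y hy hxy
  have hx' : (0 : ℝ) ≤ x := hx
  have h1 : (2 * x) ^ α ≤ (2 * y) ^ α :=
    Real.rpow_le_rpow (by linarith) (by linarith) hα.le
  have h2 : 0 ≤ (2 * x) ^ α := Real.rpow_nonneg (by linarith) _
  simp only
  nlinarith

theorem leftInvReal_one_eq {x t : ℝ} (hx : 0 < x) (ht : t ∈ Ioo (0 : ℝ) 2)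
    (h : x * (1 + (2 * x) ^ α) = t) : leftInvReal α 1 t = x :=
  (strictMonoOn_mul_one_add_rpow hα.1).injOn (leftInvReal_mem_Ioo hα ht 1).1.le hx.le
    ((leftInvReal_mul hα ht).trans h.symm)

theorem strictMonoOn_leftInvReal (n : ℕ) : StrictMonoOn (leftInvReal α n) (Ioo 0 2) := by
  have h1 : StrictMonoOn (leftInvReal α 1) (Ioo 0 2) := by
    intro s hs t ht hst
    by_contra h
    have h2 := (strictMonoOn_mul_one_add_rpow hα.1).monotoneOn (leftInvReal_mem_Ioo hα ht 1).1.le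
      (leftInvReal_mem_Ioo hα hs 1).1.le (not_lt.1 h)
    simp only [leftInvReal_mul hα ht, leftInvReal_mul hα hs] at h2
    linarith
  induction n with
  | zero => intro s _ t _ hst; simpa [leftInvReal_zero] using hst
  | succ n ih =>
    intro s hs t ht hst
    rw [leftInvReal_succ hα hs, leftInvReal_succ hα ht]
    exact h1 (leftInvReal_mem_Ioo hα hs n) (leftInvReal_mem_Ioo hα ht n) (ih hs ht hst)

theorem leftInvReal_one_one : leftInvReal α 1 1 = 1 / 2 :=
  leftInvReal_one_eq hα (by norm_num) (by norm_num) (by norm_num)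

omit hα in
theorem Ioc_subset_Ioo_two : Ioc (0 : ℝ) 1 ⊆ Ioo 0 2 := fun _ ht => ⟨ht.1, by linarith [ht.2]⟩

theorem leftInvReal_one_mem_Ioc {t : ℝ} (ht : t ∈ Ioc (0 : ℝ) 1) :
    leftInvReal α 1 t ∈ Ioc (0 : ℝ) (1 / 2) := by
  have ht' := Ioc_subset_Ioo_two ht
  refine ⟨(leftInvReal_mem_Ioo hα ht' 1).1, ?_⟩
  rw [← leftInvReal_one_one hα]
  exact (strictMonoOn_leftInvReal hα 1).monotoneOn ht' (by norm_num) ht.2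

theorem leftInvReal_mem_Ioc {t : ℝ} (ht : t ∈ Ioc (0 : ℝ) 1) (n : ℕ) :
    leftInvReal α n t ∈ Ioc (0 : ℝ) 1 := by
  induction n with
  | zero => rwa [leftInvReal_zero]
  | succ n ih =>
    rw [leftInvReal_succ hα (Ioc_subset_Ioo_two ht)]
    have := leftInvReal_one_mem_Ioc hα ih
    exact ⟨this.1, this.2.trans (by norm_num)⟩

omit hα in
theorem lsvMap_left {x : ℝ} (hx : x ∈ Ioc (0 : ℝ) (1 / 2)) :
    lsvMap α x = x * (1 + (2 * x) ^ α) := by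
  rw [lsvMap, if_pos hx.2, Real.mul_rpow zero_le_two hx.1.le]

theorem lsvMap_leftInvReal_one {t : ℝ} (ht : t ∈ Ioc (0 : ℝ) 1) :
    lsvMap α (leftInvReal α 1 t) = t := by
  rw [lsvMap_left (leftInvReal_one_mem_Ioc hα ht), leftInvReal_mul hα (Ioc_subset_Ioo_two ht)]

theorem lsvMap_leftInvReal_succ {t : ℝ} (ht : t ∈ Ioc (0 : ℝ) 1) (n : ℕ) :
    lsvMap α (leftInvReal α (n + 1) t) = leftInvReal α n t := by
  rw [leftInvReal_succ hα (Ioc_subset_Ioo_two ht),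
    lsvMap_leftInvReal_one hα (leftInvReal_mem_Ioc hα ht n)]

theorem lsvMap_mem_Ioc_left {x : ℝ} (hx : x ∈ Ioc (0 : ℝ) (1 / 2)) :
    lsvMap α x ∈ Ioc (0 : ℝ) 1 := by
  rw [lsvMap_left hx]
  have h2 : 0 < (2 * x) ^ α := Real.rpow_pos_of_pos (by linarith [hx.1]) _
  have h3 : (2 * x) ^ α ≤ 1 := Real.rpow_le_one (by linarith [hx.1]) (by linarith [hx.2]) hα.1.le
  have := hx.1
  have := hx.2
  constructor
  · positivity
  · nlinarith

theorem leftInvReal_lsvMap {x : ℝ} (hx : x ∈ Ioc (0 : ℝ) (1 / 2)) :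
    leftInvReal α 1 (lsvMap α x) = x :=
  leftInvReal_one_eq hα hx.1 (Ioc_subset_Ioo_two (lsvMap_mem_Ioc_left hα hx)) (lsvMap_left hx).symm

theorem image_leftInvReal {t : ℝ} (ht : t ∈ Ioc (0 : ℝ) 1) (n : ℕ) :
    leftInvReal α n '' Ioc 0 t = Ioc 0 (leftInvReal α n t) := by
  have hsub : Ioc 0 t ⊆ Ioc (0 : ℝ) 1 := Ioc_subset_Ioc_right ht.2
  have h1 : ∀ t ∈ Ioc (0 : ℝ) 1, leftInvReal α 1 '' Ioc 0 t = Ioc 0 (leftInvReal α 1 t) := by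
    intro t ht
    have hsub : Ioc 0 t ⊆ Ioc (0 : ℝ) 1 := Ioc_subset_Ioc_right ht.2
    ext x
    constructor
    · rintro ⟨s, hs, rfl⟩
      exact ⟨(leftInvReal_one_mem_Ioc hα (hsub hs)).1,
        (strictMonoOn_leftInvReal hα 1).monotoneOn (Ioc_subset_Ioo_two (hsub hs))
          (Ioc_subset_Ioo_two ht) hs.2⟩
    · intro hx
      have hx' : x ∈ Ioc (0 : ℝ) (1 / 2) := ⟨hx.1, hx.2.trans (leftInvReal_one_mem_Ioc hα ht).2⟩
      refine ⟨lsvMap α x, ⟨(lsvMap_mem_Ioc_left hα hx').1, ?_⟩, leftInvReal_lsvMap hα hx'⟩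
      rw [← leftInvReal_mul hα (Ioc_subset_Ioo_two ht), lsvMap_left hx']
      exact (strictMonoOn_mul_one_add_rpow hα.1).monotoneOn hx.1.le
        (leftInvReal_one_mem_Ioc hα ht).1.le hx.2
  induction n with
  | zero =>
    rw [leftInvReal_zero]
    ext x; simp [leftInvReal_zero]
  | succ n ih =>
    have h2 : leftInvReal α (n + 1) '' Ioc 0 t = leftInvReal α 1 '' (leftInvReal α n '' Ioc 0 t) := by
      rw [image_image]
      exact image_congr fun s hs => leftInvReal_succ hα (Ioc_subset_Ioo_two (hsub hs)) n
    rw [h2, ih, h1 _ (leftInvReal_mem_Ioc hα ht n), ← leftInvReal_succ hα (Ioc_subset_Ioo_two ht)]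

/-- The inverse branches are increasing with nonnegative real derivative. -/
theorem exists_hasDerivAt_leftInvIter {t : ℝ} (ht : t ∈ Ioo (0 : ℝ) 2) (n : ℕ) :
    ∃ d : ℝ, 0 < d ∧ HasDerivAt (leftInvIter α n) (d : ℂ) t := by
  induction n with
  | zero => exact ⟨1, one_pos, by rw [Complex.ofReal_one]; exact hasDerivAt_id (t : ℂ)⟩
  | succ n ih =>
    obtain ⟨d, hd, h⟩ := ih
    set x := leftInvReal α n t with hx
    have hx' : (x : ℂ) = leftInvIter α n t := ofReal_leftInvReal hα ht n
    have hx0 := leftInvReal_mem_Ioo hα ht n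
    have h1 := hasDerivAt_leftInv hα (y := leftInvIter α n t)
      (leftInvIter_re_pos hα (ofReal_mem_ball.2 ht) n)
    have h2 := h1.comp (t : ℂ) h
    set z := leftInvReal α (n + 1) t with hz
    have hz0 := (leftInvReal_mem_Ioo hα ht (n + 1)).1
    have hz' : (z : ℂ) = leftInv α (leftInvIter α n t) := by
      rw [hz, ofReal_leftInvReal hα ht, leftInvIter_succ]
    have h3 : (1 + (1 + α) * (2 * leftInv α (leftInvIter α n t)) ^ (α : ℂ))⁻¹ * (d : ℂ) =
        (((1 + (1 + α) * (2 * z) ^ α)⁻¹ * d : ℝ) : ℂ) := by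
      rw [← hz']
      push_cast
      rw [Complex.ofReal_cpow (by linarith)]
      push_cast; rfl
    refine ⟨(1 + (1 + α) * (2 * z) ^ α)⁻¹ * d, ?_, ?_⟩
    · have := hα.1
      have h4 : 0 < (2 * z) ^ α := Real.rpow_pos_of_pos (by linarith) _
      positivity
    · rw [h3] at h2
      exact h2.congr_of_eventuallyEq (.of_forall fun y => leftInvIter_succ α n y)

theorem hasDerivAt_leftInvIter_real {t : ℝ} (ht : t ∈ Ioo (0 : ℝ) 2) (n : ℕ) :
    HasDerivAt (leftInvIter α n) (leftInvDer α n t : ℂ) t := by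
  obtain ⟨d, hd, h⟩ := exists_hasDerivAt_leftInvIter hα ht n
  rw [leftInvDer, h.deriv, Complex.ofReal_re]
  exact h

theorem leftInvDer_pos {t : ℝ} (ht : t ∈ Ioo (0 : ℝ) 2) (n : ℕ) : 0 < leftInvDer α n t := by
  obtain ⟨d, hd, h⟩ := exists_hasDerivAt_leftInvIter hα ht n
  rwa [leftInvDer, h.deriv, Complex.ofReal_re]

theorem hasDerivAt_leftInvReal {t : ℝ} (ht : t ∈ Ioo (0 : ℝ) 2) (n : ℕ) :
    HasDerivAt (leftInvReal α n) (leftInvDer α n t) t :=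
  (hasDerivAt_leftInvIter_real hα ht n).real_of_complex

theorem continuousOn_leftInvReal (n : ℕ) : ContinuousOn (leftInvReal α n) (Ioo 0 2) :=
  fun _ ht => (hasDerivAt_leftInvReal hα ht n).continuousAt.continuousWithinAt

theorem continuousOn_leftInvDer (n : ℕ) : ContinuousOn (leftInvDer α n) (Ioo 0 2) := by
  have h1 := ((differentiableOn_leftInvIter hα n).deriv Metric.isOpen_ball).continuousOn
  exact Complex.continuous_re.comp_continuousOn (h1.comp Complex.continuous_ofReal.continuousOn
    fun t ht => ofReal_mem_ball.2 ht)

theorem tendsto_leftInvReal {t : ℝ} (ht : t ∈ Ioo (0 : ℝ) 2) :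
    Filter.Tendsto (fun n => leftInvReal α n t) Filter.atTop (nhds 0) := by
  have := (Complex.continuous_re.tendsto 0).comp (tendsto_leftInvIter hα (ofReal_mem_ball.2 ht))
  rwa [Complex.zero_re] at this

theorem leftInvReal_succ_one (n : ℕ) : leftInvReal α (n + 1) 1 = leftInvReal α n (1 / 2) := by
  rw [leftInvReal, Complex.ofReal_one, leftInvIter_succ', leftInv_one hα, leftInvReal]
  norm_num

/-! ### The branches of the induced map on `(0, 1]` -/

omit hα in
theorem half_mem_Ioo {t : ℝ} (ht : t ∈ Ioo (-1 : ℝ) 3) : (1 + t) / 2 ∈ Ioo (0 : ℝ) 2 := by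
  constructor <;> linarith [ht.1, ht.2]

theorem hasDerivAt_branchReal {t : ℝ} (ht : t ∈ Ioo (-1 : ℝ) 3) (n : ℕ) :
    HasDerivAt (branchReal α n) (branchDer α n t) t := by
  have h1 : HasDerivAt (fun t : ℝ => (1 + t) / 2) (1 / 2) t :=
    ((hasDerivAt_id t).const_add 1).div_const 2
  have h2 := (hasDerivAt_leftInvReal hα (half_mem_Ioo ht) n).comp t h1
  rwa [mul_one_div] at h2

theorem branchDer_pos {t : ℝ} (ht : t ∈ Ioo (-1 : ℝ) 3) (n : ℕ) : 0 < branchDer α n t :=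
  half_pos (leftInvDer_pos hα (half_mem_Ioo ht) n)

theorem ofReal_branchReal {t : ℝ} (ht : t ∈ Ioo (-1 : ℝ) 3) (n : ℕ) :
    (branchReal α n t : ℂ) = branch α n t := by
  rw [branchReal, ofReal_leftInvReal hα (half_mem_Ioo ht), branch]; push_cast; rfl

theorem deriv_branch {t : ℝ} (ht : t ∈ Ioo (-1 : ℝ) 3) (n : ℕ) :
    deriv (branch α n) t = branchDer α n t := by
  have h1 : HasDerivAt (fun t : ℂ => (1 + t) / 2) (1 / 2) t :=
    ((hasDerivAt_id (t : ℂ)).const_add 1).div_const 2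
  have h3 := hasDerivAt_leftInvIter_real hα (half_mem_Ioo ht) n
  push_cast at h3
  have h2 := h3.comp (t : ℂ) h1
  have h4 : deriv (branch α n) t = _ := h2.deriv
  rw [h4, branchDer]; push_cast; ring

theorem injOn_branchReal (n : ℕ) : InjOn (branchReal α n) (Ioc 0 1) := by
  intro s hs t ht h
  have h1 := (strictMonoOn_leftInvReal hα n).injOn (half_mem_Ioo ⟨by linarith [hs.1], by linarith [hs.2]⟩)
    (half_mem_Ioo ⟨by linarith [ht.1], by linarith [ht.2]⟩) h
  linarith

theorem image_branchReal (n : ℕ) :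
    branchReal α n '' Ioc 0 1 = Ioc (leftInvReal α (n + 1) 1) (leftInvReal α n 1) := by
  have h1 : branchReal α n '' Ioc 0 1 = leftInvReal α n '' (Ioc 0 1 \ Ioc 0 (1 / 2)) := by
    have h2 : (Ioc 0 1 \ Ioc 0 (1 / 2) : Set ℝ) = (fun t : ℝ => (1 + t) / 2) '' Ioc 0 1 := by
      ext x
      constructor
      · rintro ⟨h, h'⟩
        have h3 : 1 / 2 < x := by
          by_contra h4
          exact h' ⟨h.1, not_lt.1 h4⟩
        exact ⟨2 * x - 1, ⟨by linarith, by linarith [h.2]⟩, by ring⟩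
      · rintro ⟨s, hs, rfl⟩
        exact ⟨⟨by linarith [hs.1], by linarith [hs.2]⟩, fun h => by
          have := h.2
          linarith [hs.1]⟩
    rw [h2, image_image]
    rfl
  rw [h1, ((strictMonoOn_leftInvReal hα n).injOn.mono Ioc_subset_Ioo_two).image_sdiff_subset
    (Ioc_subset_Ioc_right (by norm_num)), image_leftInvReal hα (by norm_num),
    image_leftInvReal hα (by norm_num), leftInvReal_succ_one hα]
  ext x
  have h0 := (leftInvReal_mem_Ioc hα (t := 1 / 2) (by norm_num) n).1
  constructor
  · rintro ⟨h, h'⟩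
    refine ⟨?_, h.2⟩
    by_contra h4
    exact h' ⟨h.1, not_lt.1 h4⟩
  · rintro ⟨h, h'⟩
    exact ⟨⟨h0.trans h, h'⟩, fun h'' => absurd h''.2 (not_le.2 h)⟩

theorem antitone_leftInvReal_one : Antitone fun n => leftInvReal α n 1 := by
  refine antitone_nat_of_succ_le fun n => ?_
  rw [leftInvReal_succ_one hα]
  exact (strictMonoOn_leftInvReal hα n).monotoneOn (by norm_num) (by norm_num) (by norm_num)

theorem iUnion_image_branchReal : ⋃ n, branchReal α n '' Ioc 0 1 = Ioc 0 1 := by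
  ext x
  simp only [mem_iUnion, image_branchReal hα]
  constructor
  · rintro ⟨n, h1, h2⟩
    exact ⟨(leftInvReal_mem_Ioc hα (by norm_num) (n + 1)).1.trans h1,
      h2.trans (leftInvReal_mem_Ioc hα (by norm_num) n).2⟩
  · intro hx
    have h1 : ∃ n, leftInvReal α n 1 < x :=
      ((tendsto_leftInvReal hα (t := 1) (by norm_num)).eventually_lt_const hx.1).exists
    classical
    obtain ⟨m, hm⟩ : ∃ m, Nat.find h1 = m + 1 := by
      refine Nat.exists_eq_succ_of_ne_zero fun h => ?_
      have h2 := Nat.find_spec h1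
      rw [h, leftInvReal_zero] at h2
      exact absurd hx.2 (not_le.2 h2)
    refine ⟨m, ?_, ?_⟩
    · rw [← hm]; exact Nat.find_spec h1
    · exact not_lt.1 (Nat.find_min h1 (by omega))

theorem pairwise_disjoint_image_branchReal :
    Pairwise (Function.onFun Disjoint fun n => branchReal α n '' Ioc 0 1) := by
  simp only [image_branchReal hα]
  exact (antitone_leftInvReal_one hα).pairwise_disjoint_on_Ioc_succ

/-- Duality of the transfer operator and composition with the induced map. -/
theorem hasSum_integral_branchReal {E : Type*} [NormedAddCommGroup E] [NormedSpace ℝ E]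
    {F : ℝ → E} (hF : IntegrableOn F (Ioc 0 1)) :
    HasSum (fun n => ∫ t in Ioc 0 1, branchDer α n t • F (branchReal α n t))
      (∫ t in Ioc 0 1, F t) := by
  have hm : ∀ n, MeasurableSet (branchReal α n '' Ioc 0 1) := fun n => by
    rw [image_branchReal hα]; exact measurableSet_Ioc
  have h1 := hasSum_integral_iUnion (μ := volume) hm (pairwise_disjoint_image_branchReal hα)
    (f := F) (by rwa [iUnion_image_branchReal hα])
  rw [iUnion_image_branchReal hα] at h1
  convert! h1 using 2 with n
  rw [integral_image_eq_integral_abs_deriv_smul measurableSet_Ioc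
    (fun t ht => (hasDerivAt_branchReal hα ⟨by linarith [ht.1], by linarith [ht.2]⟩ n).hasDerivWithinAt)
    (injOn_branchReal hα n)]
  refine setIntegral_congr_fun measurableSet_Ioc fun t ht => ?_
  rw [abs_of_pos (branchDer_pos hα ⟨by linarith [ht.1], by linarith [ht.2]⟩ n)]

theorem integrableOn_branchReal {E : Type*} [NormedAddCommGroup E] [NormedSpace ℝ E]
    {F : ℝ → E} (hF : IntegrableOn F (Ioc 0 1)) (n : ℕ) :
    IntegrableOn (fun t => branchDer α n t • F (branchReal α n t)) (Ioc 0 1) := by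
  have h1 : IntegrableOn F (branchReal α n '' Ioc 0 1) := by
    exact hF.mono_set (Subset.trans (subset_iUnion (fun n => branchReal α n '' Ioc 0 1) n)
      (iUnion_image_branchReal hα).subset)
  rw [integrableOn_image_iff_integrableOn_abs_deriv_smul measurableSet_Ioc
    (fun t ht => (hasDerivAt_branchReal hα ⟨by linarith [ht.1], by linarith [ht.2]⟩ n).hasDerivWithinAt)
    (injOn_branchReal hα n)] at h1
  refine h1.congr_fun (fun t ht => ?_) measurableSet_Ioc
  simp only
  rw [abs_of_pos (branchDer_pos hα ⟨by linarith [ht.1], by linarith [ht.2]⟩ n)]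

end

/-! ### Positivity of fixed points of the transfer operator -/

theorem integral_norm_le_tsum {X E : Type*} [MeasurableSpace X] {μ : Measure X}
    [NormedAddCommGroup E] [NormedSpace ℝ E] [CompleteSpace E] {F : ℕ → X → E} {g : X → E}
    (hg : AEStronglyMeasurable g μ) (hF : ∀ n, Integrable (F n) μ)
    (hs : Summable fun n => ∫ x, ‖F n x‖ ∂μ) (h : ∀ᵐ x ∂μ, HasSum (fun n => F n x) (g x)) :
    ∫ x, ‖g x‖ ∂μ ≤ ∑' n, ∫ x, ‖F n x‖ ∂μ := by
  have h0 : 0 ≤ ∑' n, ∫ x, ‖F n x‖ ∂μ :=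
    tsum_nonneg fun n => integral_nonneg fun x => norm_nonneg _
  rw [integral_norm_eq_lintegral_enorm hg]
  refine ENNReal.toReal_le_of_le_ofReal h0 ?_
  rw [ENNReal.ofReal_tsum_of_nonneg (fun n => integral_nonneg fun x => norm_nonneg _) hs]
  simp_rw [fun n => ofReal_integral_norm_eq_lintegral_enorm (hF n)]
  rw [← lintegral_tsum fun n => (hF n).aestronglyMeasurable.enorm]
  refine lintegral_mono_ae ?_
  filter_upwards [h] with x hx
  rw [← hx.tsum_eq]
  exact enorm_tsum_le_tsum_enorm

section
variable {α : ℝ} (hα : α ∈ Ioo (0 : ℝ) 1) {v : ℝ → ℝ} (hv : ContinuousOn v (Icc 0 1))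
  (hfix : ∀ t ∈ Icc (0 : ℝ) 1, HasSum (fun n => branchDer α n t * v (branchReal α n t)) (v t))

theorem branchReal_zero (α t : ℝ) : branchReal α 0 t = (1 + t) / 2 := leftInvReal_zero _ _

theorem branchDer_zero (α t : ℝ) : branchDer α 0 t = 1 / 2 := by
  have h : HasDerivAt (leftInvIter α 0) 1 (((1 + t) / 2 : ℝ) : ℂ) := hasDerivAt_id _
  rw [branchDer, leftInvDer, h.deriv, Complex.one_re]

theorem abs_add_abs_sub_nonneg (a b : ℝ) : 0 ≤ |a| + |b - a| - |b| := by
  have := abs_add_le a (b - a)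
  rw [add_sub_cancel] at this
  linarith

include hα hv hfix

/-- Equality case of the triangle inequality. The expression is nonnegative and continuous; its
integral is at most 0, since the transfer operator preserves ∫|v| and the terms with n ≥ 1 dominate
the remainder after the branch n = 0. -/
theorem abs_half_add_abs_sub {t : ℝ} (ht : t ∈ Icc (0 : ℝ) 1) :
    |1 / 2 * v ((1 + t) / 2)| + |v t - 1 / 2 * v ((1 + t) / 2)| - |v t| = 0 := by
  have hmaps : MapsTo (fun t : ℝ => (1 + t) / 2) (Icc 0 1) (Icc 0 1) := fun t ht =>
    ⟨by linarith [ht.1], by linarith [ht.2]⟩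
  have hv2 : ContinuousOn (fun t => 1 / 2 * v ((1 + t) / 2)) (Icc 0 1) :=
    continuousOn_const.mul (hv.comp (by fun_prop) hmaps)
  have hc1 : ContinuousOn (fun t => |1 / 2 * v ((1 + t) / 2)|) (Icc 0 1) := hv2.abs
  have hc2 : ContinuousOn (fun t => |v t - 1 / 2 * v ((1 + t) / 2)|) (Icc 0 1) := (hv.sub hv2).abs
  have hc3 : ContinuousOn (fun t => |v t|) (Icc 0 1) := hv.abs
  have hint : ∀ {f : ℝ → ℝ}, ContinuousOn f (Icc 0 1) → IntegrableOn f (Ioc 0 1) := fun h =>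
    (h.integrableOn_Icc).mono_set Ioc_subset_Icc_self
  by_contra hne
  have hpos := intervalIntegral.integral_pos zero_lt_one ((hc1.add hc2).sub hc3)
    (fun t _ => abs_add_abs_sub_nonneg _ _)
    ⟨t, ht, lt_of_le_of_ne (abs_add_abs_sub_nonneg _ _) (Ne.symm hne)⟩
  rw [intervalIntegral.integral_of_le zero_le_one] at hpos
  have hI : ∫ t in Ioc (0 : ℝ) 1, (|1 / 2 * v ((1 + t) / 2)| + |v t - 1 / 2 * v ((1 + t) / 2)| - |v t|)
      = (∫ t in Ioc (0 : ℝ) 1, |1 / 2 * v ((1 + t) / 2)|) +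
        (∫ t in Ioc (0 : ℝ) 1, |v t - 1 / 2 * v ((1 + t) / 2)|) - ∫ t in Ioc (0 : ℝ) 1, |v t| := by
    have e1 := integral_add (hint hc1) (hint hc2)
    have e2 := integral_sub ((hint hc1).add (hint hc2)) (hint hc3)
    simp only [Pi.add_apply] at e2
    rw [e2, e1]
  have hsum := hasSum_integral_branchReal hα (hint hc3)
  have hterm : ∀ n, ∫ t in Ioc (0 : ℝ) 1, branchDer α n t • |v (branchReal α n t)| =
      ∫ t in Ioc (0 : ℝ) 1, ‖branchDer α n t * v (branchReal α n t)‖ := by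
    intro n
    refine setIntegral_congr_fun measurableSet_Ioc fun t ht => ?_
    rw [norm_mul, Real.norm_eq_abs, Real.norm_eq_abs,
      abs_of_pos (branchDer_pos hα ⟨by linarith [ht.1], by linarith [ht.2]⟩ n), smul_eq_mul]
  simp only [hterm] at hsum
  have h0 : ∫ t in Ioc (0 : ℝ) 1, ‖branchDer α 0 t * v (branchReal α 0 t)‖ =
      ∫ t in Ioc (0 : ℝ) 1, |1 / 2 * v ((1 + t) / 2)| := by
    simp only [branchDer_zero, branchReal_zero, Real.norm_eq_abs]
  have h1 := (hasSum_nat_add_iff' 1).2 hsum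
  rw [Finset.sum_range_one, h0] at h1
  have h2 := integral_norm_le_tsum (μ := volume.restrict (Ioc 0 1))
    (F := fun n t => branchDer α (n + 1) t * v (branchReal α (n + 1) t))
    (g := fun t => v t - 1 / 2 * v ((1 + t) / 2)) (hint (hv.sub hv2)).aestronglyMeasurable
    (fun n => by simpa only [smul_eq_mul] using! integrableOn_branchReal hα (hint hv) (n + 1))
    h1.summable ?_
  · rw [h1.tsum_eq] at h2
    simp only [Real.norm_eq_abs] at h2
    change 0 < ∫ t in Ioc (0 : ℝ) 1,
      (|1 / 2 * v ((1 + t) / 2)| + |v t - 1 / 2 * v ((1 + t) / 2)| - |v t|) at hpos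
    linarith
  · filter_upwards [ae_restrict_mem measurableSet_Ioc] with t ht
    have h3 := (hasSum_nat_add_iff' 1).2 (hfix t (Ioc_subset_Icc_self ht))
    rwa [Finset.sum_range_one, branchDer_zero, branchReal_zero] at h3

theorem pos_of_half_pos {t : ℝ} (ht : t ∈ Icc (0 : ℝ) 1) (h : 0 < v ((1 + t) / 2)) : 0 < v t := by
  have h1 := abs_half_add_abs_sub hα hv hfix ht
  by_contra h2
  rw [abs_of_pos (by linarith), abs_of_nonpos (by linarith), abs_of_nonpos (by linarith)] at h1
  linarith

/-- The branch n = 0 is t ↦ (1+t)/2, which halves the distance to 1. Its iterates reach the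
neighbourhood where v is positive, and `pos_of_half_pos` carries the sign back. -/
theorem pos_of_eventually_pos (h : ∀ᶠ t in nhdsWithin 1 (Iio 1), 0 < v t) {t : ℝ}
    (ht : t ∈ Ico (0 : ℝ) 1) : 0 < v t := by
  obtain ⟨l, hl, hl'⟩ := (mem_nhdsLT_iff_exists_Ioo_subset' (zero_lt_one' ℝ)).1 h
  have key : ∀ m : ℕ, ∀ t ∈ Ico (0 : ℝ) 1, (1 - t) / 2 ^ m < 1 - l → 0 < v t := by
    intro m
    induction m with
    | zero =>
      intro t ht h
      exact hl' ⟨by simp at h; linarith, ht.2⟩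
    | succ m ih =>
      intro t ht h
      refine pos_of_half_pos hα hv hfix (Ico_subset_Icc_self ht) (ih _ ?_ ?_)
      · exact ⟨by linarith [ht.1], by linarith [ht.2]⟩
      · refine lt_of_eq_of_lt ?_ h
        rw [pow_succ]; field_simp; ring
  have hl1 : 0 < 1 - l := sub_pos.2 hl
  obtain ⟨m, hm⟩ := exists_nat_gt (1 / (1 - l))
  refine key m t ht ?_
  have h2 : (m : ℝ) < 2 ^ m := by exact_mod_cast Nat.lt_two_pow_self
  rw [div_lt_iff₀ (by positivity)]
  rw [div_lt_iff₀ hl1] at hm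
  nlinarith [ht.1]

end

/-- A real analytic fixed point of the transfer operator vanishes or has a strict sign. -/
theorem eqOn_zero_or_sign {α : ℝ} (hα : α ∈ Ioo (0 : ℝ) 1) {v : ℝ → ℝ}
    (hv : AnalyticOnNhd ℝ v (Icc 0 1))
    (hfix : ∀ t ∈ Icc (0 : ℝ) 1, HasSum (fun n => branchDer α n t * v (branchReal α n t)) (v t)) :
    EqOn v 0 (Icc 0 1) ∨ (∀ t ∈ Ico (0 : ℝ) 1, 0 < v t) ∨ (∀ t ∈ Ico (0 : ℝ) 1, v t < 0) := by
  have hc := hv.continuousOn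
  -- Zeros are isolated: either v vanishes near 1, hence on the whole interval, or it has no zeros
  -- on some (l, 1), where connectedness fixes its sign.
  rcases (hv 1 (by norm_num)).eventually_eq_zero_or_eventually_ne_zero with h | h
  · left
    exact hv.eqOn_zero_of_preconnected_of_eventuallyEq_zero isPreconnected_Icc (by norm_num) h
  right
  have h1 : ∀ᶠ t in nhdsWithin (1 : ℝ) (Iio 1), v t ≠ 0 :=
    h.filter_mono (nhdsWithin_mono _ fun t ht => ne_of_lt ht)
  obtain ⟨l, hl, hl'⟩ := (mem_nhdsLT_iff_exists_Ioo_subset' (zero_lt_one' ℝ)).1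
    (Filter.inter_mem h1 (Ioo_mem_nhdsLT (zero_lt_one' ℝ)))
  have hlt : l < 1 := hl
  have hpre : IsPreconnected (v '' Ioo l 1) :=
    isPreconnected_Ioo.image _ (hc.mono fun t ht => Ioo_subset_Icc_self (hl' ht).2)
  have hnear : Ioo l 1 ∈ nhdsWithin (1 : ℝ) (Iio 1) := Ioo_mem_nhdsLT hlt
  have h0 : (0 : ℝ) ∉ v '' Ioo l 1 := by
    rintro ⟨t, ht, h⟩
    exact (hl' ht).1 h
  obtain ⟨m, hm⟩ : (Ioo l 1).Nonempty := nonempty_Ioo.2 hlt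
  rcases lt_or_gt_of_ne (hl' hm).1 with hneg | hpos
  · right
    have h2 : ∀ᶠ t in nhdsWithin (1 : ℝ) (Iio 1), 0 < (-v) t := by
      filter_upwards [hnear] with t ht
      rw [Pi.neg_apply, neg_pos]
      by_contra h3
      exact h0 (hpre.Icc_subset (mem_image_of_mem v hm) (mem_image_of_mem v ht)
        ⟨hneg.le, not_lt.1 h3⟩)
    intro t ht
    have h3 := pos_of_eventually_pos hα hc.neg (fun t ht => by
      simpa only [Pi.neg_apply, mul_neg] using (hfix t ht).neg) h2 ht
    simpa using h3
  · left
    have h2 : ∀ᶠ t in nhdsWithin (1 : ℝ) (Iio 1), 0 < v t := by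
      filter_upwards [hnear] with t ht
      by_contra h3
      exact h0 (hpre.Icc_subset (mem_image_of_mem v ht) (mem_image_of_mem v hm)
        ⟨not_lt.1 h3, hpos.le⟩)
    exact fun t ht => pos_of_eventually_pos hα hc hfix h2 ht

/-! ### Invertibility of `resolvOp` and the distribution function of the induced density -/

/-- The derivative of the Cauchy extension. -/
noncomputable def cauchyDer (U : CircFun) (y : ℂ) : ℂ := deriv (fun y => cauchyEv y U) y

theorem hasDerivAt_cauchyEv (U : CircFun) {y : ℂ} (hy : y ∈ Metric.ball (1 : ℂ) (3 / 2)) :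
    HasDerivAt (fun y => cauchyEv y U) (cauchyDer U y) y :=
  ((differentiableOn_cauchyEv U).differentiableAt (Metric.isOpen_ball.mem_nhds hy)).hasDerivAt

theorem analyticOnNhd_cauchyDer (U : CircFun) :
    AnalyticOnNhd ℂ (cauchyDer U) (Metric.ball (1 : ℂ) (3 / 2)) :=
  ((differentiableOn_cauchyEv U).analyticOnNhd Metric.isOpen_ball).deriv

theorem ofReal_mem_ball' {t : ℝ} (ht : t ∈ Icc (0 : ℝ) 1) :
    (t : ℂ) ∈ Metric.ball (1 : ℂ) (3 / 2) := by
  rw [mem_ball_iff_norm, ← Complex.ofReal_one, ← Complex.ofReal_sub, Complex.norm_real,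
    Real.norm_eq_abs, abs_lt]
  constructor <;> linarith [ht.1, ht.2]

theorem analyticOnNhd_clm_cauchyDer (L : ℂ →L[ℝ] ℝ) (U : CircFun) :
    AnalyticOnNhd ℝ (fun t : ℝ => L (cauchyDer U t)) (Icc 0 1) := by
  intro t ht
  have h1 : AnalyticAt ℝ (cauchyDer U) (t : ℂ) :=
    (analyticOnNhd_cauchyDer U _ (ofReal_mem_ball' ht)).restrictScalars
  have h2 : AnalyticAt ℝ (fun t : ℝ => (t : ℂ)) t := Complex.ofRealCLM.analyticAt t
  exact (L.analyticAt _).comp (h1.comp h2)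

theorem hasDerivAt_clm_cauchyEv (L : ℂ →L[ℝ] ℝ) (U : CircFun) {t : ℝ} (ht : t ∈ Icc (0 : ℝ) 1) :
    HasDerivAt (fun t : ℝ => L (cauchyEv t U)) (L (cauchyDer U t)) t :=
  L.hasFDerivAt.comp_hasDerivAt t (hasDerivAt_cauchyEv U (ofReal_mem_ball' ht)).comp_ofReal

theorem Icc_subset_Ioo_three : Icc (0 : ℝ) 1 ⊆ Ioo (-1) 3 := fun _ ht =>
  ⟨by linarith [ht.1], by linarith [ht.2]⟩

theorem clm_mul_ofReal (L : ℂ →L[ℝ] ℝ) (z : ℂ) (r : ℝ) : L (z * r) = r * L z := by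
  rw [mul_comm, ← Complex.real_smul, map_smul, smul_eq_mul]

theorem nonneg_of_pos_Ico {v : ℝ → ℝ} (hv : ContinuousOn v (Icc 0 1))
    (hpos : ∀ t ∈ Ico (0 : ℝ) 1, 0 < v t) {t : ℝ} (ht : t ∈ Icc (0 : ℝ) 1) : 0 ≤ v t := by
  rw [← closure_Ico zero_ne_one] at hv ht
  exact le_on_closure (f := fun _ => 0) (fun t ht => (hpos t ht).le) continuousOn_const hv ht

theorem integral_clm_cauchyDer (L : ℂ →L[ℝ] ℝ) (U : CircFun) {a b : ℝ} (ha : 0 ≤ a) (hab : a ≤ b)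
    (hb : b ≤ 1) :
    ∫ t in a..b, L (cauchyDer U t) = L (cauchyEv b U) - L (cauchyEv a U) := by
  have hsub : uIcc a b ⊆ Icc 0 1 := by
    rw [uIcc_of_le hab]; exact Icc_subset_Icc ha hb
  exact intervalIntegral.integral_eq_sub_of_hasDerivAt
    (f := fun t : ℝ => L (cauchyEv t U)) (fun t ht => hasDerivAt_clm_cauchyEv L U (hsub ht))
    (((analyticOnNhd_clm_cauchyDer L U).continuousOn.mono hsub).intervalIntegrable)

section
variable {α : ℝ} (hα : α ∈ Ioo (0 : ℝ) 1)
include hα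

theorem hasSum_clm_cauchyDer (L : ℂ →L[ℝ] ℝ) {Y : ℂ → ℂ}
    (hY : DifferentiableOn ℂ Y (Metric.ball 1 2)) {U : CircFun}
    (hU : ∀ z : Circ, resolvOp α U z = Y z) (hY0 : Y 0 = 0) {t : ℝ} (ht : t ∈ Icc (0 : ℝ) 1) :
    HasSum (fun n => branchDer α n t * L (cauchyDer U (branchReal α n t)))
      (L (cauchyDer U t - (deriv Y t - Y 1))) := by
  have h1 := L.hasSum (hasSum_deriv_branch_of_resolvOp hα hY hU hY0 (ofReal_mem_ball' ht))
  have ht' := Icc_subset_Ioo_three ht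
  convert! h1 using 2 with n
  rw [deriv_branch hα ht', clm_mul_ofReal, ofReal_branchReal hα ht']
  rfl

theorem clm_cauchyDer_sign (L : ℂ →L[ℝ] ℝ) {c : ℂ} {U : CircFun}
    (hU : ∀ z : Circ, resolvOp α U z = c * z) :
    EqOn (fun t : ℝ => L (cauchyDer U t)) 0 (Icc 0 1) ∨
      (∀ t ∈ Ico (0 : ℝ) 1, 0 < L (cauchyDer U t)) ∨ ∀ t ∈ Ico (0 : ℝ) 1, L (cauchyDer U t) < 0 := by
  refine eqOn_zero_or_sign hα (analyticOnNhd_clm_cauchyDer L U) fun t ht => ?_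
  have h1 := hasSum_clm_cauchyDer hα L (Y := fun z => c * z) (by fun_prop) hU (by simp) ht
  have h2 : deriv (fun z : ℂ => c * z) t = c := by
    simp
  rw [h2, mul_one, sub_self, sub_zero] at h1
  exact h1

theorem clm_cauchyEv_of_resolvOp (L : ℂ →L[ℝ] ℝ) {c : ℂ} {U : CircFun}
    (hU : ∀ z : Circ, resolvOp α U z = c * z) :
    ∫ t in (0 : ℝ)..1, L (cauchyDer U t) = L c := by
  have h0 := cauchyEv_zero_of_resolvOp hα (Y := fun z => c * z) (by fun_prop) hU (by simp)
  have h1 := cauchyEv_one_of_resolvOp hα (Y := fun z => c * z) (by fun_prop) hU (by simp)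
  rw [integral_clm_cauchyDer L U le_rfl zero_le_one le_rfl]
  simp [h0, h1]

/-- A continuous function with a strict sign on [0,1) has nonzero integral, but here the integral is
`L c` = 0. The real functional L allows real and imaginary parts to be treated alike. -/
theorem eqOn_zero_of_clm_eq_zero (L : ℂ →L[ℝ] ℝ) {c : ℂ} (hc : L c = 0) {U : CircFun}
    (hU : ∀ z : Circ, resolvOp α U z = c * z) :
    EqOn (fun t : ℝ => L (cauchyDer U t)) 0 (Icc 0 1) := by
  have hint := clm_cauchyEv_of_resolvOp hα L hU
  have hcont : ContinuousOn (fun t : ℝ => L (cauchyDer U t)) (Icc 0 1) :=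
    (analyticOnNhd_clm_cauchyDer L U).continuousOn
  have hlast : ∀ {v : ℝ → ℝ}, ContinuousOn v (Icc 0 1) → (∀ t ∈ Ico (0 : ℝ) 1, 0 < v t) →
      0 < ∫ t in (0 : ℝ)..1, v t := fun {v} hv hpos =>
    intervalIntegral.integral_pos zero_lt_one hv
      (fun t ht => nonneg_of_pos_Ico hv hpos (Ioc_subset_Icc_self ht)) ⟨0, by norm_num, hpos 0 (by norm_num)⟩
  rcases clm_cauchyDer_sign hα L hU with h | h | h
  · exact h
  · have := hlast hcont h
    rw [hint, hc] at this
    exact absurd this (lt_irrefl 0)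
  · have := hlast hcont.neg fun t ht => neg_pos.2 (h t ht)
    simp only [Pi.neg_apply, intervalIntegral.integral_neg, hint, hc, neg_zero] at this
    exact absurd this (lt_irrefl 0)

/-- The derivative of the extension vanishes on [0,1] by the sign dichotomy, hence on the disc by
the identity theorem; with value 0 at the origin the extension is 0. -/
theorem eq_zero_of_resolvOp_eq_zero {U : CircFun} (hU : resolvOp α U = 0) : U = 0 := by
  have hU' : ∀ z : Circ, resolvOp α U z = 0 * z := fun z => by rw [hU]; simp
  have hre := eqOn_zero_of_clm_eq_zero hα Complex.reCLM (c := 0) (by simp) hU'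
  have him := eqOn_zero_of_clm_eq_zero hα Complex.imCLM (c := 0) (by simp) hU'
  have h0 := cauchyEv_zero_of_resolvOp hα (Y := fun z => 0 * z) (by fun_prop) hU' (by simp)
  have h1 := cauchyEv_one_of_resolvOp hα (Y := fun z => 0 * z) (by fun_prop) hU' (by simp)
  have hder : EqOn (cauchyDer U) 0 (Metric.ball (1 : ℂ) (3 / 2)) := by
    refine (analyticOnNhd_cauchyDer U).eqOn_zero_of_preconnected_of_frequently_eq_zero
      (convex_ball _ _).isPreconnected (ofReal_mem_ball' (t := 0) (by norm_num)) ?_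
    have h2 : Filter.Tendsto (fun t : ℝ => (t : ℂ)) (nhdsWithin 0 (Ioi 0))
        (nhdsWithin ((0 : ℝ) : ℂ) {((0 : ℝ) : ℂ)}ᶜ) := by
      refine tendsto_nhdsWithin_iff.2 ⟨(Complex.continuous_ofReal.tendsto 0).mono_left
        nhdsWithin_le_nhds, ?_⟩
      filter_upwards [self_mem_nhdsWithin] with t ht
      simpa using ne_of_gt ht
    refine h2.frequently (Filter.Eventually.frequently ?_)
    filter_upwards [Ioo_mem_nhdsGT (zero_lt_one' ℝ)] with t ht
    exact Complex.ext (hre (Ioo_subset_Icc_self ht)) (him (Ioo_subset_Icc_self ht))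
  have hzero : ∀ y ∈ Metric.ball (1 : ℂ) (3 / 2), cauchyEv y U = 0 := by
    intro y hy
    have := (convex_ball (1 : ℂ) (3 / 2)).is_const_of_fderivWithin_eq_zero (𝕜 := ℂ)
      (f := fun y => cauchyEv y U) (differentiableOn_cauchyEv U) (fun z hz => ?_) hy
      (ofReal_mem_ball' (t := 0) (by norm_num))
    · rw [this, Complex.ofReal_zero, h0]
    · rw [fderivWithin_of_isOpen Metric.isOpen_ball hz]
      have h3 := hasDerivAt_cauchyEv U hz
      rw [hder hz] at h3
      ext
      simp [h3.deriv]
  -- A vanishing extension does not by itself force U = 0 on the circle. The equation does, because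
  -- its other terms see U only through the extension.
  ext z
  have h2 := resolvOp_apply α U z
  have h3 := hasSum_transferOp_apply hα U z
  simp only [hzero _ (ball_one_subset_ball (branch_mem_ball hα _ (circ_mem_ball z))),
    hzero _ (ball_one_subset_ball (branch_mem_ball hα _ zero_mem_ball_two)), sub_self] at h3
  rw [hU, h3.unique hasSum_zero, h0, h1] at h2
  simpa using h2.symm

theorem isUnit_resolvOp : IsUnit (resolvOp α) :=
  isUnit_resolvOp_of_injective hα fun _ => eq_zero_of_resolvOp_eq_zero hα

theorem resolvOp_inverse_apply (V : CircFun) : resolvOp α (Ring.inverse (resolvOp α) V) = V := by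
  have h := Ring.mul_inverse_cancel _ (isUnit_resolvOp hα)
  exact congrArg (fun T : CircFun →L[ℂ] CircFun => T V) h

end

/-- The distribution function of the invariant density of the induced map, as an element of
`CircFun`. -/
noncomputable def distFun (α : ℝ) : CircFun := Ring.inverse (resolvOp α) circId

/-- The distribution function of the invariant density of the induced map. -/
noncomputable def distReal (α t : ℝ) : ℝ := (cauchyEv t (distFun α)).re

/-- The invariant density of the induced map. -/
noncomputable def densReal (α t : ℝ) : ℝ := (cauchyDer (distFun α) t).re

section
variable {α : ℝ} (hα : α ∈ Ioo (0 : ℝ) 1)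
include hα

theorem resolvOp_distFun (z : Circ) : resolvOp α (distFun α) z = 1 * z := by
  rw [distFun, resolvOp_inverse_apply hα, one_mul]; rfl

theorem cauchyEv_zero_distFun : cauchyEv 0 (distFun α) = 0 :=
  cauchyEv_zero_of_resolvOp hα (Y := fun z => 1 * z) (by fun_prop) (resolvOp_distFun hα) (by simp)

theorem cauchyEv_one_distFun : cauchyEv 1 (distFun α) = 1 := by
  have := cauchyEv_one_of_resolvOp hα (Y := fun z => 1 * z) (by fun_prop) (resolvOp_distFun hα)
    (by simp)
  simpa using this

omit hα in
theorem continuousOn_densReal : ContinuousOn (densReal α) (Icc 0 1) :=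
  (analyticOnNhd_clm_cauchyDer Complex.reCLM (distFun α)).continuousOn

theorem distReal_one : distReal α 1 = 1 := by
  simp [distReal, cauchyEv_one_distFun hα]

/-- The integral of the density is 1, which excludes the zero and the negative alternatives. -/
theorem densReal_pos {t : ℝ} (ht : t ∈ Ico (0 : ℝ) 1) : 0 < densReal α t := by
  have hint := clm_cauchyEv_of_resolvOp hα Complex.reCLM (resolvOp_distFun hα)
  simp only [Complex.reCLM_apply, Complex.one_re] at hint
  rcases clm_cauchyDer_sign hα Complex.reCLM (resolvOp_distFun hα) with h | h | h
  · have h1 : ∫ t in (0 : ℝ)..1, (cauchyDer (distFun α) t).re = ∫ t in (0 : ℝ)..1, (0 : ℝ) :=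
      intervalIntegral.integral_congr fun t ht => h (by rwa [uIcc_of_le zero_le_one] at ht)
    rw [hint] at h1
    simp at h1
  · exact h t ht
  · have h1 : ∫ t in (0 : ℝ)..1, (cauchyDer (distFun α) t).re ≤ 0 := by
      rw [intervalIntegral.integral_of_le zero_le_one, integral_Ioc_eq_integral_Ioo]
      exact setIntegral_nonpos measurableSet_Ioo fun t ht => (h t (Ioo_subset_Ico_self ht)).le
    rw [hint] at h1
    exact absurd h1 (by norm_num)

theorem densReal_nonneg {t : ℝ} (ht : t ∈ Icc (0 : ℝ) 1) : 0 ≤ densReal α t :=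
  nonneg_of_pos_Ico continuousOn_densReal (fun _ => densReal_pos hα) ht

theorem hasSum_distReal {t : ℝ} (ht : t ∈ Icc (0 : ℝ) 1) :
    HasSum (fun n => distReal α (branchReal α n t) - distReal α (branchReal α n 0))
      (distReal α t) := by
  have h1 := hasSum_branch_of_resolvOp hα (Y := fun z => 1 * z) (by fun_prop) (resolvOp_distFun hα)
    (by simp) (ofReal_mem_ball' ht)
  have h2 := Complex.reCLM.hasSum h1
  simp only [one_mul, sub_self, sub_zero, map_sub, Complex.reCLM_apply] at h2
  simp only [distReal]
  convert! h2 using 4 with n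
  · rw [ofReal_branchReal hα (Icc_subset_Ioo_three ht)]
  · rw [ofReal_branchReal hα (by norm_num), Complex.ofReal_zero]

end

/-! ### The invariant measure of `lsvMap` -/

theorem measurable_lsvMap (α : ℝ) : Measurable (lsvMap α) :=
  Measurable.ite measurableSet_Iic (by fun_prop) (by fun_prop)

/-- The density of the (unnormalized) invariant measure. -/
noncomputable def lsvDensity (α x : ℝ) : ENNReal :=
  ∑' k, ENNReal.ofReal (leftInvDer α k x) * ENNReal.ofReal (densReal α (leftInvReal α k x))

/-- The distribution function of the (unnormalized) invariant measure. -/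
noncomputable def lsvDistribution (α t : ℝ) : ℝ := ∑' k, distReal α (leftInvReal α k t)

section
variable {α : ℝ} (hα : α ∈ Ioo (0 : ℝ) 1)
include hα

theorem distReal_nonneg {t : ℝ} (ht : t ∈ Icc (0 : ℝ) 1) : 0 ≤ distReal α t := by
  have h := integral_clm_cauchyDer Complex.reCLM (distFun α) le_rfl ht.1 ht.2
  rw [Complex.ofReal_zero, cauchyEv_zero_distFun hα, map_zero, sub_zero] at h
  rw [distReal, ← Complex.reCLM_apply, ← h]
  exact intervalIntegral.integral_nonneg ht.1 fun s hs =>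
    densReal_nonneg hα (Icc_subset_Icc_right ht.2 hs)

theorem lintegral_densReal {t : ℝ} (ht : t ∈ Icc (0 : ℝ) 1) :
    ∫⁻ x in Ioc 0 t, ENNReal.ofReal (densReal α x) = ENNReal.ofReal (distReal α t) := by
  have hsub : Icc 0 t ⊆ Icc (0 : ℝ) 1 := Icc_subset_Icc_right ht.2
  have h := integral_clm_cauchyDer Complex.reCLM (distFun α) le_rfl ht.1 ht.2
  rw [Complex.ofReal_zero, cauchyEv_zero_distFun hα, map_zero, sub_zero,
    intervalIntegral.integral_of_le ht.1] at h
  rw [distReal, ← Complex.reCLM_apply, ← h]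
  refine (ofReal_integral_eq_lintegral_ofReal ?_ ?_).symm
  · exact ((continuousOn_densReal.mono hsub).integrableOn_Icc).mono_set Ioc_subset_Icc_self
  · filter_upwards [ae_restrict_mem measurableSet_Ioc] with x hx
    exact densReal_nonneg hα (hsub (Ioc_subset_Icc_self hx))

theorem lintegral_densReal_comp {t : ℝ} (ht : t ∈ Ioc (0 : ℝ) 1) (k : ℕ) :
    ∫⁻ x in Ioc 0 t, ENNReal.ofReal (leftInvDer α k x) *
      ENNReal.ofReal (densReal α (leftInvReal α k x)) =
        ENNReal.ofReal (distReal α (leftInvReal α k t)) := by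
  have hsub : Ioc 0 t ⊆ Ioo (0 : ℝ) 2 :=
    (Ioc_subset_Ioc_right ht.2).trans Ioc_subset_Ioo_two
  rw [← lintegral_densReal hα (Ioc_subset_Icc_self (leftInvReal_mem_Ioc hα ht k)),
    ← image_leftInvReal hα ht k, lintegral_image_eq_lintegral_abs_deriv_mul measurableSet_Ioc
      (fun x hx => (hasDerivAt_leftInvReal hα (hsub hx) k).hasDerivWithinAt)
      ((strictMonoOn_leftInvReal hα k).injOn.mono hsub)]
  refine setLIntegral_congr_fun measurableSet_Ioc fun x hx => ?_
  rw [abs_of_pos (leftInvDer_pos hα (hsub hx) k)]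

theorem continuousOn_densReal_comp (k : ℕ) :
    ContinuousOn (fun x => densReal α (leftInvReal α k x)) (Ioc 0 1) :=
  continuousOn_densReal.comp ((continuousOn_leftInvReal hα k).mono Ioc_subset_Ioo_two)
    fun _ hx => Ioc_subset_Icc_self (leftInvReal_mem_Ioc hα hx k)

theorem aemeasurable_lsvDensity_term (k : ℕ) :
    AEMeasurable (fun x => ENNReal.ofReal (leftInvDer α k x) *
      ENNReal.ofReal (densReal α (leftInvReal α k x))) (volume.restrict (Ioc 0 1)) :=
  ((((continuousOn_leftInvDer hα k).mono Ioc_subset_Ioo_two).aemeasurable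
    measurableSet_Ioc).ennreal_ofReal).mul
      (((continuousOn_densReal_comp hα k).aemeasurable measurableSet_Ioc).ennreal_ofReal)

theorem norm_distReal_leftInvReal_le {u : ℕ → ℝ}
    (hu : ∀ y ∈ Metric.ball (1 : ℂ) 1, ∀ n, ‖leftInvIter α n y‖ ≤ u n) {t : ℝ}
    (ht : t ∈ Ioc (0 : ℝ) 1) (k : ℕ) :
    ‖distReal α (leftInvReal α k t)‖ ≤ 6 * u k * ‖distFun α‖ := by
  have ht' := ofReal_mem_ball.2 (Ioc_subset_Ioo_two ht)
  have h1 := norm_cauchyEv_sub_le (y := leftInvIter α k t) (x := 0)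
    (mem_ball_iff_norm.1 (leftInvIter_mem_ball hα ht' k)).le (by simp) (distFun α)
  rw [cauchyEv_zero_distFun hα, sub_zero, sub_zero] at h1
  rw [distReal, ofReal_leftInvReal hα (Ioc_subset_Ioo_two ht)]
  refine (Complex.abs_re_le_norm _).trans (h1.trans ?_)
  gcongr
  exact hu _ ht' k

theorem summable_distReal {t : ℝ} (ht : t ∈ Ioc (0 : ℝ) 1) :
    Summable fun k => distReal α (leftInvReal α k t) := by
  obtain ⟨u, hu, h⟩ := exists_summable_bound_leftInvIter hα.1 le_rfl hα.2
  exact Summable.of_norm_bounded ((hu.mul_left 6).mul_right ‖distFun α‖)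
    (norm_distReal_leftInvReal_le hα (fun y hy n => (h α (by simp) y hy n).1) ht)

theorem lsvDistribution_nonneg {t : ℝ} (ht : t ∈ Ioc (0 : ℝ) 1) : 0 ≤ lsvDistribution α t :=
  tsum_nonneg fun k => distReal_nonneg hα (Ioc_subset_Icc_self (leftInvReal_mem_Ioc hα ht k))

theorem one_le_lsvDistribution_one : 1 ≤ lsvDistribution α 1 := by
  have h1 : (1 : ℝ) ∈ Ioc (0 : ℝ) 1 := by norm_num
  have h := (summable_distReal hα h1).le_tsum 0 fun k _ =>
    distReal_nonneg hα (Ioc_subset_Icc_self (leftInvReal_mem_Ioc hα h1 k))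
  rwa [leftInvReal_zero, distReal_one hα] at h

theorem lintegral_lsvDensity {t : ℝ} (ht : t ∈ Ioc (0 : ℝ) 1) :
    ∫⁻ x in Ioc 0 t, lsvDensity α x = ENNReal.ofReal (lsvDistribution α t) := by
  simp only [lsvDensity]
  rw [lintegral_tsum fun k => (aemeasurable_lsvDensity_term hα k).mono_measure
    (Measure.restrict_mono (Ioc_subset_Ioc_right ht.2) le_rfl), lsvDistribution,
    ENNReal.ofReal_tsum_of_nonneg (fun k => distReal_nonneg hα
      (Ioc_subset_Icc_self (leftInvReal_mem_Ioc hα ht k))) (summable_distReal hα ht)]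
  exact tsum_congr fun k => lintegral_densReal_comp hα ht k

theorem leftInvReal_succ' {t : ℝ} (ht : t ∈ Ioo (0 : ℝ) 2) (n : ℕ) :
    leftInvReal α (n + 1) t = leftInvReal α n (leftInvReal α 1 t) := by
  rw [leftInvReal, leftInvReal, ofReal_leftInvReal hα ht, leftInvIter_succ', ← zero_add 1,
    leftInvIter_succ', leftInvIter_zero]

theorem lsvDistribution_eq_add {t : ℝ} (ht : t ∈ Ioc (0 : ℝ) 1) :
    lsvDistribution α t = distReal α t + lsvDistribution α (leftInvReal α 1 t) := by
  rw [lsvDistribution, (summable_distReal hα ht).tsum_eq_zero_add, leftInvReal_zero]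
  congr 1
  exact tsum_congr fun k => by rw [leftInvReal_succ' hα (Ioc_subset_Ioo_two ht)]

/-- Since g^k((1+t)/2) = f_k(t) and g^k(1/2) = f_k(0), this is the fixed point equation for D. -/
theorem lsvDistribution_half_sub {t : ℝ} (ht : t ∈ Icc (0 : ℝ) 1) :
    lsvDistribution α ((1 + t) / 2) - lsvDistribution α (1 / 2) = distReal α t := by
  have h1 : (1 + t) / 2 ∈ Ioc (0 : ℝ) 1 := ⟨by linarith [ht.1], by linarith [ht.2]⟩
  have h2 : 1 / 2 ∈ Ioc (0 : ℝ) 1 := by norm_num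
  have h3 := (summable_distReal hα h1).hasSum.sub (summable_distReal hα h2).hasSum
  have h4 := hasSum_distReal hα ht
  simp only [branchReal, add_zero] at h4
  exact h3.unique h4

end

/-- The unnormalized invariant measure. -/
noncomputable def lsvPreMeasure (α : ℝ) : Measure ℝ :=
  (volume.withDensity (lsvDensity α)).restrict (Ioc 0 1)

theorem lsvPreMeasure_apply (α : ℝ) {s : Set ℝ} (hs : MeasurableSet s) :
    lsvPreMeasure α s = ∫⁻ x in s ∩ Ioc 0 1, lsvDensity α x := by
  rw [lsvPreMeasure, Measure.restrict_apply hs, withDensity_apply _ (hs.inter measurableSet_Ioc)]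

section
variable {α : ℝ} (hα : α ∈ Ioo (0 : ℝ) 1)
include hα

theorem lsvPreMeasure_Ioc {t : ℝ} (ht : t ∈ Ioc (0 : ℝ) 1) :
    lsvPreMeasure α (Ioc 0 t) = ENNReal.ofReal (lsvDistribution α t) := by
  rw [lsvPreMeasure_apply α measurableSet_Ioc,
    inter_eq_left.2 (Ioc_subset_Ioc_right ht.2), lintegral_lsvDensity hα ht]

theorem lsvPreMeasure_univ : lsvPreMeasure α univ = ENNReal.ofReal (lsvDistribution α 1) := by
  rw [← lsvPreMeasure_Ioc hα (by norm_num), lsvPreMeasure_apply α .univ,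
    lsvPreMeasure_apply α measurableSet_Ioc, univ_inter, inter_self]

theorem isFiniteMeasure_lsvPreMeasure : IsFiniteMeasure (lsvPreMeasure α) :=
  ⟨by rw [lsvPreMeasure_univ hα]; exact ENNReal.ofReal_lt_top⟩

omit hα in
theorem lsvPreMeasure_absolutelyContinuous : lsvPreMeasure α ≪ volume.restrict (Icc 0 1) := by
  have h : lsvPreMeasure α ≪ volume.restrict (Ioc 0 1) :=
    (withDensity_absolutelyContinuous _ _).restrict _
  exact h.trans (Measure.restrict_mono Ioc_subset_Icc_self le_rfl).absolutelyContinuous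

/-- The summand k = 0 of the density alone is positive on (0,1). -/
theorem absolutelyContinuous_lsvPreMeasure : volume.restrict (Icc 0 1) ≪ lsvPreMeasure α := by
  rw [lsvPreMeasure, restrict_withDensity measurableSet_Ioc, restrict_Ioc_eq_restrict_Icc.symm]
  refine withDensity_absolutelyContinuous' ?_ ?_
  · exact AEMeasurable.tsum fun k => aemeasurable_lsvDensity_term hα k
  · rw [← restrict_Ioo_eq_restrict_Ioc]
    filter_upwards [ae_restrict_mem measurableSet_Ioo] with x hx
    rw [lsvDensity, ne_eq, ENNReal.tsum_eq_zero, not_forall]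
    refine ⟨0, (ENNReal.mul_pos (ne_of_gt ?_) (ne_of_gt ?_)).ne'⟩
    · exact ENNReal.ofReal_pos.2 (leftInvDer_pos hα ⟨hx.1, by linarith [hx.2]⟩ 0)
    · rw [leftInvReal_zero]
      exact ENNReal.ofReal_pos.2 (densReal_pos hα ⟨hx.1.le, hx.2⟩)

theorem lsvMap_mem_Ioc {x : ℝ} (hx : x ∈ Ioc (0 : ℝ) 1) : lsvMap α x ∈ Ioc (0 : ℝ) 1 := by
  rcases le_or_gt x (1 / 2) with h | h
  · exact lsvMap_mem_Ioc_left hα ⟨hx.1, h⟩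
  · rw [lsvMap, if_neg h.not_ge]
    exact ⟨by linarith, by linarith [hx.2]⟩

theorem lsvMap_le_iff {x t : ℝ} (hx : x ∈ Ioc (0 : ℝ) (1 / 2)) (ht : t ∈ Ioc (0 : ℝ) 1) :
    lsvMap α x ≤ t ↔ x ≤ leftInvReal α 1 t := by
  rw [← (strictMonoOn_leftInvReal hα 1).le_iff_le
    (Ioc_subset_Ioo_two (lsvMap_mem_Ioc_left hα hx)) (Ioc_subset_Ioo_two ht),
    leftInvReal_lsvMap hα hx]

theorem preimage_lsvMap_Iic {t : ℝ} (ht : t ∈ Ioc (0 : ℝ) 1) :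
    lsvMap α ⁻¹' Iic t ∩ Ioc 0 1 = Ioc 0 (leftInvReal α 1 t) ∪ Ioc (1 / 2) ((1 + t) / 2) := by
  have h1 := leftInvReal_one_mem_Ioc hα ht
  have ht2 := ht.2
  ext x
  simp only [mem_inter_iff, mem_preimage, mem_Iic, mem_union, mem_Ioc]
  rcases le_or_gt x (1 / 2) with h | h
  · constructor
    · rintro ⟨h2, h3, -⟩
      exact Or.inl ⟨h3, (lsvMap_le_iff hα ⟨h3, h⟩ ht).1 h2⟩
    · rintro (⟨h2, h3⟩ | ⟨h2, h3⟩)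
      · exact ⟨(lsvMap_le_iff hα ⟨h2, h⟩ ht).2 h3, h2, by linarith⟩
      · linarith
  · rw [lsvMap, if_neg h.not_ge]
    constructor
    · rintro ⟨h2, h3, -⟩
      exact Or.inr ⟨h, by linarith⟩
    · rintro (⟨h2, h3⟩ | ⟨h2, h3⟩)
      · linarith [h1.2]
      · exact ⟨by linarith, by linarith, by linarith⟩

omit hα in
theorem lsvPreMeasure_inter (s : Set ℝ) (hs : MeasurableSet s) :
    lsvPreMeasure α s = lsvPreMeasure α (s ∩ Ioc 0 1) := by
  rw [lsvPreMeasure_apply α hs, lsvPreMeasure_apply α (hs.inter measurableSet_Ioc), inter_assoc,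
    inter_self]

/-- Up to a null set the preimage is (0, g t] ∪ (1/2, (1+t)/2]. Its mass is H(g t) + D(t) by
`lsvDistribution_half_sub`, and this is H(t) by splitting off the first term of the series. -/
theorem lsvPreMeasure_preimage {t : ℝ} (ht : t ∈ Ioc (0 : ℝ) 1) :
    lsvPreMeasure α (lsvMap α ⁻¹' Iic t) = lsvPreMeasure α (Iic t) := by
  have hleft := leftInvReal_one_mem_Ioc hα ht
  have hleft' := leftInvReal_mem_Ioc hα ht 1
  have hhalf : (1 / 2 : ℝ) ∈ Ioc (0 : ℝ) 1 := by norm_num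
  have hb : (1 + t) / 2 ∈ Ioc (0 : ℝ) 1 := ⟨by linarith [ht.1], by linarith [ht.2]⟩
  have hdisj : ∀ s ≤ (1 / 2 : ℝ), Disjoint (Ioc 0 s) (Ioc (1 / 2) ((1 + t) / 2)) := fun s hs =>
    Set.disjoint_left.2 fun x hx hx' => by linarith [hx.2, hx'.1]
  have hsplit : lsvPreMeasure α (Ioc 0 ((1 + t) / 2)) =
      lsvPreMeasure α (Ioc 0 (1 / 2)) + lsvPreMeasure α (Ioc (1 / 2) ((1 + t) / 2)) := by
    rw [← measure_union (hdisj _ le_rfl) measurableSet_Ioc,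
      Ioc_union_Ioc_eq_Ioc hhalf.1.le (by linarith [ht.1])]
  rw [lsvPreMeasure_Ioc hα hb, lsvPreMeasure_Ioc hα hhalf] at hsplit
  have h1 := lsvDistribution_half_sub hα (Ioc_subset_Icc_self ht)
  have h2 := distReal_nonneg hα (Ioc_subset_Icc_self ht)
  have hb' : lsvDistribution α ((1 + t) / 2) = lsvDistribution α (1 / 2) + distReal α t := by
    linarith
  rw [hb', ENNReal.ofReal_add (lsvDistribution_nonneg hα hhalf) h2,
    ENNReal.add_right_inj ENNReal.ofReal_ne_top] at hsplit
  have hIic : Iic t ∩ Ioc 0 1 = Ioc 0 t := by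
    ext x
    simp only [mem_inter_iff, mem_Iic, mem_Ioc]
    exact ⟨fun h => ⟨h.2.1, h.1⟩, fun h => ⟨h.2, h.1, h.2.trans ht.2⟩⟩
  rw [lsvPreMeasure_inter _ (measurable_lsvMap α measurableSet_Iic), preimage_lsvMap_Iic hα ht,
    measure_union (hdisj _ hleft.2) measurableSet_Ioc, ← hsplit, lsvPreMeasure_Ioc hα hleft',
    ← ENNReal.ofReal_add (lsvDistribution_nonneg hα hleft') h2,
    lsvPreMeasure_inter _ measurableSet_Iic, hIic, lsvPreMeasure_Ioc hα ht,
    lsvDistribution_eq_add hα ht, add_comm]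

theorem measurePreserving_lsvPreMeasure :
    MeasurePreserving (lsvMap α) (lsvPreMeasure α) (lsvPreMeasure α) := by
  have := isFiniteMeasure_lsvPreMeasure hα
  refine ⟨measurable_lsvMap α, Measure.ext_of_Iic _ _ fun t => ?_⟩
  rw [Measure.map_apply (measurable_lsvMap α) measurableSet_Iic]
  have hempty : ∀ {s : Set ℝ}, MeasurableSet s → s ∩ Ioc 0 1 = ∅ → lsvPreMeasure α s = 0 :=
    fun hs h => by rw [lsvPreMeasure_inter _ hs, h, measure_empty]
  rcases le_or_gt t 0 with h0 | h0
  · rw [hempty measurableSet_Iic, hempty (measurable_lsvMap α measurableSet_Iic)]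
    · exact eq_empty_of_forall_notMem fun x hx =>
        absurd (lsvMap_mem_Ioc hα hx.2).1 (not_lt.2 (le_trans hx.1 h0))
    · exact eq_empty_of_forall_notMem fun x hx => absurd hx.2.1 (not_lt.2 (le_trans hx.1 h0))
  rcases le_or_gt t 1 with h1 | h1
  · exact lsvPreMeasure_preimage hα ⟨h0, h1⟩
  · rw [lsvPreMeasure_inter _ measurableSet_Iic,
      lsvPreMeasure_inter _ (measurable_lsvMap α measurableSet_Iic)]
    congr 1
    ext x
    constructor
    · exact fun hx => ⟨hx.2.2.trans h1.le, hx.2⟩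
    · exact fun hx => ⟨(lsvMap_mem_Ioc hα hx.2).2.trans h1.le, hx.2⟩

end

/-- The normalized invariant measure. -/
noncomputable def lsvProbMeasure (α : ℝ) : Measure ℝ :=
  (ENNReal.ofReal (lsvDistribution α 1))⁻¹ • lsvPreMeasure α

section
variable {α : ℝ} (hα : α ∈ Ioo (0 : ℝ) 1)
include hα

theorem isLSVMeasure_lsvProbMeasure : IsLSVMeasure α (lsvProbMeasure α) where
  isProbabilityMeasure := by
    have h1 := one_le_lsvDistribution_one hα
    refine ⟨?_⟩
    rw [lsvProbMeasure, Measure.smul_apply, lsvPreMeasure_univ hα, smul_eq_mul,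
      ENNReal.inv_mul_cancel (ENNReal.ofReal_pos.2 (by linarith)).ne' ENNReal.ofReal_ne_top]
  absolutelyContinuous := lsvPreMeasure_absolutelyContinuous.smul_left _
  invariant := (measurePreserving_lsvPreMeasure hα).smul_measure _

theorem lsvProbMeasure_Ioc {t : ℝ} (ht : t ∈ Ioc (0 : ℝ) 1) :
    lsvProbMeasure α (Ioc 0 t) = ENNReal.ofReal (lsvDistribution α t / lsvDistribution α 1) := by
  have h1 := one_le_lsvDistribution_one hα
  rw [lsvProbMeasure, Measure.smul_apply, lsvPreMeasure_Ioc hα ht, smul_eq_mul,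
    ENNReal.ofReal_div_of_pos (by linarith), ENNReal.div_eq_inv_mul]

theorem absolutelyContinuous_lsvProbMeasure : volume.restrict (Icc 0 1) ≪ lsvProbMeasure α :=
  (absolutelyContinuous_lsvPreMeasure hα).trans
    (Measure.absolutelyContinuous_smul (ENNReal.inv_ne_zero.2 ENNReal.ofReal_ne_top))

end

/-! ### Ergodicity and uniqueness -/

/-- A primitive of `t ↦ exp (t * ξ * I)`, corrected so as to vanish at `0` and `1`. -/
noncomputable def expPrim (ξ : ℝ) (z : ℂ) : ℂ :=
  (Complex.exp (ξ * z * Complex.I) - 1) / (ξ * Complex.I) -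
    z * ((Complex.exp (ξ * Complex.I) - 1) / (ξ * Complex.I))

theorem hasDerivAt_expPrim {ξ : ℝ} (hξ : ξ ≠ 0) (z : ℂ) :
    HasDerivAt (expPrim ξ) (Complex.exp (ξ * z * Complex.I) -
      (Complex.exp (ξ * Complex.I) - 1) / (ξ * Complex.I)) z := by
  have hξ' : (ξ : ℂ) * Complex.I ≠ 0 := mul_ne_zero (by exact_mod_cast hξ) Complex.I_ne_zero
  have h1 : HasDerivAt (fun z : ℂ => ξ * z * Complex.I) (ξ * Complex.I) z := by
    simpa using ((hasDerivAt_id z).const_mul (ξ : ℂ)).mul_const Complex.I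
  have h2 := ((h1.cexp.sub_const 1).div_const (ξ * Complex.I)).sub
    ((hasDerivAt_id z).mul_const ((Complex.exp (ξ * Complex.I) - 1) / (ξ * Complex.I)))
  rw [mul_div_cancel_right₀ _ hξ', one_mul] at h2
  exact h2

theorem expPrim_zero (ξ : ℝ) : expPrim ξ 0 = 0 := by simp [expPrim]

theorem expPrim_one (ξ : ℝ) : expPrim ξ 1 = 0 := by simp [expPrim]

theorem differentiable_expPrim {ξ : ℝ} (hξ : ξ ≠ 0) : Differentiable ℂ (expPrim ξ) :=
  fun z => (hasDerivAt_expPrim hξ z).differentiableAt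

section
variable {α : ℝ} (hα : α ∈ Ioo (0 : ℝ) 1)
include hα

omit hα in
theorem lsvMap_half_add {t : ℝ} (ht : 0 < t) : lsvMap α ((1 + t) / 2) = t := by
  rw [lsvMap, if_neg (by linarith)]
  ring

/-- The point f_n(t) is carried to t by n + 1 applications of `lsvMap α`. -/
theorem branchReal_mem_iff {A : Set ℝ} (hA : lsvMap α ⁻¹' A = A) {t : ℝ} (ht : t ∈ Ioc (0 : ℝ) 1)
    (n : ℕ) : branchReal α n t ∈ A ↔ t ∈ A := by
  have h1 : (1 + t) / 2 ∈ Ioc (0 : ℝ) 1 := ⟨by linarith [ht.1], by linarith [ht.2]⟩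
  have hmem : ∀ x, lsvMap α x ∈ A ↔ x ∈ A := fun x => by
    conv_rhs => rw [← hA]
    rfl
  rw [branchReal]
  induction n with
  | zero => rw [leftInvReal_zero, ← hmem, lsvMap_half_add ht.1]
  | succ n ih => exact ((hmem _).symm.trans (by rw [lsvMap_leftInvReal_succ hα h1])).trans ih

/-- A coboundary-type identity: functions `u - P u` integrate to zero over invariant sets. -/
theorem setIntegral_eq_zero_of_hasSum {A : Set ℝ} (hAm : MeasurableSet A)
    (hA : lsvMap α ⁻¹' A = A) {u g : ℝ → ℂ} (hu : ContinuousOn u (Icc 0 1))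
    (hg : ContinuousOn g (Icc 0 1))
    (hsum : ∀ t ∈ Icc (0 : ℝ) 1, HasSum (fun n => branchDer α n t • u (branchReal α n t))
      (u t - g t)) : ∫ t in Ioc 0 1, A.indicator g t = 0 := by
  have hu1 : IntegrableOn u (Ioc 0 1) := hu.integrableOn_Icc.mono_set Ioc_subset_Icc_self
  have hF : IntegrableOn (A.indicator u) (Ioc 0 1) := hu1.indicator hAm
  have hcongr : ∀ t ∈ Ioc (0 : ℝ) 1,
      HasSum (fun n => branchDer α n t • A.indicator u (branchReal α n t))
        (A.indicator u t - A.indicator g t) := by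
    intro t ht
    -- All f_n(t) lie on the same side of A as t, so the indicator of A passes through the transfer
    -- operator.
    by_cases htA : t ∈ A
    · simp only [indicator_of_mem htA, indicator_of_mem ((branchReal_mem_iff hα hA ht _).2 htA)]
      exact hsum t (Ioc_subset_Icc_self ht)
    · simp only [indicator_of_notMem htA,
        indicator_of_notMem (fun h => htA ((branchReal_mem_iff hα hA ht _).1 h)), smul_zero,
        sub_zero]
      exact hasSum_zero
  have h1 := hasSum_integral_branchReal hα hF
  have hint := integrableOn_branchReal hα hF
  have hnorm : Summable fun n => ∫ t in Ioc 0 1,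
      ‖branchDer α n t • A.indicator u (branchReal α n t)‖ := by
    have := (hasSum_integral_branchReal hα hF.norm).summable
    refine this.congr fun n => setIntegral_congr_fun measurableSet_Ioc fun t ht => ?_
    rw [norm_smul, Real.norm_of_nonneg
      (branchDer_pos hα (Icc_subset_Ioo_three (Ioc_subset_Icc_self ht)) n).le, smul_eq_mul]
  have h2 := hasSum_integral_of_summable_integral_norm hint hnorm
  have h3 := h1.unique h2
  have h4 : ∫ t in Ioc 0 1, ∑' n, branchDer α n t • A.indicator u (branchReal α n t) =
      ∫ t in Ioc 0 1, (A.indicator u t - A.indicator g t) :=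
    setIntegral_congr_fun measurableSet_Ioc fun t ht => (hcongr t ht).tsum_eq
  have hg' : IntegrableOn (A.indicator g) (Ioc 0 1) :=
    (hg.integrableOn_Icc.mono_set Ioc_subset_Icc_self).indicator hAm
  rw [h4, integral_sub hF hg'] at h3
  have h6 := sub_eq_zero.2 h3
  rwa [sub_sub_cancel] at h6

/-- The equation `resolvOp α U = expPrim ξ` has a solution. As `expPrim ξ` vanishes at 0 and 1, the
mass term disappears, and U' is the u in u - Pu = exponential minus its mean. -/
theorem integral_exp_invariant {A : Set ℝ} (hAm : MeasurableSet A) (hA : lsvMap α ⁻¹' A = A)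
    {ξ : ℝ} (hξ : ξ ≠ 0) :
    ∫ t in Ioc 0 1, A.indicator (fun t : ℝ => Complex.exp (ξ * t * Complex.I) -
      (Complex.exp (ξ * Complex.I) - 1) / (ξ * Complex.I)) t = 0 := by
  set Y : CircFun := ⟨fun z => expPrim ξ z,
    (differentiable_expPrim hξ).continuous.comp continuous_subtype_val⟩ with hY
  set U : CircFun := Ring.inverse (resolvOp α) Y with hU
  have hUY : ∀ z : Circ, resolvOp α U z = expPrim ξ z := fun z => by
    rw [hU, resolvOp_inverse_apply hα]; rfl
  have hcont : ContinuousOn (fun t : ℝ => cauchyDer U t) (Icc 0 1) :=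
    (analyticOnNhd_cauchyDer U).continuousOn.comp Complex.continuous_ofReal.continuousOn
      fun t ht => ofReal_mem_ball' ht
  refine setIntegral_eq_zero_of_hasSum hα hAm hA hcont (by fun_prop) fun t ht => ?_
  have h1 := hasSum_deriv_branch_of_resolvOp hα (differentiable_expPrim hξ).differentiableOn hUY
    (expPrim_zero ξ) (ofReal_mem_ball' ht)
  rw [(hasDerivAt_expPrim hξ _).deriv, expPrim_one, sub_zero] at h1
  have ht' := Icc_subset_Ioo_three ht
  convert! h1 using 2 with n
  rw [deriv_branch hα ht', Complex.real_smul, mul_comm, ofReal_branchReal hα ht']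
  rfl

/-- The two measures have the same characteristic function: over an invariant set each exponential
integrates to its mean times the measure of the set. Evaluating the identity at A later gives |A| =
|A|². -/
theorem measure_invariant_eq {A : Set ℝ} (hAm : MeasurableSet A) (hA : lsvMap α ⁻¹' A = A) :
    volume.restrict (A ∩ Ioc 0 1) =
      volume (A ∩ Ioc 0 1) • volume.restrict (Ioc (0 : ℝ) 1) := by
  have hfin : volume (A ∩ Ioc 0 1) ≠ ⊤ :=
    ((measure_mono inter_subset_right).trans_lt (by simp)).ne
  have : IsFiniteMeasure (volume.restrict (A ∩ Ioc 0 1)) := ⟨by simpa using hfin.lt_top⟩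
  have : IsFiniteMeasure (volume (A ∩ Ioc 0 1) • volume.restrict (Ioc (0 : ℝ) 1)) :=
    ⟨by simpa using hfin.lt_top⟩
  refine Measure.ext_of_charFun (funext fun ξ => ?_)
  rw [charFun_apply_real, charFun_apply_real, integral_smul_measure]
  rcases eq_or_ne ξ 0 with rfl | hξ
  · simp [Measure.real]
  have h1 := integral_exp_invariant hα hAm hA hξ
  have h2 := integral_exp_invariant hα .univ preimage_univ hξ
  rw [indicator_univ] at h2
  have hexp : ∀ s : Set ℝ, IntegrableOn (fun t : ℝ => Complex.exp (ξ * t * Complex.I))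
      (s ∩ Ioc 0 1) := fun s => by
    have : Continuous fun t : ℝ => Complex.exp (ξ * t * Complex.I) := by fun_prop
    exact (this.integrableOn_Icc (a := 0) (b := 1)).mono_set
      (inter_subset_right.trans Ioc_subset_Icc_self)
  have hexp1 := hexp univ
  rw [univ_inter] at hexp1
  rw [setIntegral_indicator hAm, inter_comm, integral_sub (hexp A) (integrableOn_const hfin),
    setIntegral_const, sub_eq_zero] at h1
  rw [integral_sub hexp1 (integrableOn_const (by simp)), setIntegral_const, sub_eq_zero] at h2
  rw [h1, h2]
  simp [Measure.real]

theorem measure_invariant {A : Set ℝ} (hAm : MeasurableSet A) (hA : lsvMap α ⁻¹' A = A) :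
    volume (A ∩ Ioc 0 1) = 0 ∨ volume (A ∩ Ioc 0 1) = 1 := by
  have h := congrArg (fun μ : Measure ℝ => μ A) (measure_invariant_eq hα hAm hA)
  simp only [Measure.smul_apply, Measure.restrict_apply hAm, smul_eq_mul] at h
  rw [← inter_assoc, inter_self] at h
  have hfin : volume (A ∩ Ioc 0 1) ≠ ⊤ :=
    ((measure_mono inter_subset_right).trans_lt (by simp)).ne
  by_cases h0 : volume (A ∩ Ioc 0 1) = 0
  · exact Or.inl h0
  · exact Or.inr (((ENNReal.mul_eq_right h0 hfin).1 h.symm))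

theorem ergodic_of_isLSVMeasure {ν : Measure ℝ} (hν : IsLSVMeasure α ν) :
    Ergodic (lsvMap α) ν := by
  have hac : ν ≪ volume.restrict (Ioc 0 1) := by
    rw [restrict_Ioc_eq_restrict_Icc]; exact hν.absolutelyContinuous
  refine ⟨hν.invariant, ⟨fun A hAm hA => ?_⟩⟩
  rw [Filter.eventuallyConst_set', ae_eq_empty, ae_eq_univ]
  rcases measure_invariant hα hAm hA with h | h
  · exact Or.inl (hac (by rwa [Measure.restrict_apply hAm]))
  · refine Or.inr (hac ?_)
    rw [measure_compl hAm (measure_ne_top _ _), Measure.restrict_apply hAm, h]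
    simp

/-- The constructed measure is ergodic and equivalent to Lebesgue measure on [0,1], so ν is
absolutely continuous with respect to it; an invariant probability measure with this property must
coincide with it. -/
theorem isLSVMeasure_unique {ν : Measure ℝ} (hν : IsLSVMeasure α ν) : ν = lsvProbMeasure α := by
  have h := isLSVMeasure_lsvProbMeasure hα
  have := hν.isProbabilityMeasure
  have := h.isProbabilityMeasure
  exact (ergodic_of_isLSVMeasure hα h).eq_of_absolutelyContinuous hν.invariant
    (hν.absolutelyContinuous.trans (absolutelyContinuous_lsvProbMeasure hα))

theorem lsvMeasure_eq : lsvMeasure α = lsvProbMeasure α := by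
  have h : ∃ ν : Measure ℝ, IsLSVMeasure α ν := ⟨_, isLSVMeasure_lsvProbMeasure hα⟩
  rw [lsvMeasure, dif_pos h]
  exact isLSVMeasure_unique hα h.choose_spec

end

/-! ### Dependence of the distribution function on the parameter -/

theorem contDiffOn_distFun : ContDiffOn ℝ 1 distFun (Ioo 0 1) := by
  intro α hα
  obtain ⟨v, hv⟩ := isUnit_resolvOp hα
  have h1 : ContDiffAt ℝ 1 resolvOp α :=
    contDiffAt_const.sub ((contDiffOn_transferOp.contDiffAt (isOpen_Ioo.mem_nhds hα)).sub
      contDiffAt_const)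
  have h2 := contDiffAt_ringInverse ℂ (R := CircFun →L[ℂ] CircFun) (n := 1) v
  rw [hv] at h2
  have : IsScalarTower ℝ ℂ (CircFun →L[ℂ] CircFun) := ⟨fun x y T => by ext; simp [mul_assoc]⟩
  have h3 : ContDiffAt ℂ 1 (fun T : CircFun →L[ℂ] CircFun => Ring.inverse T circId)
      (resolvOp α) := h2.clm_apply contDiffAt_const
  exact ((h3.restrict_scalars ℝ).comp α h1).contDiffWithinAt

theorem hasDerivAt_distFun {α : ℝ} (hα : α ∈ Ioo (0 : ℝ) 1) :
    HasDerivAt distFun (deriv distFun α) α :=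
  contDiffOn_one_hasDerivAt isOpen_Ioo contDiffOn_distFun hα

theorem continuousOn_deriv_distFun : ContinuousOn (deriv distFun) (Ioo 0 1) :=
  contDiffOn_distFun.continuousOn_deriv_of_isOpen isOpen_Ioo le_rfl

/-- The value at 0 is 0 for every parameter. This makes the extension of the derivative small at
g^k(t), as summability requires. -/
theorem cauchyEv_zero_deriv_distFun {α : ℝ} (hα : α ∈ Ioo (0 : ℝ) 1) :
    cauchyEv 0 (deriv distFun α) = 0 := by
  have h1 : HasDerivAt (fun a => cauchyEv 0 (distFun a)) (cauchyEv 0 (deriv distFun α)) α :=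
    ((cauchyEv 0).restrictScalars ℝ).hasFDerivAt.comp_hasDerivAt α (hasDerivAt_distFun hα)
  refine h1.unique ((hasDerivAt_const α (0 : ℂ)).congr_of_eventuallyEq ?_)
  filter_upwards [isOpen_Ioo.mem_nhds hα] with a ha
  exact cauchyEv_zero_distFun ha

theorem cauchyDer_eq (U : CircFun) {y : ℂ} (hy : y ∈ Metric.ball (1 : ℂ) (3 / 2)) :
    cauchyDer U y = circMean (deriv cauchyKer y * U) := by
  have h1 := ((contDiffAt_cauchyKer hy).differentiableAt one_ne_zero).hasDerivAt.mul_const U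
  have h2 := circMean.hasFDerivAt.comp_hasDerivAt y h1
  exact HasDerivAt.deriv h2

theorem continuousOn_deriv_cauchyKer :
    ContinuousOn (deriv cauchyKer) (Metric.ball (1 : ℂ) (3 / 2)) := by
  have h : ContDiffOn ℂ 1 cauchyKer (Metric.ball (1 : ℂ) (3 / 2)) :=
    fun y hy => (contDiffAt_cauchyKer hy).contDiffWithinAt
  exact h.continuousOn_deriv_of_isOpen Metric.isOpen_ball le_rfl

theorem norm_cauchyDer_le (U : CircFun) {y : ℂ} (hy : y ∈ Metric.ball (1 : ℂ) 1) :
    ‖cauchyDer U y‖ ≤ 6 * ‖U‖ := by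
  refine (hasDerivAt_cauchyEv U (ball_one_subset_ball hy)).le_of_lip' (by positivity) ?_
  filter_upwards [Metric.isOpen_ball.mem_nhds hy] with x hx
  have := norm_cauchyEv_sub_le (mem_ball_iff_norm.1 hx).le (mem_ball_iff_norm.1 hy).le U
  linarith

/-- The terms of the parameter derivative of `lsvDistribution`. -/
noncomputable def distTermDot (k : ℕ) (α t : ℝ) : ℂ :=
  leftInvIterDot α k t * cauchyDer (distFun α) (leftInvIter α k t) +
    cauchyEv (leftInvIter α k t) (deriv distFun α)

/-- The parameter derivative of `lsvDistribution`. -/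
noncomputable def lsvDistributionDot (α t : ℝ) : ℝ := ∑' k, (distTermDot k α t).re

theorem hasDerivAt_cauchyEv_comp {w : ℝ → ℂ} {w' : ℂ} {D : ℝ → CircFun} {D' : CircFun} {α : ℝ}
    (hw : HasDerivAt w w' α) (hD : HasDerivAt D D' α)
    (hwα : w α ∈ Metric.ball (1 : ℂ) (3 / 2)) :
    HasDerivAt (fun a => cauchyEv (w a) (D a))
      (w' * cauchyDer (D α) (w α) + cauchyEv (w α) D') α := by
  have h1 := ((contDiffAt_cauchyKer hwα).differentiableAt one_ne_zero).hasDerivAt.scomp α hw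
  have h2 := (circMean.restrictScalars ℝ).hasFDerivAt.comp_hasDerivAt α (h1.mul hD)
  refine h2.congr_deriv ?_
  rw [cauchyDer_eq _ hwα, cauchyEv_apply, ContinuousLinearMap.coe_restrictScalars', map_add,
    smul_mul_assoc, map_smul, smul_eq_mul]
  rfl

theorem hasDerivAt_distReal_param {α t : ℝ} (hα : α ∈ Ioo (0 : ℝ) 1) (ht : t ∈ Ioc (0 : ℝ) 1)
    (k : ℕ) : HasDerivAt (fun a => distReal a (leftInvReal a k t)) (distTermDot k α t).re α := by
  have ht' := ofReal_mem_ball.2 (Ioc_subset_Ioo_two ht)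
  have h1 := hasDerivAt_cauchyEv_comp (hasDerivAt_leftInvIter_param hα ht' k)
    (hasDerivAt_distFun hα) (ball_one_subset_ball (leftInvIter_mem_ball hα ht' k))
  have h2 := Complex.reCLM.hasFDerivAt.comp_hasDerivAt α h1
  refine h2.congr_of_eventuallyEq ?_
  filter_upwards [isOpen_Ioo.mem_nhds hα] with a ha
  rw [distReal, ofReal_leftInvReal ha (Ioc_subset_Ioo_two ht)]
  rfl

/-- Each summand contributes 6Mu: the first through the smallness of the parameter derivative of
g^k, the second because an extension vanishing at 0 is Lipschitz there. -/
theorem norm_distTermDot_le {α t : ℝ} (hα : α ∈ Ioo (0 : ℝ) 1) (ht : t ∈ Ioc (0 : ℝ) 1) {k : ℕ}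
    {u M : ℝ} (hM : ‖distFun α‖ ≤ M) (hM' : ‖deriv distFun α‖ ≤ M)
    (h1 : ‖leftInvIter α k t‖ ≤ u) (h2 : ‖leftInvIterDot α k t‖ ≤ u) :
    ‖distTermDot k α t‖ ≤ 12 * M * u := by
  have ht' := ofReal_mem_ball.2 (Ioc_subset_Ioo_two ht)
  have hw := leftInvIter_mem_ball hα ht' k
  have hM0 : 0 ≤ M := (norm_nonneg _).trans hM
  have hu0 : 0 ≤ u := (norm_nonneg _).trans h1
  have h3 := norm_cauchyEv_sub_le (y := leftInvIter α k t) (x := 0) (mem_ball_iff_norm.1 hw).le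
    (by simp) (deriv distFun α)
  rw [cauchyEv_zero_deriv_distFun hα, sub_zero, sub_zero] at h3
  have h4 : ‖leftInvIterDot α k t * cauchyDer (distFun α) (leftInvIter α k t)‖ ≤ u * (6 * M) := by
    rw [norm_mul]
    have := norm_cauchyDer_le (distFun α) hw
    gcongr
    linarith
  have h5 : 6 * ‖leftInvIter α k t‖ * ‖deriv distFun α‖ ≤ 6 * u * M := by gcongr
  refine (norm_add_le _ _).trans ?_
  linarith

theorem continuousOn_cauchyEv_prod : ContinuousOn (fun p : ℂ × CircFun => cauchyEv p.1 p.2)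
    (Metric.ball (1 : ℂ) (3 / 2) ×ˢ univ) := by
  have h0 : ContinuousOn cauchyKer (Metric.ball (1 : ℂ) (3 / 2)) :=
    fun y hy => (contDiffAt_cauchyKer hy).continuousAt.continuousWithinAt
  have h1 : ContinuousOn (fun p : ℂ × CircFun => cauchyKer p.1)
      (Metric.ball (1 : ℂ) (3 / 2) ×ˢ univ) :=
    h0.comp continuous_fst.continuousOn fun p hp => hp.1
  exact circMean.continuous.comp_continuousOn (h1.mul continuous_snd.continuousOn)

theorem continuousOn_cauchyDer_prod : ContinuousOn (fun p : ℂ × CircFun => cauchyDer p.2 p.1)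
    (Metric.ball (1 : ℂ) (3 / 2) ×ˢ univ) := by
  have h1 : ContinuousOn (fun p : ℂ × CircFun => deriv cauchyKer p.1)
      (Metric.ball (1 : ℂ) (3 / 2) ×ˢ univ) :=
    continuousOn_deriv_cauchyKer.comp continuous_fst.continuousOn fun p hp => hp.1
  exact (circMean.continuous.comp_continuousOn (h1.mul continuous_snd.continuousOn)).congr
    fun p hp => cauchyDer_eq p.2 hp.1

theorem mapsTo_ofReal_prod : MapsTo (fun p : ℝ × ℝ => (p.1, (p.2 : ℂ)))
    (Ioo (0 : ℝ) 1 ×ˢ Ioc (0 : ℝ) 1) (Ioo (0 : ℝ) 1 ×ˢ Metric.ball (1 : ℂ) 1) :=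
  fun _ hp => ⟨hp.1, ofReal_mem_ball.2 (Ioc_subset_Ioo_two hp.2)⟩

theorem continuousOn_leftInvIter_prod (k : ℕ) :
    ContinuousOn (fun p : ℝ × ℝ => leftInvIter p.1 k p.2) (Ioo (0 : ℝ) 1 ×ˢ Ioc (0 : ℝ) 1) :=
  (contDiffOn_leftInvIter k).continuousOn.comp (f := fun p : ℝ × ℝ => (p.1, (p.2 : ℂ)))
    (by fun_prop) mapsTo_ofReal_prod

theorem leftInvIter_mem_ball_prod (k : ℕ) {p : ℝ × ℝ} (hp : p ∈ Ioo (0 : ℝ) 1 ×ˢ Ioc (0 : ℝ) 1) :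
    leftInvIter p.1 k p.2 ∈ Metric.ball (1 : ℂ) (3 / 2) :=
  ball_one_subset_ball (leftInvIter_mem_ball hp.1
    (ofReal_mem_ball.2 (Ioc_subset_Ioo_two hp.2)) k)

theorem continuousOn_distReal_prod (k : ℕ) :
    ContinuousOn (fun p : ℝ × ℝ => distReal p.1 (leftInvReal p.1 k p.2))
      (Ioo (0 : ℝ) 1 ×ˢ Ioc (0 : ℝ) 1) := by
  have hD : ContinuousOn (fun p : ℝ × ℝ => distFun p.1) (Ioo (0 : ℝ) 1 ×ˢ Ioc (0 : ℝ) 1) :=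
    contDiffOn_distFun.continuousOn.comp continuous_fst.continuousOn fun p hp => hp.1
  have h1 := continuousOn_cauchyEv_prod.comp ((continuousOn_leftInvIter_prod k).prodMk hD)
    fun p hp => ⟨leftInvIter_mem_ball_prod k hp, mem_univ _⟩
  refine (Complex.continuous_re.comp_continuousOn h1).congr fun p hp => ?_
  simp only [distReal, ofReal_leftInvReal hp.1 (Ioc_subset_Ioo_two hp.2)]
  rfl

theorem continuousOn_distTermDot_prod (k : ℕ) :
    ContinuousOn (fun p : ℝ × ℝ => (distTermDot k p.1 p.2).re)
      (Ioo (0 : ℝ) 1 ×ˢ Ioc (0 : ℝ) 1) := by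
  have hD : ContinuousOn (fun p : ℝ × ℝ => distFun p.1) (Ioo (0 : ℝ) 1 ×ˢ Ioc (0 : ℝ) 1) :=
    contDiffOn_distFun.continuousOn.comp continuous_fst.continuousOn fun p hp => hp.1
  have hD' : ContinuousOn (fun p : ℝ × ℝ => deriv distFun p.1)
      (Ioo (0 : ℝ) 1 ×ˢ Ioc (0 : ℝ) 1) :=
    continuousOn_deriv_distFun.comp continuous_fst.continuousOn fun p hp => hp.1
  have hw := continuousOn_leftInvIter_prod k
  have h1 := continuousOn_cauchyEv_prod.comp (hw.prodMk hD')
    fun p hp => ⟨leftInvIter_mem_ball_prod k hp, mem_univ _⟩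
  have h2 := continuousOn_cauchyDer_prod.comp (hw.prodMk hD)
    fun p hp => ⟨leftInvIter_mem_ball_prod k hp, mem_univ _⟩
  have h3 := (continuousOn_leftInvIterDot k).comp (f := fun p : ℝ × ℝ => (p.1, (p.2 : ℂ)))
    (by fun_prop) mapsTo_ofReal_prod
  exact Complex.continuous_re.comp_continuousOn ((h3.mul h2).add h1)

theorem exists_summable_bound_distReal {a b : ℝ} (ha : 0 < a) (hab : a ≤ b) (hb : b < 1) :
    ∃ u : ℕ → ℝ, Summable u ∧ ∀ α ∈ Icc a b, ∀ t ∈ Ioc (0 : ℝ) 1, ∀ k,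
      ‖distReal α (leftInvReal α k t)‖ ≤ u k ∧ ‖(distTermDot k α t).re‖ ≤ u k := by
  have hsub : Icc a b ⊆ Ioo (0 : ℝ) 1 := fun x hx => ⟨ha.trans_le hx.1, hx.2.trans_lt hb⟩
  obtain ⟨u, hu, h⟩ := exists_summable_bound_leftInvIter ha hab hb
  obtain ⟨M, hM⟩ := isCompact_Icc.exists_bound_of_continuousOn
    (contDiffOn_distFun.continuousOn.mono hsub)
  obtain ⟨M', hM'⟩ := isCompact_Icc.exists_bound_of_continuousOn
    (continuousOn_deriv_distFun.mono hsub)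
  have hu0 : ∀ k, 0 ≤ u k := fun k => (norm_nonneg _).trans
    (h a ⟨le_rfl, hab⟩ 1 (by simp) k).1
  refine ⟨fun k => 12 * max M M' * u k, hu.mul_left _, fun α hα t ht k => ⟨?_, ?_⟩⟩
  · have h1 := norm_distReal_leftInvReal_le (hsub hα) (fun y hy n => (h α hα y hy n).1) ht k
    have h2 : ‖distFun α‖ ≤ max M M' := (hM α hα).trans (le_max_left _ _)
    have h3 := mul_le_mul_of_nonneg_left h2 (hu0 k)
    have h4 := mul_nonneg ((norm_nonneg _).trans h2) (hu0 k)
    linarith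
  · have hb := h α hα t (ofReal_mem_ball.2 (Ioc_subset_Ioo_two ht)) k
    exact (Complex.abs_re_le_norm _).trans (norm_distTermDot_le (hsub hα) ht
      ((hM α hα).trans (le_max_left _ _)) ((hM' α hα).trans (le_max_right _ _)) hb.1 hb.2)

section
variable {a b : ℝ} (ha : 0 < a) (hab : a ≤ b) (hb : b < 1)
include ha hab hb

omit hab in
theorem Ioo_subset_Ioo_of_bounds : Ioo a b ⊆ Ioo (0 : ℝ) 1 := fun _ hx =>
  ⟨ha.trans hx.1, hx.2.trans hb⟩

theorem hasDerivAt_lsvDistribution {α t : ℝ} (hα : α ∈ Ioo a b) (ht : t ∈ Ioc (0 : ℝ) 1) :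
    HasDerivAt (fun a => lsvDistribution a t) (lsvDistributionDot α t) α := by
  obtain ⟨u, hu, h⟩ := exists_summable_bound_distReal ha hab hb
  exact hasDerivAt_tsum_Ioo hu (fun k x hx =>
    hasDerivAt_distReal_param (Ioo_subset_Ioo_of_bounds ha hb hx) ht k)
    (fun k x hx => (h x (Ioo_subset_Icc_self hx) t ht k).1)
    (fun k x hx => (h x (Ioo_subset_Icc_self hx) t ht k).2) hα

theorem continuousOn_lsvDistribution_prod :
    ContinuousOn (fun p : ℝ × ℝ => lsvDistribution p.1 p.2) (Ioo a b ×ˢ Ioc (0 : ℝ) 1) := by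
  obtain ⟨u, hu, h⟩ := exists_summable_bound_distReal ha hab hb
  exact continuousOn_tsum (fun k => (continuousOn_distReal_prod k).mono
    (prod_mono_left (Ioo_subset_Ioo_of_bounds ha hb))) hu
    fun k p hp => (h p.1 (Ioo_subset_Icc_self hp.1) p.2 hp.2 k).1

theorem continuousOn_lsvDistributionDot_prod :
    ContinuousOn (fun p : ℝ × ℝ => lsvDistributionDot p.1 p.2) (Ioo a b ×ˢ Ioc (0 : ℝ) 1) := by
  obtain ⟨u, hu, h⟩ := exists_summable_bound_distReal ha hab hb
  exact continuousOn_tsum (fun k => (continuousOn_distTermDot_prod k).mono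
    (prod_mono_left (Ioo_subset_Ioo_of_bounds ha hb))) hu
    fun k p hp => (h p.1 (Ioo_subset_Icc_self hp.1) p.2 hp.2 k).2

theorem exists_bound_lsvDistribution : ∃ K : ℝ, ∀ α ∈ Ioo a b, ∀ t ∈ Ioc (0 : ℝ) 1,
    ‖lsvDistribution α t‖ ≤ K ∧ ‖lsvDistributionDot α t‖ ≤ K := by
  obtain ⟨u, hu, h⟩ := exists_summable_bound_distReal ha hab hb
  exact ⟨∑' k, u k, fun α hα t ht =>
    ⟨tsum_of_norm_bounded hu.hasSum fun k => (h α (Ioo_subset_Icc_self hα) t ht k).1,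
      tsum_of_norm_bounded hu.hasSum fun k => (h α (Ioo_subset_Icc_self hα) t ht k).2⟩⟩

end

/-! ### Linear response -/

theorem contDiffOn_integral_of_dominated {X : Type*} [MeasurableSpace X] {μ : Measure X}
    {F F' : ℝ → X → ℝ} {bound : X → ℝ} {s : Set ℝ} (hs : IsOpen s)
    (hF : ∀ α ∈ s, AEStronglyMeasurable (F α) μ) (hF' : ∀ α ∈ s, AEStronglyMeasurable (F' α) μ)
    (hbound : Integrable bound μ) (h : ∀ᵐ x ∂μ, ∀ α ∈ s, ‖F α x‖ ≤ bound x)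
    (h' : ∀ᵐ x ∂μ, ∀ α ∈ s, ‖F' α x‖ ≤ bound x)
    (hderiv : ∀ᵐ x ∂μ, ∀ α ∈ s, HasDerivAt (fun α => F α x) (F' α x) α)
    (hcont : ∀ᵐ x ∂μ, ContinuousOn (fun α => F' α x) s) :
    ContDiffOn ℝ 1 (fun α => ∫ x, F α x ∂μ) s := by
  refine contDiffOn_one_of_hasDerivAt (f' := fun α => ∫ x, F' α x ∂μ) hs (fun α hα => ?_) ?_
  · refine (hasDerivAt_integral_of_dominated_loc_of_deriv_le (hs.mem_nhds hα) ?_ ?_ (hF' α hα) h'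
      hbound hderiv).2
    · filter_upwards [hs.mem_nhds hα] with a ha using hF a ha
    · exact hbound.mono' (hF α hα) (h.mono fun x hx => hx α hα)
  · exact continuousOn_of_dominated hF' (fun α hα => h'.mono fun x hx => hx α hα) hbound hcont

theorem contDiffOn_integral_lsvDistribution_div {ψ : ℝ → ℝ} (hψ : IntegrableOn ψ (Ioc 0 1)) :
    ContDiffOn ℝ 1 (fun α => ∫ t in Ioc 0 1, ψ t * (lsvDistribution α t / lsvDistribution α 1))
      (Ioo 0 1) := by
  have hone : (1 : ℝ) ∈ Ioc (0 : ℝ) 1 := by norm_num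
  have key : ∀ {a b : ℝ}, 0 < a → a ≤ b → b < 1 → ContDiffOn ℝ 1
      (fun α => ∫ t in Ioc 0 1, ψ t * (lsvDistribution α t / lsvDistribution α 1)) (Ioo a b) := by
    intro a b ha hab hb
    have hsub := Ioo_subset_Ioo_of_bounds ha hb
    obtain ⟨K, hK⟩ := exists_bound_lsvDistribution ha hab hb
    have hpos : ∀ α ∈ Ioo a b, 1 ≤ lsvDistribution α 1 := fun α hα =>
      one_le_lsvDistribution_one (hsub hα)
    have hH := continuousOn_lsvDistribution_prod ha hab hb
    have hH' := continuousOn_lsvDistributionDot_prod ha hab hb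
    have hfst : ∀ {f : ℝ × ℝ → ℝ}, ContinuousOn f (Ioo a b ×ˢ Ioc 0 1) → ∀ t ∈ Ioc (0 : ℝ) 1,
        ContinuousOn (fun α => f (α, t)) (Ioo a b) := fun hf t ht =>
      hf.comp (by fun_prop) fun α hα => ⟨hα, ht⟩
    have hsnd : ∀ {f : ℝ × ℝ → ℝ}, ContinuousOn f (Ioo a b ×ˢ Ioc 0 1) → ∀ α ∈ Ioo a b,
        ContinuousOn (fun t => f (α, t)) (Ioc 0 1) := fun hf α hα =>
      hf.comp (by fun_prop) fun t ht => ⟨hα, ht⟩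
    refine contDiffOn_integral_of_dominated isOpen_Ioo
      (F' := fun α t => ψ t * ((lsvDistributionDot α t * lsvDistribution α 1 -
        lsvDistribution α t * lsvDistributionDot α 1) / lsvDistribution α 1 ^ 2))
      -- From the quotient rule, using `lsvDistribution α 1 ≥ 1` in the denominators.
      (bound := fun t => ‖ψ t‖ * (K + K * K)) (fun α hα => ?_) (fun α hα => ?_)
      (hψ.norm.mul_const _) ?_ ?_ ?_ ?_
    · exact hψ.aestronglyMeasurable.mul
        (((hsnd hH α hα).div_const _).aestronglyMeasurable measurableSet_Ioc)
    · exact hψ.aestronglyMeasurable.mul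
        (((((hsnd hH' α hα).mul continuousOn_const).sub
          ((hsnd hH α hα).mul continuousOn_const)).div_const _).aestronglyMeasurable
            measurableSet_Ioc)
    · filter_upwards [ae_restrict_mem measurableSet_Ioc] with t ht α hα
      have h1 := hpos α hα
      have h2 := (hK α hα t ht).1
      have hK0 : 0 ≤ K := (norm_nonneg _).trans h2
      rw [norm_mul, norm_div, Real.norm_of_nonneg (zero_le_one.trans h1)]
      gcongr
      rw [div_le_iff₀ (by linarith)]
      nlinarith [mul_nonneg hK0 hK0]
    · filter_upwards [ae_restrict_mem measurableSet_Ioc] with t ht α hα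
      have h1 := hpos α hα
      have h2 := hK α hα t ht
      have h3 := hK α hα 1 hone
      have hK0 : 0 ≤ K := (norm_nonneg _).trans h2.1
      have h4 : ‖lsvDistribution α t * lsvDistributionDot α 1‖ ≤ K * K := by
        rw [norm_mul]; exact mul_le_mul h2.1 h3.2 (norm_nonneg _) hK0
      have h5 : ‖lsvDistributionDot α t * lsvDistribution α 1‖ ≤ K * lsvDistribution α 1 := by
        rw [norm_mul, Real.norm_of_nonneg (zero_le_one.trans h1)]
        exact mul_le_mul_of_nonneg_right h2.2 (by linarith)
      rw [norm_mul, norm_div, norm_pow, Real.norm_of_nonneg (zero_le_one.trans h1)]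
      gcongr
      rw [div_le_iff₀ (by positivity)]
      refine (norm_sub_le _ _).trans ((add_le_add h5 h4).trans ?_)
      nlinarith [mul_nonneg hK0 hK0, mul_nonneg hK0 (mul_nonneg (zero_le_one.trans h1)
        (sub_nonneg.2 h1)), mul_nonneg (mul_nonneg hK0 hK0) (sub_nonneg.2 (one_le_pow₀ h1 (n := 2)))]
    · filter_upwards [ae_restrict_mem measurableSet_Ioc] with t ht α hα
      exact ((hasDerivAt_lsvDistribution ha hab hb hα ht).div
        (hasDerivAt_lsvDistribution ha hab hb hα hone)
        (zero_lt_one.trans_le (hpos α hα)).ne').const_mul _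
    · filter_upwards [ae_restrict_mem measurableSet_Ioc] with t ht
      exact continuousOn_const.mul ((((hfst hH' t ht).mul (hfst hH 1 hone)).sub
        ((hfst hH t ht).mul (hfst hH' 1 hone))).div ((hfst hH 1 hone).pow 2)
          fun α hα => pow_ne_zero _ (zero_lt_one.trans_le (hpos α hα)).ne')
  intro α hα
  have h1 := hα.1
  have h2 := hα.2
  have := key (a := α / 2) (b := (1 + α) / 2) (by linarith) (by linarith) (by linarith)
  exact (this.contDiffAt (Ioo_mem_nhds (by linarith) (by linarith))).contDiffWithinAt

/-- At the endpoints `deriv φ` may differ from the one-sided derivative, but these form a null set.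
-/
theorem integrableOn_deriv_of_contDiffOn {φ : ℝ → ℝ} (hφ : ContDiffOn ℝ 1 φ (Icc 0 1)) :
    IntegrableOn (deriv φ) (Ioc 0 1) := by
  have h1 : IntegrableOn (derivWithin φ (Icc 0 1)) (Ioo 0 1) :=
    (hφ.continuousOn_derivWithin (uniqueDiffOn_Icc zero_lt_one)
      le_rfl).integrableOn_Icc.mono_set Ioo_subset_Icc_self
  rw [integrableOn_Ioc_iff_integrableOn_Ioo]
  exact h1.congr_fun (fun t ht => derivWithin_of_mem_nhds (Icc_mem_nhds ht.1 ht.2))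
    measurableSet_Ioo

/-- Integration by parts against a probability measure on `(0, 1]`. -/
theorem integral_eq_sub_integral_deriv {ν : Measure ℝ} [IsProbabilityMeasure ν]
    (hν : ∀ᵐ x ∂ν, x ∈ Ioc (0 : ℝ) 1) {φ : ℝ → ℝ} (hφ : ContDiffOn ℝ 1 φ (Icc 0 1)) :
    ∫ x, φ x ∂ν = φ 1 - ∫ t in Ioc 0 1, deriv φ t * ν.real (Ioc 0 t) := by
  have hint := integrableOn_deriv_of_contDiffOn hφ
  -- Fubini for φ'(t) restricted to x ≤ t: integrating in t first gives φ(1) - φ(x), integrating in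
  -- x first gives φ'(t) ν(0,t].
  set S : Set (ℝ × ℝ) := {p | p.1 ≤ p.2}
  have hS : MeasurableSet S := measurableSet_le measurable_fst measurable_snd
  set f : ℝ → ℝ → ℝ := fun x t => S.indicator (fun p => deriv φ p.2) (x, t)
  have hf : Integrable (Function.uncurry f) (ν.prod (volume.restrict (Ioc 0 1))) :=
    (hint.comp_snd ν).indicator hS
  have hinner : ∀ x ∈ Ioc (0 : ℝ) 1, ∫ t in Ioc 0 1, f x t = φ 1 - φ x := by
    intro x hx
    have h1 : (fun t => f x t) = (Ici x).indicator (deriv φ) := rfl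
    have h2 : Ioc 0 1 ∩ Ici x = Icc x 1 := by
      ext t
      simp only [mem_inter_iff, mem_Ioc, mem_Ici, mem_Icc]
      exact ⟨fun h => ⟨h.2, h.1.2⟩, fun h => ⟨⟨hx.1.trans_le h.1, h.2⟩, h.1⟩⟩
    rw [h1, setIntegral_indicator measurableSet_Ici, h2, integral_Icc_eq_integral_Ioc,
      ← intervalIntegral.integral_of_le hx.2]
    exact intervalIntegral.integral_deriv_of_contDiffOn_Icc (hφ.mono (Icc_subset_Icc_left hx.1.le)) hx.2
  have houter : ∀ t ∈ Ioc (0 : ℝ) 1, ∫ x, f x t ∂ν = deriv φ t * ν.real (Ioc 0 t) := by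
    intro t ht
    have h1 : (fun x => f x t) = (Iic t).indicator fun _ => deriv φ t := rfl
    have h2 : ν (Iic t) = ν (Ioc 0 t) := by
      refine measure_congr ?_
      filter_upwards [hν] with x hx
      exact propext ⟨fun h => ⟨hx.1, h⟩, fun h => h.2⟩
    rw [h1, integral_indicator_const _ measurableSet_Iic, smul_eq_mul, mul_comm, Measure.real, h2,
      Measure.real]
  have hae : (fun x => ∫ t in Ioc 0 1, f x t) =ᵐ[ν] fun x => φ 1 - φ x :=
    hν.mono fun x hx => hinner x hx
  have hφint : Integrable φ ν := by
    have h1 : Integrable (fun x => φ 1 - φ x) ν := hf.integral_prod_left.congr hae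
    exact ((integrable_const (φ 1)).sub h1).congr (ae_of_all _ fun x => sub_sub_cancel _ _)
  have hswap := integral_integral_swap hf
  rw [integral_congr_ae hae, integral_sub (integrable_const _) hφint,
    setIntegral_congr_fun measurableSet_Ioc houter] at hswap
  simp only [integral_const, probReal_univ, one_smul] at hswap
  linarith

theorem integral_lsvMeasure {α : ℝ} (hα : α ∈ Ioo (0 : ℝ) 1) {φ : ℝ → ℝ}
    (hφ : ContDiffOn ℝ 1 φ (Icc 0 1)) :
    ∫ x, φ x ∂(lsvMeasure α) =
      φ 1 - ∫ t in Ioc 0 1, deriv φ t * (lsvDistribution α t / lsvDistribution α 1) := by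
  have h := isLSVMeasure_lsvProbMeasure hα
  have := h.isProbabilityMeasure
  have hν : ∀ᵐ x ∂(lsvProbMeasure α), x ∈ Ioc (0 : ℝ) 1 := by
    have hac := h.absolutelyContinuous
    rw [← restrict_Ioc_eq_restrict_Icc] at hac
    exact hac.ae_le (ae_restrict_mem measurableSet_Ioc)
  rw [lsvMeasure_eq hα, integral_eq_sub_integral_deriv hν hφ]
  congr 1
  refine setIntegral_congr_fun measurableSet_Ioc fun t ht => ?_
  have h1 := one_le_lsvDistribution_one hα
  simp only [Measure.real, lsvProbMeasure_Ioc hα ht]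
  rw [ENNReal.toReal_ofReal (div_nonneg (lsvDistribution_nonneg hα ht) (by linarith))]

theorem mainTheorem2 :
    (∀ α ∈ Ioo (0 : ℝ) 1,
      IsLSVMeasure α (lsvMeasure α) ∧
        ∀ ν : Measure ℝ, IsLSVMeasure α ν → ν = lsvMeasure α) ∧
    ∀ φ : ℝ → ℝ, ContDiffOn ℝ 1 φ (Icc 0 1) →
      ContDiffOn ℝ 1 (fun α : ℝ => ∫ x, φ x ∂(lsvMeasure α)) (Ioo 0 1) := by
  refine ⟨fun α hα => ?_, fun φ hφ => ?_⟩
  · rw [lsvMeasure_eq hα]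
    exact ⟨isLSVMeasure_lsvProbMeasure hα, fun ν hν => isLSVMeasure_unique hα hν⟩
  · exact (contDiffOn_const.sub (contDiffOn_integral_lsvDistribution_div
      (integrableOn_deriv_of_contDiffOn hφ))).congr fun α hα => integral_lsvMeasure hα hφ
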